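/- **Setting.** Let $0=s_0<s_1<\cdots$ be a partition of $[0,\infty)$ such that, for some integer $d\ge 1$, the intervals $A_j=(s_{j-1},s_j]$ satisfy $|A_{j+d}|=|A_j|$ for all $j\ge1$. Put $\tau=\sum_{j=1}^d|A_j|$ and $\mathfrak D_j=\bigcup_{k\ge0}A_{j+kd}$. Let $\lambda_1,\dots,\lambda_d\ge0$, $\lambda(u)=\sum_{j=1}^d\lambda_j\mathbf 1_{\mathfrak D_j}(u)$ and $\Lambda(t)=\int_0^t\lambda(u)\,du$. Let $(N(t))_{t\ge0}$ be a non-homogeneous Poisson process with mean function $\Lambda$ and jump times $\Upsilon_1<\Upsilon_2<\cdots$ ($\Upsilon_0=0$). Let $F_1,\dots,F_d$ be probability distributions on $\mathbb R$ with $\int z^2F_j(dz)<\infty$, and let $Z_n^{(j)}\sim F_j$ ($n\ge1$, $1\le j\le d$) be independent random variables, independent of $N$. Put $Z_n=\sum_{j=1}^dZ_n^{(j)}\mathbf 1_{\{\Upsilon_n\in\mathfrak D_j\}}$ and $S_t=\delta t+\sum_{n=1}^{N(t)}Z_n$ with $\delta\in\mathbb R$. Its quadratic variation is $[S,S]_t=\sum_{0<u\le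 t}(\Delta S_u)^2$. Let $q\ge p\ge1$ be integers, $\alpha_0>0$, $\alpha_1,\dots,\alpha_q,\beta_1,\dots,\beta_q\in\mathbb R$ with $\alpha_p\ne0$, $\beta_q\neq0$ and $\alpha_{p+1}=\cdots=\alpha_q=0$. Let $B$ be the $q\times q$ companion matrix with ones on the superdiagonal, last row $(-\beta_q,-\beta_{q-1},\dots,-\beta_1)$ and zeros elsewhere, and let $\mathbf a=(\alpha_1,\dots,\alpha_q)'$, $\mathbf e=(0,\dots,0,1)'$. Let $(\mathbf Y_t)_{t\ge0}$ be a càdlàg solution of $$d\mathbf Y_t=B\mathbf Y_{t^-}\,dt+\mathbf e(\alpha_0+\mathbf a'\mathbf Y_{t^-})\,d[S,S]_t,\qquad t>0,$$ whose initial value $\mathbf Y_0$ is independent of $(S_t)_{t\ge0}$. For $0\le u\le t$, with $k=N(u)$, $n=N(t)$, $C_i=(I+Z_i^2\mathbf e\mathbf a')e^{B(\Upsilon_i-\Upsilon_{i-1})}$ and $\mathbf D_i=\alpha_0Z_i^2\mathbf e$, put $$J_{u,t}=e^{B(t-\Upsilon_n)}\,C_nC_{n-1}\cdots C_{k+1}\,e^{B(\Upsilon_k-u)},\qquad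 \mathbf K_{u,t}=e^{B(t-\Upsilon_n)}\sum_{i=0}^{n-k-1}C_n\cdots C_{n-i+1}\mathbf D_{n-i},$$ where empty products are $I$ and empty sums are $0$; these are the random coefficients in the recurrence $\mathbf Y_t=J_{u,t}\mathbf Y_u+\mathbf K_{u,t}$. For $r\in[1,\infty]$ let $\|C\|_r=\sup_{c\in\mathbb C^q\setminus\{0\}}\|Cc\|_r/\|c\|_r$, and let $\eta$ be the largest real part of an eigenvalue of $B$. **Theorem.** Assume that (i) the eigenvalues of $B$ are distinct and have strictly negative real parts; (ii) there are $r\in[1,\infty]$ and an invertible complex matrix $P$ with $P^{-1}BP$ diagonal such that, for all $t\in[0,\tau]$ and $j=1,\dots,d$, $$\int_{\mathbb R}\log\bigl(1+\|P^{-1}\mathbf e\mathbf a'P\|_r\,z^2\bigr)F_j(dz)<-\frac{\eta\tau}{\Lambda(t+\tau)-\Lambda(t)}$$ (the right-hand side being read as $+\infty$ if $\Lambda(t+\tau)=\Lambda(t)$). Then, for each fixed $t\in[0,\tau)$, $\mathbf Y_{t+m\tau}$ converges in distribution, as $m\to\infty$, to a random vector $\mathbf U^{(t)}$ in $\mathbb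 R^q$. The law of $\mathbf U^{(t)}$ is the unique probability law on $\mathbb R^q$ satisfying $$\mathbf U^{(t)}\overset{d}{=}J_{t,t+\tau}\mathbf U^{(t)}+\mathbf K_{t,t+\tau},\qquad \mathbf U^{(t)}\text{ independent of }(J_{t,t+\tau},\mathbf K_{t,t+\tau}).$$ -/

import Mathlib

open MeasureTheory ProbabilityTheory Set Filter Topology
open scoped ENNReal NNReal Matrix

noncomputable section

namespace SLDCogarch

/-! ### The periodic partition and the intensity -/

/-- `0 = s 0 < s 1 < ⋯` cuts the positive half-line into the intervals `A_j = (s (j-1), s j]`,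
whose lengths are periodic in `j` with period `d ≥ 1`. -/
structure IsPeriodicPartition (d : ℕ) (s : ℕ → ℝ) : Prop where
  d_pos : 0 < d
  zero : s 0 = 0
  strictMono : StrictMono s
  periodic : ∀ j, s (j + d + 1) - s (j + d) = s (j + 1) - s j

/-- The period `τ = |A_1| + ⋯ + |A_d|`. -/
def period (d : ℕ) (s : ℕ → ℝ) : ℝ := ∑ j ∈ Finset.range d, (s (j + 1) - s j)

/-- The union of all the intervals whose index is congruent to that of `A_{j+1}` modulo `d`
(so `j : Fin d` is the season that is numbered `j + 1` in mathematical notation). -/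
def season (d : ℕ) (s : ℕ → ℝ) (j : Fin d) : Set ℝ :=
  ⋃ k : ℕ, Ioc (s (j + k * d)) (s (j + 1 + k * d))

/-- The intensity function, equal to `lam j` on the `j`-th season. -/
def intensity (d : ℕ) (s : ℕ → ℝ) (lam : Fin d → ℝ) (u : ℝ) : ℝ :=
  ∑ j, (season d s j).indicator (fun _ => lam j) u

/-- The mean function `Λ(t) = ∫_0^t λ(u) du`. -/
def cumIntensity (d : ℕ) (s : ℕ → ℝ) (lam : Fin d → ℝ) (t : ℝ) : ℝ :=
  ∫ u in (0 : ℝ)..t, intensity d s lam u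

/-! ### The driving process

Processes are indexed by `ℝ`, but only their values at times `t ≥ 0` are ever constrained or used.
-/

section Driving

variable {Ω : Type*} [MeasurableSpace Ω]

/-- `N` is a (non-homogeneous) Poisson process on `[0, ∞)` with mean function `Λ`: a counting
process (started at `0`, nondecreasing, right-continuous, with jumps of size one) with independent
increments, the increment over `(u, t]` being Poisson distributed with mean `Λ t - Λ u`. -/
structure IsPoissonProcess (N : ℝ → Ω → ℕ) (Λ : ℝ → ℝ) (P : Measure Ω) : Prop where
  measurable : ∀ t, 0 ≤ t → Measurable (N t)
  zero : ∀ ω, N 0 ω = 0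
  mono : ∀ ω, MonotoneOn (fun t => N t ω) (Ici 0)
  rightCont : ∀ ω t, 0 ≤ t → ContinuousWithinAt (fun u => N u ω) (Ici t) t
  unitJumps : ∀ ω t, 0 < t → ∃ u, 0 ≤ u ∧ u < t ∧ N t ω ≤ N u ω + 1
  indepIncrements : HasIndepIncrements (fun t : ℝ≥0 => N t) P
  law_increment : ∀ u t, 0 ≤ u → u ≤ t →
    HasLaw (fun ω => N t ω - N u ω) (poissonMeasure (Λ t - Λ u).toNNReal) P

/-- The time of the `n`-th jump of `N`, with value `0` for `n = 0`. (It is only used for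
`n ≤ N t`, that is for jumps that do occur.) -/
def arrival (N : ℝ → Ω → ℕ) (n : ℕ) (ω : Ω) : ℝ := sInf {u : ℝ | 0 ≤ u ∧ n ≤ N u ω}

/-- The size `Z_n = ∑_j Z_n^{(j)} 1{Υ_n in season j}` of the `n`-th jump. -/
def jumpSize (d : ℕ) (s : ℕ → ℝ) (N : ℝ → Ω → ℕ) (Z : Fin d → ℕ → Ω → ℝ) (n : ℕ) (ω : Ω) : ℝ :=
  ∑ j, (season d s j).indicator (fun _ => Z j n ω) (arrival N n ω)

/-- The semi-Lévy compound Poisson process `S_t = δ t + ∑_{n=1}^{N(t)} Z_n`. -/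
def drivingProcess (d : ℕ) (s : ℕ → ℝ) (N : ℝ → Ω → ℕ) (Z : Fin d → ℕ → Ω → ℝ) (δ : ℝ)
    (t : ℝ) (ω : Ω) : ℝ :=
  δ * t + ∑ n ∈ Finset.Icc 1 (N t ω), jumpSize d s N Z n ω

/-- The standing assumptions on the ingredients of a semi-Lévy compound Poisson process: a periodic
partition, season rates `lam j ≥ 0`, season jump distributions `F j` with finite second moment, a
Poisson process with the associated mean function, and independent variables `Z j n ∼ F j` that are
also independent of that Poisson process. -/
structure IsSemiLevyCompoundPoisson (d : ℕ) (s : ℕ → ℝ) (lam : Fin d → ℝ) (F : Fin d → Measure ℝ)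
    (N : ℝ → Ω → ℕ) (Z : Fin d → ℕ → Ω → ℝ) (P : Measure Ω) : Prop where
  partition : IsPeriodicPartition d s
  lam_nonneg : ∀ j, 0 ≤ lam j
  prob : ∀ j, IsProbabilityMeasure (F j)
  secondMoment : ∀ j, Integrable (fun z : ℝ => z ^ 2) (F j)
  poisson : IsPoissonProcess N (cumIntensity d s lam) P
  measurable_jump : ∀ j n, Measurable (Z j n)
  law_jump : ∀ j n, HasLaw (Z j n) (F j) P
  indep_jumps : iIndepFun (fun i : Fin d × ℕ => Z i.1 i.2) P
  indep_counting : IndepFun (fun ω (t : ℝ≥0) => N t ω) (fun ω (i : Fin d × ℕ) => Z i.1 i.2 ω) P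

end Driving

/-- The random measure `d[S,S]` of a path `S` of finite variation with `S 0 = 0` whose continuous
part does not contribute: `[S,S]_t = ∑_{0 < u ≤ t} (ΔS_u)²`, so `d[S,S] = ∑_{u > 0} (ΔS_u)² δ_u`,
where `ΔS_u = S_u - S_{u-}`. -/
def quadVarMeasure (S : ℝ → ℝ) : Measure ℝ :=
  Measure.sum fun u : Ioi (0 : ℝ) =>
    ENNReal.ofReal ((S u - Function.leftLim S u) ^ 2) • Measure.dirac (u : ℝ)

/-! ### Coefficients and the state process -/

/-- The companion matrix with superdiagonal entries `1` and last row `(-β_q, …, -β_1)`. -/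
def companion (q : ℕ) (β : ℕ → ℝ) : Matrix (Fin q) (Fin q) ℝ :=
  Matrix.of fun i k =>
    if (i : ℕ) + 1 = q then -β (q - k) else if (k : ℕ) = i + 1 then 1 else 0

/-- The vector `a = (α_1, …, α_q)`. -/
def aVec (q : ℕ) (α : ℕ → ℝ) : Fin q → ℝ := fun i => α (i + 1)

/-- The vector `e = (0, …, 0, 1)`. -/
def eVec (q : ℕ) : Fin q → ℝ := fun i => if (i : ℕ) + 1 = q then 1 else 0

/-- The constraints on the orders `p, q` and the parameters `α_0, …, α_q, β_1, …, β_q`. -/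
structure IsCogarchParam (p q : ℕ) (α β : ℕ → ℝ) : Prop where
  one_le_p : 1 ≤ p
  p_le_q : p ≤ q
  alpha_zero : 0 < α 0
  alpha_p : α p ≠ 0
  alpha_gt : ∀ k, p < k → k ≤ q → α k = 0
  beta_q : β q ≠ 0

/-- `Y` is a càdlàg solution of `dY_t = B Y_{t-} dt + e (α_0 + a' Y_{t-}) d[S,S]_t`, `t > 0`, with
an initial value that is independent of the driving process `S`. -/
structure IsStateProcess {Ω : Type*} [MeasurableSpace Ω] (q : ℕ) (α β : ℕ → ℝ) (S : ℝ → Ω → ℝ)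
    (Y : ℝ → Ω → Fin q → ℝ) (P : Measure Ω) : Prop where
  measurable : ∀ t, 0 ≤ t → Measurable (Y t)
  indep_init : IndepFun (Y 0) (fun ω (t : ℝ≥0) => S t ω) P
  rightCont : ∀ᵐ ω ∂P, ∀ t, 0 ≤ t → ContinuousWithinAt (fun u => Y u ω) (Ici t) t
  leftLimits : ∀ᵐ ω ∂P, ∀ t, 0 < t → ∃ y, Tendsto (fun u => Y u ω) (𝓝[<] t) (𝓝 y)
  sde : ∀ᵐ ω ∂P, ∀ t, 0 ≤ t →
    Y t ω = Y 0 ω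
      + (∫ u in (0 : ℝ)..t, companion q β *ᵥ Function.leftLim (fun v => Y v ω) u)
      + ∫ u in Ioc 0 t,
          (α 0 + aVec q α ⬝ᵥ Function.leftLim (fun v => Y v ω) u) • eVec q
            ∂quadVarMeasure (fun v => S v ω)

/-! ### The random coefficients `J_{u,t}` and `K_{u,t}` of the recurrence `Y_t = J Y_u + K`

Here `T n` and `z n` are the time and the size of the `n`-th jump, `T 0 = 0`, and `k`, `n` are the
numbers of jumps in `(0, u]` and `(0, t]`. -/

/-- `C_i = (I + z_i² e a') exp(B (T_i - T_{i-1}))`. -/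
def stepMatrix (q : ℕ) (α β : ℕ → ℝ) (T z : ℕ → ℝ) (i : ℕ) : Matrix (Fin q) (Fin q) ℝ :=
  (1 + z i ^ 2 • Matrix.vecMulVec (eVec q) (aVec q α)) *
    NormedSpace.exp ((T i - T (i - 1)) • companion q β)

/-- The ordered product `C_{k+n} ⋯ C_{k+2} C_{k+1}`. -/
def descProd {q : ℕ} (C : ℕ → Matrix (Fin q) (Fin q) ℝ) (k : ℕ) : ℕ → Matrix (Fin q) (Fin q) ℝ
  | 0 => 1
  | n + 1 => C (k + n + 1) * descProd C k n

/-- `exp(B (t - T_n)) C_n ⋯ C_{k+1} exp(B (T_k - u))`. -/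
def pathJ (q : ℕ) (α β : ℕ → ℝ) (T z : ℕ → ℝ) (k n : ℕ) (u t : ℝ) : Matrix (Fin q) (Fin q) ℝ :=
  NormedSpace.exp ((t - T n) • companion q β) * descProd (stepMatrix q α β T z) k (n - k) *
    NormedSpace.exp ((T k - u) • companion q β)

/-- `exp(B (t - T_n)) (D_n + C_n D_{n-1} + ⋯ + C_n ⋯ C_{k+2} D_{k+1})`, `D_i = α_0 z_i² e`
(the sum being `0` if `n = k`). -/
def pathK (q : ℕ) (α β : ℕ → ℝ) (T z : ℕ → ℝ) (k n : ℕ) (t : ℝ) : Fin q → ℝ :=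
  NormedSpace.exp ((t - T n) • companion q β) *ᵥ
    ∑ i ∈ Finset.range (n - k),
      descProd (stepMatrix q α β T z) (n - i) i *ᵥ ((α 0 * z (n - i) ^ 2) • eVec q)

section Coeff

variable {Ω : Type*}

/-- The random matrix `J_{u,t}`. -/
def coeffJ (q : ℕ) (α β : ℕ → ℝ) (d : ℕ) (s : ℕ → ℝ) (N : ℝ → Ω → ℕ) (Z : Fin d → ℕ → Ω → ℝ)
    (u t : ℝ) (ω : Ω) : Matrix (Fin q) (Fin q) ℝ :=
  pathJ q α β (fun n => arrival N n ω) (fun n => jumpSize d s N Z n ω) (N u ω) (N t ω) u t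

/-- The random vector `K_{u,t}`. -/
def coeffK (q : ℕ) (α β : ℕ → ℝ) (d : ℕ) (s : ℕ → ℝ) (N : ℝ → Ω → ℕ) (Z : Fin d → ℕ → Ω → ℝ)
    (u t : ℝ) (ω : Ω) : Fin q → ℝ :=
  pathK q α β (fun n => arrival N n ω) (fun n => jumpSize d s N Z n ω) (N u ω) (N t ω) t

/-- `ν` solves `U =ᵈ J U + K` with `U ∼ ν` independent of `(J, K)`: on the product space `P ⊗ ν`
the second coordinate `U` has law `ν` and is independent of `(J, K)`, which is a function of the
first coordinate, and `J U + K` again has law `ν`. -/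
def SolvesRecurrence [MeasurableSpace Ω] {q : ℕ} (P : Measure Ω)
    (J : Ω → Matrix (Fin q) (Fin q) ℝ) (K : Ω → Fin q → ℝ) (ν : Measure (Fin q → ℝ)) : Prop :=
  HasLaw (fun x : Ω × (Fin q → ℝ) => J x.1 *ᵥ x.2 + K x.1) ν (P.prod ν)

end Coeff

/-! ### Eigenvalues and norms -/

/-- A real matrix seen as a complex one. -/
def toComplex {q : ℕ} (M : Matrix (Fin q) (Fin q) ℝ) : Matrix (Fin q) (Fin q) ℂ :=
  M.map Complex.ofReal

/-- The complex eigenvalues of a real matrix, with multiplicity. -/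
def eigenvalues {q : ℕ} (M : Matrix (Fin q) (Fin q) ℝ) : Multiset ℂ := (toComplex M).charpoly.roots

/-- The largest real part of an eigenvalue. -/
def maxRe {q : ℕ} (M : Matrix (Fin q) (Fin q) ℝ) : ℝ :=
  sSup (Complex.re '' {z | z ∈ eigenvalues M})

/-- The matrix norm `sup_{c ≠ 0} ‖C c‖_r / ‖c‖_r` induced by the `L^r`-norm of `ℂ^q`. -/
def matrixLpNorm {q : ℕ} (r : ℝ≥0∞) (C : Matrix (Fin q) (Fin q) ℂ) : ℝ :=
  ⨆ c : {c : Fin q → ℂ // c ≠ 0}, ‖WithLp.toLp r (C *ᵥ c.1)‖ / ‖WithLp.toLp r c.1‖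

end SLDCogarch

end

/-!
Over a window of one period the state process satisfies `Y_{t + (m+1)τ} = J_m Y_{t + mτ} + K_m`,
and the theorem is an instance of the theory of iterated random affine maps: the pairs `(J_m, K_m)`
are independent and identically distributed, and they contract on average.

*Recurrence.* Between jumps `Y` follows the flow of `B`, and at a jump it is multiplied by
`I + Z² e a'` and shifted by `α_0 Z² e`, because `d[S,S]` is a sum of point masses `Z_n²` at the
jump times. Since `Y` is càdlàg, this follows pathwise from the integral equation
(`IsPoissonProcess.state_recurrence`).

*Independence.* The pair `(J_m, K_m)` is a measurable function `(blockJ, blockK)` of the *block* of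
the `m`-th window (`markedBlock`): the number, the local times and the sizes of its jumps. It is
built from the increments of `N` over the window, and from the marks `Z_n^{(j)}` with
`n > N(t + mτ)`. By independent increments and periodicity of the intensity, and because the marks
after a random index determined by the past of `N` are again independent copies
(`indepFun_split_marks`), the blocks form an i.i.d. sequence
(`IsPoissonProcess.isIIDSeq_markedBlock`).

*Contraction.* In the norm `‖M⁻¹ v‖_r` of the diagonalising coordinates (`diagNorm`), the flow
`exp(sB)` has norm at most `exp(ηs)` and a jump of size `z` has norm at most `1 + κ z²`, with `κ`
the norm of `M⁻¹ e a' M`. Hence `log ‖J_m‖ ≤ ητ + ∑ log(1 + κ z_i²)`, the sum being over the jumps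
of the window, and `log ‖K_m‖` has a similar bound (`IsAdaptedNorm.blockJ_le`,
`IsAdaptedNorm.blockK_le`). By Wald's identity the sum has expectation at most
`(Λ(t+τ) - Λ(t)) max_j ∫ log(1 + κ z²) F_j(dz)` (`IsPoissonProcess.integrable_blockSum`), so that
the logarithmic moment condition makes the expectation of the bound negative.

*Stationary law.* For i.i.d. maps that contract on average, the strong law of large numbers makes
the backward iterates `f_0 ∘ ⋯ ∘ f_{m-1}(x)` converge almost surely, with a limit that does not
depend on `x`. Its law is invariant, it is the limit law of the forward iterates, which have the
same laws as the backward ones, and a further invariant law would have to agree with it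
(`IsIIDSeq.exists_stationary_law`). Iterates of different initial states approach each other almost
surely, whatever the initial states are.
-/

noncomputable section

namespace SLDCogarch

/-! ### Iterated random Lipschitz maps -/

section IteratedMaps

variable {𝓑 V : Type*}

/-- The backward composition `f (r 0) ∘ f (r 1) ∘ ⋯ ∘ f (r (m - 1))`. -/
def bwdIter (f : 𝓑 → V → V) (r : ℕ → 𝓑) : ℕ → V → V
  | 0, x => x
  | m + 1, x => bwdIter f r m (f (r m) x)

/-- The forward composition `f (r (m - 1)) ∘ ⋯ ∘ f (r 1) ∘ f (r 0)`. -/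
def fwdIter (f : 𝓑 → V → V) (r : ℕ → 𝓑) : ℕ → V → V
  | 0, x => x
  | m + 1, x => f (r m) (fwdIter f r m x)

lemma bwdIter_congr (f : 𝓑 → V → V) {r r' : ℕ → 𝓑} {m : ℕ} (h : ∀ i < m, r i = r' i) (x : V) :
    bwdIter f r m x = bwdIter f r' m x := by
  induction m generalizing x with
  | zero => rfl
  | succ m ih =>
    simp only [bwdIter]
    rw [h m (Nat.lt_succ_self m), ih fun i hi => h i (hi.trans (Nat.lt_succ_self m))]

lemma fwdIter_congr (f : 𝓑 → V → V) {r r' : ℕ → 𝓑} {m : ℕ} (h : ∀ i < m, r i = r' i) (x : V) :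
    fwdIter f r m x = fwdIter f r' m x := by
  induction m with
  | zero => rfl
  | succ m ih =>
    simp only [fwdIter]
    rw [h m (Nat.lt_succ_self m), ih fun i hi => h i (hi.trans (Nat.lt_succ_self m))]

section Measurability

variable [MeasurableSpace 𝓑] [MeasurableSpace V] {f : 𝓑 → V → V}

lemma measurable_bwdIter (hf : Measurable (Function.uncurry f)) (m : ℕ) :
    Measurable fun p : (ℕ → 𝓑) × V => bwdIter f p.1 m p.2 := by
  induction m with
  | zero => exact measurable_snd
  | succ m ih =>
    have h0 : Measurable fun p : (ℕ → 𝓑) × V => (p.1 m, p.2) :=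
      ((measurable_pi_apply m).comp measurable_fst).prodMk measurable_snd
    exact ih.comp (measurable_fst.prodMk (hf.comp h0))

lemma measurable_fwdIter (hf : Measurable (Function.uncurry f)) (m : ℕ) :
    Measurable fun p : (ℕ → 𝓑) × V => fwdIter f p.1 m p.2 := by
  induction m with
  | zero => exact measurable_snd
  | succ m ih =>
    exact hf.comp (((measurable_pi_apply m).comp measurable_fst).prodMk ih)

/-- The law of `f R U` when `R ∼ ρ` and `U ∼ ν` are independent. -/
def transfer (f : 𝓑 → V → V) (ρ : Measure 𝓑) (ν : Measure V) : Measure V :=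
  (ρ.prod ν).map (Function.uncurry f)

lemma isProbabilityMeasure_transfer (hf : Measurable (Function.uncurry f)) (ρ : Measure 𝓑)
    [IsProbabilityMeasure ρ] (ν : Measure V) [IsProbabilityMeasure ν] :
    IsProbabilityMeasure (transfer f ρ ν) :=
  Measure.isProbabilityMeasure_map hf.aemeasurable

/-- A sequence of identically distributed random elements, each of them independent of the
preceding ones. -/
structure IsIIDSeq {Ω : Type*} [MeasurableSpace Ω] (R : ℕ → Ω → 𝓑) (ρ : Measure 𝓑)
    (P : Measure Ω) : Prop where
  measurable : ∀ m, Measurable (R m)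
  map_eq : ∀ m, P.map (R m) = ρ
  indep_past : ∀ m, IndepFun (fun ω (i : Fin m) => R i ω) (R m) P

variable {Ω : Type*} [MeasurableSpace Ω] {P : Measure Ω} {R : ℕ → Ω → 𝓑}
  {ρ : Measure 𝓑}

lemma IsIIDSeq.isProbabilityMeasure [IsProbabilityMeasure P] (hR : IsIIDSeq R ρ P) :
    IsProbabilityMeasure ρ := by
  rw [← hR.map_eq 0]
  exact Measure.isProbabilityMeasure_map (hR.measurable 0).aemeasurable

lemma IsIIDSeq.map_prod [IsProbabilityMeasure P] (hR : IsIIDSeq R ρ P) (m : ℕ) :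
    P.map (fun ω => ((fun i : Fin m => R i ω), R m ω))
      = (P.map fun ω (i : Fin m) => R i ω).prod ρ := by
  have h1 : Measurable fun ω (i : Fin m) => R i ω :=
    measurable_pi_lambda _ fun i => hR.measurable i
  rw [← hR.map_eq m]
  exact (indepFun_iff_map_prod_eq_prod_map_map h1.aemeasurable
    (hR.measurable m).aemeasurable).1 (hR.indep_past m)

lemma IsIIDSeq.pairwise (hR : IsIIDSeq R ρ P) {g : 𝓑 → ℝ} (hg : Measurable g) :
    Pairwise (Function.onFun (fun X Y => IndepFun X Y P) fun m ω => g (R m ω)) := by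
  have key : ∀ i j, i < j → IndepFun (fun ω => g (R i ω)) (fun ω => g (R j ω)) P := fun i j hij =>
    (hR.indep_past j).comp (φ := fun p : Fin j → 𝓑 => g (p ⟨i, hij⟩))
      (hg.comp (measurable_pi_apply _)) hg
  intro i j hij
  rcases lt_or_gt_of_ne hij with h | h
  · exact key i j h
  · exact (key j i h).symm

lemma IsIIDSeq.identDistrib (hR : IsIIDSeq R ρ P) {g : 𝓑 → ℝ} (hg : Measurable g) (m : ℕ) :
    IdentDistrib (fun ω => g (R m ω)) (fun ω => g (R 0 ω)) P P :=
  IdentDistrib.comp ⟨(hR.measurable m).aemeasurable, (hR.measurable 0).aemeasurable,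
    (hR.map_eq m).trans (hR.map_eq 0).symm⟩ hg

lemma IsIIDSeq.strong_law (hR : IsIIDSeq R ρ P) {g : 𝓑 → ℝ} (hg : Measurable g)
    (hint : Integrable g ρ) :
    ∀ᵐ ω ∂P, Tendsto (fun n : ℕ => (∑ i ∈ Finset.range n, g (R i ω)) / n) atTop
      (𝓝 (∫ r, g r ∂ρ)) := by
  have hi : Integrable (fun ω => g (R 0 ω)) P := by
    rw [← hR.map_eq 0] at hint
    exact hint.comp_measurable (hR.measurable 0)
  have he : ∫ r, g r ∂ρ = ∫ ω, g (R 0 ω) ∂P := by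
    rw [← hR.map_eq 0, integral_map (hR.measurable 0).aemeasurable hg.aestronglyMeasurable]
  rw [he]
  exact strong_law_ae_real (fun m ω => g (R m ω)) hi (hR.pairwise hg) (hR.identDistrib hg)

/-- The next map of the backward iteration is independent of the preceding ones, so that it can
be absorbed into the initial law. -/
theorem IsIIDSeq.map_bwdIter [IsProbabilityMeasure P] (hR : IsIIDSeq R ρ P)
    (hf : Measurable (Function.uncurry f)) (m : ℕ) (ν : Measure V) [IsProbabilityMeasure ν] :
    (P.prod ν).map (fun p => bwdIter f (fun i => R i p.1) m p.2) = (transfer f ρ)^[m] ν := by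
  have := hR.isProbabilityMeasure
  induction m generalizing ν with
  | zero =>
    simp only [bwdIter, Function.iterate_zero, id]
    exact Measure.map_snd_prod.trans (by simp)
  | succ m ih =>
    have := isProbabilityMeasure_transfer hf ρ ν
    rw [Function.iterate_succ_apply, ← ih (transfer f ρ ν)]
    obtain ⟨ω₀⟩ : Nonempty Ω := nonempty_of_isProbabilityMeasure P
    -- a sequence that extends a given finite history
    let e : (Fin m → 𝓑) → ℕ → 𝓑 := fun h i => if hi : i < m then h ⟨i, hi⟩ else R 0 ω₀
    have he : Measurable e := by
      refine measurable_pi_lambda _ fun i => ?_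
      by_cases hi : i < m
      · simpa [e, hi] using measurable_pi_apply _
      · simp [e, hi]
    let past : Ω → Fin m → 𝓑 := fun ω i => R i ω
    have hpast : Measurable past := measurable_pi_lambda _ fun i => hR.measurable i
    have hb : ∀ ω x, bwdIter f (fun i => R i ω) m x = bwdIter f (e (past ω)) m x := fun ω x =>
      bwdIter_congr f (fun i hi => by simp [e, past, hi]) x
    have := Measure.isProbabilityMeasure_map (μ := P) hpast.aemeasurable
    have hB : Measurable fun p : (Fin m → 𝓑) × V => bwdIter f (e p.1) m p.2 :=
      (measurable_bwdIter hf m).comp ((he.comp measurable_fst).prodMk measurable_snd)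
    have hF : Measurable (Prod.map (id : (Fin m → 𝓑) → _) (Function.uncurry f)) :=
      measurable_id.prodMap hf
    -- both sides are images of the law `past ⊗ ρ ⊗ ν`
    have hl : (P.prod ν).map (fun p => bwdIter f (fun i => R i p.1) (m + 1) p.2)
        = ((P.map past).prod (ρ.prod ν)).map
          ((fun p : (Fin m → 𝓑) × V => bwdIter f (e p.1) m p.2) ∘
            Prod.map id (Function.uncurry f)) := by
      rw [← Measure.prodAssoc_prod, ← hR.map_prod m]
      have h1 : Measurable fun ω => ((fun i : Fin m => R i ω), R m ω) :=
        hpast.prodMk (hR.measurable m)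
      nth_rewrite 2 [← Measure.map_id (μ := ν)]
      rw [Measure.map_prod_map _ _ h1 measurable_id,
        Measure.map_map MeasurableEquiv.prodAssoc.measurable (h1.prodMap measurable_id),
        Measure.map_map (hB.comp hF)
          (MeasurableEquiv.prodAssoc.measurable.comp (h1.prodMap measurable_id))]
      congr 1
      funext p
      simp only [bwdIter, hb]
      rfl
    have hr : (P.prod (transfer f ρ ν)).map (fun p => bwdIter f (fun i => R i p.1) m p.2)
        = ((P.map past).prod (ρ.prod ν)).map
          ((fun p : (Fin m → 𝓑) × V => bwdIter f (e p.1) m p.2) ∘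
            Prod.map id (Function.uncurry f)) := by
      rw [← Measure.map_map hB hF, ← Measure.map_prod_map _ _ measurable_id hf, Measure.map_id]
      change _ = Measure.map _ ((P.map past).prod (transfer f ρ ν))
      nth_rewrite 2 [← Measure.map_id (μ := transfer f ρ ν)]
      rw [Measure.map_prod_map _ _ hpast measurable_id,
        Measure.map_map hB (hpast.prodMap measurable_id)]
      congr 1
      funext p
      simp only [hb]
      rfl
    rw [hl, hr]

/-- Forward and backward iterates of a given length have the same law. -/
theorem IsIIDSeq.map_fwdIter [IsProbabilityMeasure P] (hR : IsIIDSeq R ρ P)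
    (hf : Measurable (Function.uncurry f)) (m : ℕ) (x : V) :
    P.map (fun ω => fwdIter f (fun i => R i ω) m x)
      = (transfer f ρ)^[m] (Measure.dirac x) := by
  have := hR.isProbabilityMeasure
  induction m with
  | zero => simp [fwdIter]
  | succ m ih =>
    rw [Function.iterate_succ_apply', ← ih]
    obtain ⟨ω₀⟩ : Nonempty Ω := nonempty_of_isProbabilityMeasure P
    let e : (Fin m → 𝓑) → ℕ → 𝓑 := fun h i => if hi : i < m then h ⟨i, hi⟩ else R 0 ω₀
    have he : Measurable e := by
      refine measurable_pi_lambda _ fun i => ?_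
      by_cases hi : i < m
      · simpa [e, hi] using measurable_pi_apply _
      · simp [e, hi]
    have hR' : Measurable fun ω (i : ℕ) => R i ω := measurable_pi_lambda _ hR.measurable
    have hX : Measurable fun ω => fwdIter f (fun i => R i ω) m x :=
      (measurable_fwdIter hf m).comp (hR'.prodMk measurable_const)
    have hind : IndepFun (R m) (fun ω => fwdIter f (fun i => R i ω) m x) P := by
      have hF : Measurable fun h : Fin m → 𝓑 => fwdIter f (e h) m x :=
        (measurable_fwdIter hf m).comp (he.prodMk measurable_const)
      have := ((hR.indep_past m).comp hF measurable_id).symm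
      refine this.congr .rfl (.of_forall fun ω => ?_)
      exact fwdIter_congr f (fun i hi => by simp [e, hi]) x
    rw [transfer, ← hR.map_eq m, ← (indepFun_iff_map_prod_eq_prod_map_map
      (hR.measurable m).aemeasurable hX.aemeasurable).1 hind,
      Measure.map_map hf ((hR.measurable m).prodMk hX)]
    rfl

end Measurability

/-! ### Contraction on average -/

section Contraction

variable [NormedAddCommGroup V] {f : 𝓑 → V → V} {nrm : V → ℝ} {L G : 𝓑 → ℝ}

lemma nrm_bwdIter_sub_le {r : ℕ → 𝓑}
    (hfL : ∀ i x y, nrm (f (r i) x - f (r i) y) ≤ Real.exp (L (r i)) * nrm (x - y))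
    (m : ℕ) (x y : V) :
    nrm (bwdIter f r m x - bwdIter f r m y)
      ≤ Real.exp (∑ i ∈ Finset.range m, L (r i)) * nrm (x - y) := by
  induction m generalizing x y with
  | zero => simp [bwdIter]
  | succ m ih =>
    rw [Finset.sum_range_succ, Real.exp_add, mul_assoc]
    exact (ih _ _).trans (mul_le_mul_of_nonneg_left (hfL _ _ _) (Real.exp_nonneg _))

lemma nrm_fwdIter_sub_le {r : ℕ → 𝓑}
    (hfL : ∀ i x y, nrm (f (r i) x - f (r i) y) ≤ Real.exp (L (r i)) * nrm (x - y))
    (m : ℕ) (x y : V) :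
    nrm (fwdIter f r m x - fwdIter f r m y)
      ≤ Real.exp (∑ i ∈ Finset.range m, L (r i)) * nrm (x - y) := by
  induction m with
  | zero => simp [fwdIter]
  | succ m ih =>
    rw [Finset.sum_range_succ, add_comm (Finset.sum _ _), Real.exp_add, mul_assoc]
    exact (hfL _ _ _).trans (mul_le_mul_of_nonneg_left ih (Real.exp_nonneg _))

/-- If the averages of `a` converge to a negative limit and those of `g` converge to any limit,
then `exp (a 0 + ⋯ + a (m - 1) + g m)` decays geometrically. -/
lemma summable_exp_sum_add {a g : ℕ → ℝ} {A B : ℝ} (hA : A < 0)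
    (ha : Tendsto (fun n : ℕ => (∑ i ∈ Finset.range n, a i) / n) atTop (𝓝 A))
    (hg : Tendsto (fun n : ℕ => (∑ i ∈ Finset.range n, g i) / n) atTop (𝓝 B)) :
    Summable fun n : ℕ => Real.exp ((∑ i ∈ Finset.range n, a i) + g n) := by
  have hg0 : Tendsto (fun n : ℕ => g n / n) atTop (𝓝 0) := by
    have h1 : Tendsto (fun n : ℕ => (∑ i ∈ Finset.range (n + 1), g i) / ((n + 1 : ℕ) : ℝ)) atTop
        (𝓝 B) := hg.comp (tendsto_add_atTop_nat 1)
    have h2 : Tendsto (fun n : ℕ => ((n + 1 : ℕ) : ℝ) / n) atTop (𝓝 1) := by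
      have : Tendsto (fun n : ℕ => 1 + 1 / (n : ℝ)) atTop (𝓝 (1 + 0)) :=
        tendsto_const_nhds.add tendsto_one_div_atTop_nhds_zero_nat
      rw [add_zero] at this
      refine this.congr' ?_
      filter_upwards [eventually_gt_atTop 0] with n hn
      have : (n : ℝ) ≠ 0 := by positivity
      push_cast
      field_simp
    have h3 := (h1.mul h2).sub hg
    rw [mul_one, sub_self] at h3
    refine h3.congr' ?_
    filter_upwards [eventually_gt_atTop 0] with n hn
    have : (n : ℝ) ≠ 0 := by positivity
    rw [Finset.sum_range_succ]
    push_cast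
    field_simp
    ring
  have h := ha.add hg0
  rw [add_zero] at h
  have hlt := h.eventually (gt_mem_nhds (show A < A / 2 by linarith))
  have hs : Summable fun n : ℕ => Real.exp (A / 2) ^ n :=
    summable_geometric_of_lt_one (Real.exp_nonneg _) (by rw [Real.exp_lt_one_iff]; linarith)
  refine Summable.of_norm_bounded_eventually_nat hs ?_
  filter_upwards [hlt, eventually_gt_atTop 0] with n hn hn0
  have hn' : (0 : ℝ) < n := by positivity
  rw [Real.norm_of_nonneg (Real.exp_nonneg _), ← Real.exp_nat_mul, Real.exp_le_exp]
  rw [← add_div, div_lt_iff₀ hn'] at hn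
  linarith

lemma tendsto_exp_sum {a : ℕ → ℝ} {A : ℝ} (hA : A < 0)
    (ha : Tendsto (fun n : ℕ => (∑ i ∈ Finset.range n, a i) / n) atTop (𝓝 A)) :
    Tendsto (fun n : ℕ => Real.exp (∑ i ∈ Finset.range n, a i)) atTop (𝓝 0) := by
  have h := summable_exp_sum_add (g := fun _ => 0) (B := 0) hA ha (by simp)
  simpa using h.tendsto_atTop_zero

end Contraction

section Stationary

/-- Convergence in distribution only depends on the laws. -/
lemma tendstoInDistribution_congr_map {ι E Ω₁ Ω₂ Ω₃ Ω₄ : Type*} [MeasurableSpace Ω₁]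
    [MeasurableSpace Ω₂] [MeasurableSpace Ω₃] [MeasurableSpace Ω₄] [TopologicalSpace E]
    [MeasurableSpace E] [OpensMeasurableSpace E] {P₁ : Measure Ω₁} {P₂ : Measure Ω₂}
    {P₃ : Measure Ω₃} {P₄ : Measure Ω₄} [IsProbabilityMeasure P₁] [IsProbabilityMeasure P₂]
    [IsProbabilityMeasure P₃] [IsProbabilityMeasure P₄] {l : Filter ι}
    {X : ι → Ω₁ → E} {X' : ι → Ω₂ → E} {Z : Ω₃ → E} {Z' : Ω₄ → E}
    (h : TendstoInDistribution X l Z (fun _ => P₁) P₃) (hX' : ∀ i, AEMeasurable (X' i) P₂)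
    (hZ' : AEMeasurable Z' P₄) (hXX' : ∀ i, P₂.map (X' i) = P₁.map (X i))
    (hZZ' : P₄.map Z' = P₃.map Z) :
    TendstoInDistribution X' l Z' (fun _ => P₂) P₄ := by
  refine ⟨hX', hZ', ?_⟩
  have h1 := h.tendsto
  have h2 : (fun n => (⟨P₂.map (X' n), Measure.isProbabilityMeasure_map (hX' n)⟩ :
      ProbabilityMeasure E)) = fun n => ⟨P₁.map (X n),
        Measure.isProbabilityMeasure_map (h.forall_aemeasurable n)⟩ :=
    funext fun n => Subtype.ext (hXX' n)
  have h3 : (⟨P₄.map Z', Measure.isProbabilityMeasure_map hZ'⟩ : ProbabilityMeasure E)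
      = ⟨P₃.map Z, Measure.isProbabilityMeasure_map h.aemeasurable_limit⟩ := Subtype.ext hZZ'
  rw [h2, h3]
  exact h1

variable [MeasurableSpace 𝓑] [NormedAddCommGroup V] [MeasurableSpace V] [BorelSpace V]
  [CompleteSpace V] {f : 𝓑 → V → V} {nrm : V → ℝ} {L G : 𝓑 → ℝ}
  {Ω : Type*} [MeasurableSpace Ω] {P : Measure Ω}
  {R : ℕ → Ω → 𝓑} {ρ : Measure 𝓑}

/-- If the maps contract on average, the backward iterates converge almost surely, and the limit
does not depend on the initial state: by the strong law of large numbers the increments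
`bwdIter (m + 1) 0 - bwdIter m 0` decay geometrically. -/
lemma IsIIDSeq.exists_tendsto_bwdIter (hR : IsIIDSeq R ρ P) (hf : Measurable (Function.uncurry f))
    {K : ℝ} (hK : 0 ≤ K) (hnrm : ∀ v, ‖v‖ ≤ K * nrm v)
    (hfL : ∀ ω i x y, nrm (f (R i ω) x - f (R i ω) y) ≤ Real.exp (L (R i ω)) * nrm (x - y))
    (hfG : ∀ ω i, nrm (f (R i ω) 0) ≤ Real.exp (G (R i ω))) (hL : Measurable L) (hG : Measurable G)
    (hLi : Integrable L ρ) (hGi : Integrable G ρ) (hneg : ∫ r, L r ∂ρ < 0) :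
    ∃ U : Ω → V, Measurable U ∧ ∀ᵐ ω ∂P, ∀ x,
      Tendsto (fun m => bwdIter f (fun i => R i ω) m x) atTop (𝓝 (U ω)) := by
  have hconv : ∀ᵐ ω ∂P, ∃ l, Tendsto (fun m => bwdIter f (fun i => R i ω) m 0) atTop (𝓝 l) := by
    filter_upwards [hR.strong_law hL hLi, hR.strong_law hG hGi] with ω h1 h2
    refine cauchySeq_tendsto_of_complete (cauchySeq_of_dist_le_of_summable _ (fun m => ?_)
      ((summable_exp_sum_add hneg h1 h2).mul_left K))
    rw [dist_comm, dist_eq_norm]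
    refine (hnrm _).trans (mul_le_mul_of_nonneg_left ?_ hK)
    rw [Real.exp_add]
    refine (nrm_bwdIter_sub_le (hfL ω) m _ _).trans
      (mul_le_mul_of_nonneg_left ?_ (Real.exp_nonneg _))
    rw [sub_zero]
    exact hfG _ _
  have hR' : Measurable fun ω (i : ℕ) => R i ω := measurable_pi_lambda _ hR.measurable
  obtain ⟨U, hU, hUt⟩ := measurable_limit_of_tendsto_metrizable_ae (fun m =>
    ((measurable_bwdIter hf m).comp (hR'.prodMk (measurable_const (a := (0 : V))))).aemeasurable)
    hconv
  refine ⟨U, hU, ?_⟩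
  filter_upwards [hR.strong_law hL hLi, hUt] with ω h1 h2 x
  have h3 : Tendsto (fun m => bwdIter f (fun i => R i ω) m x - bwdIter f (fun i => R i ω) m 0) atTop
      (𝓝 0) := by
    refine squeeze_zero_norm (fun m => (hnrm _).trans (mul_le_mul_of_nonneg_left
      (nrm_bwdIter_sub_le (hfL ω) m x 0) hK)) ?_
    simpa using ((tendsto_exp_sum hneg h1).mul_const (nrm (x - 0))).const_mul K
  simpa using h3.add h2

/-- **Stationary law of iterated random Lipschitz maps.** If the maps `f (R m)` contract on
average, the forward iterates converge in distribution, whatever the initial state, and the limit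
is the only law that is invariant under `transfer f ρ`. -/
theorem IsIIDSeq.exists_stationary_law [SecondCountableTopology V] [IsProbabilityMeasure P]
    (hR : IsIIDSeq R ρ P) (hf : Measurable (Function.uncurry f)) (hfc : ∀ r, Continuous (f r))
    {K : ℝ} (hK : 0 ≤ K) (hnrm : ∀ v, ‖v‖ ≤ K * nrm v)
    (hfL : ∀ ω i x y, nrm (f (R i ω) x - f (R i ω) y) ≤ Real.exp (L (R i ω)) * nrm (x - y))
    (hfG : ∀ ω i, nrm (f (R i ω) 0) ≤ Real.exp (G (R i ω))) (hL : Measurable L) (hG : Measurable G)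
    (hLi : Integrable L ρ) (hGi : Integrable G ρ) (hneg : ∫ r, L r ∂ρ < 0)
    (Y : ℕ → Ω → V) (hYm : ∀ m, Measurable (Y m))
    (hY : ∀ᵐ ω ∂P, ∀ m, Y (m + 1) ω = f (R m ω) (Y m ω)) :
    ∃ μ : ProbabilityMeasure V,
      TendstoInDistribution Y atTop (id : V → V) (fun _ => P) (μ : Measure V) ∧
      transfer f ρ (μ : Measure V) = μ ∧
      ∀ ν : ProbabilityMeasure V, transfer f ρ (ν : Measure V) = ν → ν = μ := by
  have := hR.isProbabilityMeasure
  obtain ⟨U, hU, hUt⟩ := hR.exists_tendsto_bwdIter hf hK hnrm hfL hfG hL hG hLi hGi hneg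
  have hR' : Measurable fun ω (i : ℕ) => R i ω := measurable_pi_lambda _ hR.measurable
  have hbm : ∀ m, Measurable fun p : Ω × V => bwdIter f (fun i => R i p.1) m p.2 := fun m =>
    (measurable_bwdIter hf m).comp ((hR'.comp measurable_fst).prodMk measurable_snd)
  have hbm0 : ∀ m, Measurable fun ω : Ω => bwdIter f (fun i => R i ω) m 0 := fun m =>
    (measurable_bwdIter hf m).comp (hR'.prodMk measurable_const)
  have hfm0 : ∀ m, Measurable fun ω : Ω => fwdIter f (fun i => R i ω) m 0 := fun m =>
    (measurable_fwdIter hf m).comp (hR'.prodMk measurable_const)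
  have hbwd0 : ∀ m, P.map (fun ω => bwdIter f (fun i => R i ω) m 0)
      = (transfer f ρ)^[m] (Measure.dirac 0) := fun m => by
    have h0 : Measurable fun ω : Ω => (ω, (0 : V)) := measurable_id.prodMk measurable_const
    rw [← hR.map_bwdIter hf m, Measure.prod_dirac, Measure.map_map (hbm m) h0]
    rfl
  obtain ⟨μ, hμ⟩ : ∃ μ : ProbabilityMeasure V, (μ : Measure V) = P.map U :=
    ⟨⟨P.map U, Measure.isProbabilityMeasure_map hU.aemeasurable⟩, rfl⟩
  have hconv : TendstoInDistribution (fun m ω => bwdIter f (fun i => R i ω) m 0) atTop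
      (id : V → V) (fun _ => P) (μ : Measure V) :=
    tendstoInDistribution_congr_map (tendstoInDistribution_of_ae_tendsto (l := atTop) (μ' := P)
      (Z := U) (fun m => (hbm0 m).aemeasurable) hU.aemeasurable (hUt.mono fun ω h => h 0))
      (fun m => (hbm0 m).aemeasurable) aemeasurable_id (fun _ => rfl)
      (Measure.map_id.trans hμ)
  refine ⟨μ, ?_, ?_, ?_⟩
  · have hfwd : TendstoInDistribution (fun m ω => fwdIter f (fun i => R i ω) m 0) atTop
        (id : V → V) (fun _ => P) (μ : Measure V) :=
      tendstoInDistribution_congr_map hconv (fun m => (hfm0 m).aemeasurable) aemeasurable_id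
        (fun m => (hR.map_fwdIter hf m 0).trans (hbwd0 m).symm) rfl
    -- `Y` is asymptotically close to the forward iterates that start at `0`
    have hYf : ∀ᵐ ω ∂P, ∀ m, Y m ω = fwdIter f (fun i => R i ω) m (Y 0 ω) := by
      filter_upwards [hY] with ω h m
      induction m with
      | zero => rfl
      | succ m ih => rw [h m, ih]; rfl
    refine tendstoInDistribution_of_tendstoInMeasure_sub Y _ hfwd ?_ fun m => (hYm m).aemeasurable
    refine tendstoInMeasure_of_tendsto_ae
      (fun m => ((hYm m).sub (hfm0 m)).aestronglyMeasurable) ?_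
    filter_upwards [hYf, hR.strong_law hL hLi] with ω h1 h2
    have h3 : ∀ m, ‖(Y - fun m ω => fwdIter f (fun i => R i ω) m 0) m ω‖
        ≤ K * (Real.exp (∑ i ∈ Finset.range m, L (R i ω)) * nrm (Y 0 ω - 0)) := fun m => by
      simp only [Pi.sub_apply]
      rw [h1 m]
      exact (hnrm _).trans (mul_le_mul_of_nonneg_left
        (nrm_fwdIter_sub_le (hfL ω) m _ _) hK)
    exact squeeze_zero_norm h3
      (by simpa using ((tendsto_exp_sum hneg h2).mul_const (nrm (Y 0 ω - 0))).const_mul K)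
  · -- `f R U_m → f R U` for the backward iterates `U_m → U`, while `f R U_m` has the law of
    -- `U_{m+1}`
    have h1 : TendstoInDistribution
        (fun m (p : Ω × Ω) => f (R 0 p.1) (bwdIter f (fun i => R i p.2) m 0)) atTop
        (fun p : Ω × Ω => f (R 0 p.1) (U p.2)) (fun _ => P.prod P) (P.prod P) := by
      refine tendstoInDistribution_of_ae_tendsto (fun m => ?_) ?_ ?_
      · exact (hf.comp (((hR.measurable 0).comp measurable_fst).prodMk
          ((hbm0 m).comp measurable_snd))).aemeasurable
      · exact (hf.comp (((hR.measurable 0).comp measurable_fst).prodMk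
          (hU.comp measurable_snd))).aemeasurable
      · have := Measure.quasiMeasurePreserving_snd (μ := P) (ν := P)
        filter_upwards [this.ae hUt] with p hp
        exact ((hfc _).tendsto _).comp (hp 0)
    have h2 : TendstoInDistribution
        (fun m (p : Ω × Ω) => f (R 0 p.1) (bwdIter f (fun i => R i p.2) m 0)) atTop
        (id : V → V) (fun _ => P.prod P) (μ : Measure V) := by
      have hshift : TendstoInDistribution (fun m ω => bwdIter f (fun i => R i ω) (m + 1) 0) atTop
          (id : V → V) (fun _ => P) (μ : Measure V) :=
        ⟨fun m => (hbm0 _).aemeasurable, aemeasurable_id,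
          hconv.tendsto.comp (tendsto_add_atTop_nat 1)⟩
      refine tendstoInDistribution_congr_map hshift h1.forall_aemeasurable aemeasurable_id
        (fun m => ?_) rfl
      rw [hbwd0 (m + 1), Function.iterate_succ_apply', ← hbwd0 m, transfer, ← hR.map_eq 0,
        Measure.map_prod_map _ _ (hR.measurable 0) (hbm0 m),
        Measure.map_map hf ((hR.measurable 0).prodMap (hbm0 m))]
      rfl
    have h3 := tendstoInDistribution_unique _ h1 h2
    rw [Measure.map_id] at h3
    rw [← h3, h3, hμ, transfer, ← hR.map_eq 0, Measure.map_prod_map _ _ (hR.measurable 0) hU,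
      Measure.map_map hf ((hR.measurable 0).prodMap hU), ← hμ, ← h3]
    rfl
  · -- an invariant law `ν` is the law of the backward iterates started with `ν`, for every `m`
    intro ν hν
    have hfix : ∀ m, (transfer f ρ)^[m] (ν : Measure V) = ν := fun m =>
      Function.iterate_fixed hν m
    have h1 : TendstoInDistribution
        (fun m (p : Ω × V) => bwdIter f (fun i => R i p.1) m p.2) atTop
        (fun p : Ω × V => U p.1) (fun _ => P.prod (ν : Measure V)) (P.prod (ν : Measure V)) := by
      refine tendstoInDistribution_of_ae_tendsto (fun m => (hbm m).aemeasurable)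
        (hU.comp measurable_fst).aemeasurable ?_
      have := Measure.quasiMeasurePreserving_fst (μ := P) (ν := (ν : Measure V))
      filter_upwards [this.ae hUt] with p hp
      exact hp p.2
    have h2 : TendstoInDistribution
        (fun m (p : Ω × V) => bwdIter f (fun i => R i p.1) m p.2) atTop
        (id : V → V) (fun _ => P.prod (ν : Measure V)) (ν : Measure V) :=
      tendstoInDistribution_congr_map (tendstoInDistribution_const (μ' := (ν : Measure V))
        aemeasurable_id) (fun m => (hbm m).aemeasurable) aemeasurable_id
        (fun m => by rw [hR.map_bwdIter hf m, hfix, Measure.map_id]) rfl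
    have h3 := tendstoInDistribution_unique _ h1 h2
    rw [Measure.map_id] at h3
    refine Subtype.ext ?_
    change (ν : Measure V) = (μ : Measure V)
    rw [hμ, ← h3]
    change (P.prod (ν : Measure V)).map (U ∘ Prod.fst) = _
    rw [← Measure.map_map hU measurable_fst, Measure.map_fst_prod]
    simp

end Stationary

end IteratedMaps

/-! ### Independence of families and rearrangements -/

section Independence

variable {Ω : Type*} [MeasurableSpace Ω] {P : Measure Ω}

/-- Disjoint, possibly infinite, subfamilies of an independent family are independent. -/
lemma iIndepFun_indepFun_sets {ι : Type*} {E : ι → Type*} [∀ i, MeasurableSpace (E i)]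
    {X : ∀ i, Ω → E i} (h : iIndepFun X P) (hX : ∀ i, Measurable (X i)) {S T : Set ι}
    (hST : Disjoint S T) :
    IndepFun (fun ω (i : S) => X i ω) (fun ω (i : T) => X i ω) P := by
  have key : ∀ S : Set ι, MeasurableSpace.comap (fun ω (i : S) => X i ω) MeasurableSpace.pi
      = ⨆ i ∈ S, MeasurableSpace.comap (X i) inferInstance := fun S => by
    simp only [MeasurableSpace.pi, MeasurableSpace.comap_iSup, MeasurableSpace.comap_comp,
      iSup_subtype']
    rfl
  rw [IndepFun_iff_Indep, key, key]
  exact indep_iSup_of_disjoint (fun i => (hX i).comap_le) h hST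

lemma measurePreserving_prod_shuffle {α β γ δ : Type*} [MeasurableSpace α] [MeasurableSpace β]
    [MeasurableSpace γ] [MeasurableSpace δ] (a : Measure α) (b : Measure β) (c : Measure γ)
    (e : Measure δ) [IsProbabilityMeasure a] [IsProbabilityMeasure b] [IsProbabilityMeasure c]
    [IsProbabilityMeasure e] :
    MeasurePreserving (fun p : (α × γ) × (β × δ) => ((p.1.1, p.2.1), (p.1.2, p.2.2)))
      ((a.prod c).prod (b.prod e)) ((a.prod b).prod (c.prod e)) := by
  have h1 := measurePreserving_prodAssoc a c (b.prod e)
  have h2 := (MeasurePreserving.id a).prod ((measurePreserving_prodAssoc c b e).symm)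
  have h3 := (MeasurePreserving.id a).prod
    ((Measure.measurePreserving_swap (μ := c) (ν := b)).prod (MeasurePreserving.id e))
  have h4 := (MeasurePreserving.id a).prod (measurePreserving_prodAssoc b c e)
  have h5 := (measurePreserving_prodAssoc a b (c.prod e)).symm
  exact h5.comp (h4.comp (h3.comp (h2.comp h1)))

lemma indepFun_prodMk_prodMk {α β γ δ : Type*} [MeasurableSpace α] [MeasurableSpace β]
    [MeasurableSpace γ] [MeasurableSpace δ] [IsProbabilityMeasure P] {A : Ω → α} {B : Ω → β}
    {C : Ω → γ} {D : Ω → δ} (hA : Measurable A) (hB : Measurable B) (hC : Measurable C)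
    (hD : Measurable D) (hAC : IndepFun A C P) (hBD : IndepFun B D P)
    (h : IndepFun (fun ω => (A ω, C ω)) (fun ω => (B ω, D ω)) P) :
    IndepFun (fun ω => (A ω, B ω)) (fun ω => (C ω, D ω)) P := by
  have := Measure.isProbabilityMeasure_map (μ := P) hA.aemeasurable
  have := Measure.isProbabilityMeasure_map (μ := P) hB.aemeasurable
  have := Measure.isProbabilityMeasure_map (μ := P) hC.aemeasurable
  have := Measure.isProbabilityMeasure_map (μ := P) hD.aemeasurable
  have hAB : IndepFun A B P := h.comp measurable_fst measurable_fst
  have hCD : IndepFun C D P := h.comp measurable_snd measurable_snd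
  rw [indepFun_iff_map_prod_eq_prod_map_map (by fun_prop) (by fun_prop)] at hAC hBD hAB hCD h ⊢
  rw [hAB, hCD]
  rw [hAC, hBD] at h
  have hs := measurePreserving_prod_shuffle (P.map A) (P.map B) (P.map C) (P.map D)
  rw [← hs.map_eq, ← h, Measure.map_map hs.measurable (by fun_prop)]
  rfl

lemma measure_eq_tsum_inter_fiber {κ : Ω → ℕ} (hκ : Measurable κ) {E : Set Ω}
    (hE : MeasurableSet E) : P E = ∑' k, P (κ ⁻¹' {k} ∩ E) := by
  rw [← measure_iUnion]
  · congr 1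
    ext ω
    simp
  · intro i j hij
    refine Set.disjoint_left.2 fun ω h1 h2 => hij ?_
    simp only [mem_inter_iff, mem_preimage, mem_singleton_iff] at h1 h2
    rw [← h1.1, h2.1]
  · exact fun k => (hκ (measurableSet_singleton k)).inter hE

end Independence

/-! ### Past and future of a Poisson process -/

section Increments

/-- A finite set of times is contained in the range of a nondecreasing sequence that starts at
`0`. -/
lemma exists_monotone_seq (S : Finset ℝ≥0) :
    ∃ t : ℕ → ℝ≥0, Monotone t ∧ t 0 = 0 ∧ (∀ l, t l ∈ insert 0 S) ∧ ∀ u ∈ S, ∃ l, t l = u := by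
  classical
  have hc : 0 < (insert 0 S).card := Finset.card_pos.2 (Finset.insert_nonempty _ _)
  let f := (insert 0 S).orderEmbOfFin rfl
  let t : ℕ → ℝ≥0 := fun n => f ⟨min n ((insert 0 S).card - 1), by omega⟩
  have ht : ∀ u ∈ insert 0 S, ∃ l, t l = u := fun u hu => by
    have : u ∈ Set.range f := by
      rw [Finset.range_orderEmbOfFin]; exact hu
    obtain ⟨i, rfl⟩ := this
    exact ⟨i, by simp only [t]; congr; omega⟩
  have hm : Monotone t := fun a b hab => f.monotone (by simp only [Fin.mk_le_mk]; omega)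
  refine ⟨t, hm, ?_, fun l => Finset.orderEmbOfFin_mem _ _ _,
    fun u hu => ht u (Finset.mem_insert_of_mem hu)⟩
  obtain ⟨l, hl⟩ := ht 0 (Finset.mem_insert_self _ _)
  exact le_antisymm (hl ▸ hm (Nat.zero_le l)) zero_le

variable {Ω : Type*} [MeasurableSpace Ω] {P : Measure Ω} {N : ℝ → Ω → ℕ} {Λ : ℝ → ℝ}

lemma IsPoissonProcess.le (hN : IsPoissonProcess N Λ P) (ω : Ω) {u v : ℝ} (hu : 0 ≤ u)
    (huv : u ≤ v) : N u ω ≤ N v ω :=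
  hN.mono ω hu (hu.trans huv) huv

lemma IsPoissonProcess.sub_eq_sum (hN : IsPoissonProcess N Λ P) (ω : Ω) {t : ℕ → ℝ}
    (ht : Monotone t) (ht0 : 0 ≤ t 0) {i j : ℕ} (hij : i ≤ j) :
    N (t j) ω - N (t i) ω = ∑ l ∈ Finset.Ico i j, (N (t (l + 1)) ω - N (t l) ω) := by
  have h0 : ∀ l, 0 ≤ t l := fun l => ht0.trans (ht (Nat.zero_le l))
  induction j, hij using Nat.le_induction with
  | base => simp
  | succ j hij ih =>
    rw [Finset.sum_Ico_succ_top hij, ← ih]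
    have h1 := hN.le ω (h0 i) (ht hij)
    have h2 := hN.le ω (h0 j) (ht (Nat.le_succ j))
    simp only [Nat.succ_eq_add_one] at h2
    omega

lemma IsPoissonProcess.iIndepFun_increments (hN : IsPoissonProcess N Λ P) {t : ℕ → ℝ}
    (ht : Monotone t) (ht0 : 0 ≤ t 0) :
    iIndepFun (fun l ω => N (t (l + 1)) ω - N (t l) ω) P := by
  have h0 : ∀ l, 0 ≤ t l := fun l => ht0.trans (ht (Nat.zero_le l))
  have := hN.indepIncrements.nat (t := fun l => (⟨t l, h0 l⟩ : ℝ≥0)) (fun a b hab => ht hab)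
  exact this

/-- The increments after time `a` are independent of the path up to time `a`. -/
theorem IsPoissonProcess.indepFun_past_future [IsProbabilityMeasure P]
    (hN : IsPoissonProcess N Λ P) {a : ℝ} (ha : 0 ≤ a) :
    IndepFun (fun ω (u : Icc 0 a) => N u ω) (fun ω (v : Ici (0 : ℝ)) => N (a + v) ω - N a ω) P := by
  classical
  have hav : ∀ v : Ici (0 : ℝ), 0 ≤ a + (v : ℝ) := fun v => add_nonneg ha v.2
  refine IndepFun.process_indepFun_process (fun u => hN.measurable _ u.2.1)
    (fun v => (hN.measurable _ (hav v)).sub (hN.measurable _ ha)) fun I J => ?_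
  obtain ⟨t, ht, ht0, -, hS⟩ := exists_monotone_seq
    (insert ⟨a, ha⟩ (I.image (fun u : Icc 0 a => (⟨u, u.2.1⟩ : ℝ≥0)) ∪
      J.image (fun v : Ici (0 : ℝ) => (⟨a + v, hav v⟩ : ℝ≥0))))
  obtain ⟨k, hk⟩ := hS ⟨a, ha⟩ (Finset.mem_insert_self _ _)
  have hIl : ∀ u : I, ∃ l, l ≤ k ∧ (t l : ℝ) = u := fun u => by
    obtain ⟨l, hl⟩ := hS ⟨u, u.1.2.1⟩ (Finset.mem_insert_of_mem (Finset.mem_union_left _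
      (Finset.mem_image_of_mem (fun u : Icc 0 a => (⟨u, u.2.1⟩ : ℝ≥0)) u.2)))
    rcases le_total l k with h | h
    · exact ⟨l, h, by rw [hl]; rfl⟩
    · refine ⟨k, le_rfl, ?_⟩
      have h1 : (t k : ℝ) ≤ t l := ht h
      rw [hl, hk] at h1
      rw [hk]
      exact le_antisymm h1 u.1.2.2
  have hJl : ∀ v : J, ∃ l, k ≤ l ∧ (t l : ℝ) = a + v := fun v => by
    obtain ⟨l, hl⟩ := hS ⟨a + v, hav v⟩ (Finset.mem_insert_of_mem (Finset.mem_union_right _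
      (Finset.mem_image_of_mem (fun v : Ici (0 : ℝ) => (⟨a + v, hav v⟩ : ℝ≥0)) v.2)))
    rcases le_total k l with h | h
    · exact ⟨l, h, by rw [hl]; rfl⟩
    · refine ⟨k, le_rfl, ?_⟩
      have h1 : (t l : ℝ) ≤ t k := ht h
      rw [hl, hk] at h1
      rw [hk]
      exact le_antisymm (le_add_of_nonneg_right v.1.2) h1
  choose lI hlI hI using hIl
  choose lJ hlJ hJ using hJl
  have htm : Monotone fun l => (t l : ℝ) := fun a b h => ht h
  have ht00 : (0 : ℝ) ≤ t 0 := (t 0).2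
  have hind := iIndepFun_indepFun_sets (hN.iIndepFun_increments htm ht00)
    (fun l => (hN.measurable _ (t _).2).sub (hN.measurable _ (t _).2))
    (S := Iio k) (T := Ici k)
    (Set.disjoint_left.2 fun l h1 h2 => not_le.2 (mem_Iio.1 h1) (mem_Ici.1 h2))
  let φ : (Iio k → ℕ) → I → ℕ := fun p u =>
    ∑ l ∈ Finset.Ico 0 (lI u), if h : l ∈ Iio k then p ⟨l, h⟩ else 0
  let χ : (Ici k → ℕ) → J → ℕ := fun p v =>
    ∑ l ∈ Finset.Ico k (lJ v), if h : l ∈ Ici k then p ⟨l, h⟩ else 0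
  have hφ : Measurable φ := by
    refine measurable_pi_lambda _ fun u => Finset.measurable_sum _ fun l _ => ?_
    split_ifs
    · exact measurable_pi_apply _
    · exact measurable_const
  have hχ : Measurable χ := by
    refine measurable_pi_lambda _ fun u => Finset.measurable_sum _ fun l _ => ?_
    split_ifs
    · exact measurable_pi_apply _
    · exact measurable_const
  convert hind.comp hφ hχ using 1
  · funext ω u
    have h := hN.sub_eq_sum ω htm ht00 (Nat.zero_le (lI u))
    simp only [hI, ht0, NNReal.coe_zero, hN.zero, Nat.sub_zero] at h
    rw [h]
    refine Finset.sum_congr rfl fun l hl => ?_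
    rw [dif_pos (show l ∈ Iio k from (Finset.mem_Ico.1 hl).2.trans_le (hlI u))]
  · funext ω v
    have h := hN.sub_eq_sum ω htm ht00 (hlJ v)
    simp only [hJ, hk] at h
    refine Eq.trans h ?_
    refine Finset.sum_congr rfl fun l hl => ?_
    rw [dif_pos (show l ∈ Ici k from (Finset.mem_Ico.1 hl).1)]

/-- The law of the increments over a time window depends only on the increments of the mean
function. -/
theorem IsPoissonProcess.map_window_eq [IsProbabilityMeasure P] (hN : IsPoissonProcess N Λ P)
    {a b τ : ℝ} (ha : 0 ≤ a) (hb : 0 ≤ b)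
    (hΛ : ∀ v v', 0 ≤ v → v ≤ v' → v' ≤ τ → Λ (a + v') - Λ (a + v) = Λ (b + v') - Λ (b + v)) :
    P.map (fun ω (v : Icc 0 τ) => N (a + v) ω - N a ω)
      = P.map (fun ω (v : Icc 0 τ) => N (b + v) ω - N b ω) := by
  classical
  have hm : ∀ a, 0 ≤ a → Measurable fun ω (v : Icc 0 τ) => N (a + v) ω - N a ω := fun a ha =>
    measurable_pi_lambda _ fun v =>
      (hN.measurable _ (add_nonneg ha v.2.1)).sub (hN.measurable _ ha)
  rw [map_eq_iff_forall_finset_map_restrict_eq (X := fun (v : Icc 0 τ) ω => N (a + v) ω - N a ω)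
    (Y := fun (v : Icc 0 τ) ω => N (b + v) ω - N b ω) (hm a ha).aemeasurable (hm b hb).aemeasurable]
  intro I
  obtain ⟨t, ht, ht0, htI, hS⟩ :=
    exists_monotone_seq (I.image (fun u : Icc 0 τ => (⟨u, u.2.1⟩ : ℝ≥0)))
  rcases I.eq_empty_or_nonempty with rfl | ⟨i₀, hi₀⟩
  · congr 1
    funext ω
    exact Subsingleton.elim _ _
  have htτ : ∀ l, (t l : ℝ) ≤ τ := fun l => by
    rcases Finset.mem_insert.1 (htI l) with h | h
    · rw [h]; exact i₀.2.1.trans i₀.2.2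
    · obtain ⟨u, -, hu⟩ := Finset.mem_image.1 h
      rw [← hu]
      exact u.2.2
  have hIl : ∀ u : I, ∃ l, (t l : ℝ) = u := fun u => by
    obtain ⟨l, hl⟩ := hS ⟨u, u.1.2.1⟩
      (Finset.mem_image_of_mem (fun u : Icc 0 τ => (⟨u, u.2.1⟩ : ℝ≥0)) u.2)
    exact ⟨l, by rw [hl]; rfl⟩
  choose lI hI using hIl
  have htm : ∀ a, Monotone fun l => a + (t l : ℝ) := fun a x y h =>
    add_le_add_right (NNReal.coe_le_coe.2 (ht h)) a
  have ht00 : ∀ a, 0 ≤ a → (0 : ℝ) ≤ a + t 0 := fun a ha => add_nonneg ha (t 0).2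
  have hδ : ∀ a, 0 ≤ a → ∀ l, Measurable fun ω => N (a + t (l + 1)) ω - N (a + t l) ω :=
    fun a ha l => (hN.measurable _ (add_nonneg ha (t _).2)).sub
      (hN.measurable _ (add_nonneg ha (t _).2))
  let g : (ℕ → ℕ) → I → ℕ := fun p u => ∑ l ∈ Finset.Ico 0 (lI u), p l
  have hg : Measurable g :=
    measurable_pi_lambda _ fun u => Finset.measurable_sum _ fun l _ => measurable_pi_apply _
  have key : ∀ a, 0 ≤ a →
      P.map (fun ω => I.restrict fun v : Icc 0 τ => N (a + v) ω - N a ω)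
        = (Measure.infinitePi fun l =>
            poissonMeasure (Λ (a + t (l + 1)) - Λ (a + t l)).toNNReal).map g := fun a ha => by
    have h1 := (hN.iIndepFun_increments (htm a) (ht00 a ha)).map_fun_eq_infinitePi_map (hδ a ha)
    have h2 : ∀ l, P.map (fun ω => N (a + t (l + 1)) ω - N (a + t l) ω)
        = poissonMeasure (Λ (a + t (l + 1)) - Λ (a + t l)).toNNReal := fun l =>
      (hN.law_increment _ _ (add_nonneg ha (t _).2) (htm a (Nat.le_succ l))).map_eq
    simp only [h2] at h1
    rw [← h1, Measure.map_map hg (measurable_pi_lambda _ (hδ a ha))]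
    congr 1
    funext ω u
    have h := hN.sub_eq_sum ω (htm a) (ht00 a ha) (Nat.zero_le (lI u))
    simp only [hI, ht0, NNReal.coe_zero, add_zero] at h
    exact h
  rw [key a ha, key b hb]
  congr 2
  funext l
  rw [hΛ (t l) (t (l + 1)) (t l).2 (NNReal.coe_le_coe.2 (ht (Nat.le_succ l))) (htτ _)]

end Increments

/-! ### Splitting the marks at a random index -/

section Splitting

variable {Ω J : Type*} [MeasurableSpace Ω] {P : Measure Ω}

/-- The marks with an index larger than `n`, re-indexed from `0`. -/
def shiftMarks (n : ℕ) (z : J × ℕ → ℝ) : J × ℕ → ℝ := fun i => z (i.1, n + 1 + i.2)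

/-- The marks with an index at most `k`, the others being replaced by `0`. -/
def truncMarks (k : ℕ) (z : J × ℕ → ℝ) : J × ℕ → ℝ := fun i => if i.2 ≤ k then z i else 0

lemma measurable_shiftMarks : Measurable fun p : ℕ × (J × ℕ → ℝ) => shiftMarks p.1 p.2 :=
  measurable_from_prod_countable_right fun n =>
    measurable_pi_lambda (fun z : J × ℕ → ℝ => shiftMarks n z) fun i =>
      measurable_pi_apply (i.1, n + 1 + i.2)

lemma measurable_truncMarks (k : ℕ) : Measurable (truncMarks k : (J × ℕ → ℝ) → _) :=
  measurable_pi_lambda _ fun i => by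
    by_cases h : i.2 ≤ k
    · simpa [truncMarks, h] using measurable_pi_apply i
    · simp [truncMarks, h]

variable {ζ : J × ℕ → Ω → ℝ} {F : J → Measure ℝ}

lemma indepFun_truncMarks_shiftMarks (hζ : iIndepFun ζ P) (hm : ∀ i, Measurable (ζ i)) (k : ℕ) :
    IndepFun (fun ω => truncMarks k fun i => ζ i ω) (fun ω => shiftMarks k fun i => ζ i ω) P := by
  have h := iIndepFun_indepFun_sets hζ hm (S := {i | i.2 ≤ k}) (T := {i | k < i.2})
    (Set.disjoint_left.2 fun i (h1 : i.2 ≤ k) (h2 : k < i.2) => not_le.2 h2 h1)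
  have h' := h.comp
    (φ := fun p (i : J × ℕ) => if h : i.2 ≤ k then p ⟨i, h⟩ else (0 : ℝ))
    (ψ := fun p (i : J × ℕ) => p ⟨(i.1, k + 1 + i.2), show k < k + 1 + i.2 by omega⟩)
    (measurable_pi_lambda _ fun i => by
      split_ifs
      · exact measurable_pi_apply _
      · exact measurable_const)
    (measurable_pi_lambda _ fun i => measurable_pi_apply _)
  convert h' using 1
  · funext ω i
    simp only [truncMarks, Function.comp]
    split_ifs <;> rfl
  · rfl

lemma map_shiftMarks (hζ : iIndepFun ζ P) (hm : ∀ i, Measurable (ζ i))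
    (hF : ∀ i, P.map (ζ i) = F i.1) (k : ℕ) :
    P.map (fun ω => shiftMarks k fun i => ζ i ω) = Measure.infinitePi fun i : J × ℕ => F i.1 := by
  have hinj : Function.Injective fun i : J × ℕ => (i.1, k + 1 + i.2) := fun a b h => by
    simp only [Prod.mk.injEq, Nat.add_left_cancel_iff] at h
    exact Prod.ext h.1 h.2
  have h := (hζ.precomp hinj).map_fun_eq_infinitePi_map fun i => hm _
  simp only [hF] at h
  exact h

/-- Let the marks `ζ` be independent of `(A, C)`, and `A` independent of `C`. At an index `κ A`
determined by `A`, the marks with a larger index, together with `C`, are independent of everything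
that depends only on `A` and the marks with an index at most `κ A`, and their law is a product. -/
theorem indepFun_split_marks [IsProbabilityMeasure P] {α β γ : Type*} [MeasurableSpace α]
    [MeasurableSpace β] [MeasurableSpace γ] (hζ : iIndepFun ζ P) (hm : ∀ i, Measurable (ζ i))
    (hF : ∀ i, P.map (ζ i) = F i.1) {A : Ω → α} {C : Ω → γ} (hA : Measurable A)
    (hC : Measurable C) (hAC : IndepFun A C P)
    (hACζ : IndepFun (fun ω => (A ω, C ω)) (fun ω i => ζ i ω) P)
    {κ : α → ℕ} (hκ : Measurable κ) {ψ : α × (J × ℕ → ℝ) → β} (hψ : Measurable ψ)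
    (htrunc : ∀ ω, ψ (A ω, fun i => ζ i ω) = ψ (A ω, truncMarks (κ (A ω)) fun i => ζ i ω)) :
    IndepFun (fun ω => ψ (A ω, fun i => ζ i ω))
        (fun ω => (C ω, shiftMarks (κ (A ω)) fun i => ζ i ω)) P ∧
      P.map (fun ω => (C ω, shiftMarks (κ (A ω)) fun i => ζ i ω))
        = (P.map C).prod (Measure.infinitePi fun i : J × ℕ => F i.1) := by
  have hz : Measurable fun ω i => ζ i ω := measurable_pi_lambda _ hm
  have hsh : ∀ k, Measurable fun z : J × ℕ → ℝ => shiftMarks k z := fun k =>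
    measurable_shiftMarks.comp (measurable_const.prodMk measurable_id)
  have hfut : Measurable fun ω => (C ω, shiftMarks (κ (A ω)) fun i => ζ i ω) :=
    hC.prodMk (measurable_shiftMarks.comp ((hκ.comp hA).prodMk hz))
  have hpast : Measurable fun ω => ψ (A ω, fun i => ζ i ω) := hψ.comp (hA.prodMk hz)
  set μ := (P.map C).prod (Measure.infinitePi fun i : J × ℕ => F i.1) with hμ
  have hind : ∀ k, IndepFun (fun ω => (A ω, truncMarks k fun i => ζ i ω))
      (fun ω => (C ω, shiftMarks k fun i => ζ i ω)) P := fun k =>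
    indepFun_prodMk_prodMk hA ((measurable_truncMarks k).comp hz) hC ((hsh k).comp hz) hAC
      (indepFun_truncMarks_shiftMarks hζ hm k)
      (hACζ.comp measurable_id ((measurable_truncMarks k).prodMk (hsh k)))
  have hlaw : ∀ k, P.map (fun ω => (C ω, shiftMarks k fun i => ζ i ω)) = μ := fun k => by
    have h : IndepFun C (fun ω => shiftMarks k fun i => ζ i ω) P :=
      hACζ.comp measurable_snd (hsh k)
    have hsz : Measurable fun ω => shiftMarks k fun i => ζ i ω := (hsh k).comp hz
    rw [(indepFun_iff_map_prod_eq_prod_map_map hC.aemeasurable hsz.aemeasurable).1 h,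
      map_shiftMarks hζ hm hF k]
  have key : ∀ S V, MeasurableSet S → MeasurableSet V →
      P ((fun ω => ψ (A ω, fun i => ζ i ω)) ⁻¹' S ∩
        (fun ω => (C ω, shiftMarks (κ (A ω)) fun i => ζ i ω)) ⁻¹' V)
        = P ((fun ω => ψ (A ω, fun i => ζ i ω)) ⁻¹' S) * μ V := fun S V hS hV => by
    rw [measure_eq_tsum_inter_fiber (hκ.comp hA) ((hpast hS).inter (hfut hV)),
      measure_eq_tsum_inter_fiber (hκ.comp hA) (hpast hS), ← ENNReal.tsum_mul_right]
    refine tsum_congr fun k => ?_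
    have hST : MeasurableSet ((Prod.fst ⁻¹' (κ ⁻¹' {k}) ∩ ψ ⁻¹' S : Set (α × (J × ℕ → ℝ)))) :=
      (measurable_fst (hκ (measurableSet_singleton k))).inter (hψ hS)
    have h := (hind k).measure_inter_preimage_eq_mul _ V hST hV
    have e1 : (κ ∘ A) ⁻¹' {k} ∩ ((fun ω => ψ (A ω, fun i => ζ i ω)) ⁻¹' S ∩
        (fun ω => (C ω, shiftMarks (κ (A ω)) fun i => ζ i ω)) ⁻¹' V)
        = (fun ω => (A ω, truncMarks k fun i => ζ i ω)) ⁻¹'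
            (Prod.fst ⁻¹' (κ ⁻¹' {k}) ∩ ψ ⁻¹' S) ∩
          (fun ω => (C ω, shiftMarks k fun i => ζ i ω)) ⁻¹' V := by
      ext ω
      simp only [mem_inter_iff, mem_preimage, mem_singleton_iff, Function.comp]
      constructor
      · rintro ⟨rfl, h1, h2⟩
        exact ⟨⟨rfl, by rw [← htrunc]; exact h1⟩, h2⟩
      · rintro ⟨⟨rfl, h1⟩, h2⟩
        exact ⟨rfl, by rw [htrunc]; exact h1, h2⟩
    have e2 : (κ ∘ A) ⁻¹' {k} ∩ (fun ω => ψ (A ω, fun i => ζ i ω)) ⁻¹' S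
        = (fun ω => (A ω, truncMarks k fun i => ζ i ω)) ⁻¹'
            (Prod.fst ⁻¹' (κ ⁻¹' {k}) ∩ ψ ⁻¹' S) := by
      ext ω
      simp only [mem_inter_iff, mem_preimage, mem_singleton_iff, Function.comp]
      constructor
      · rintro ⟨rfl, h1⟩
        exact ⟨rfl, by rw [← htrunc]; exact h1⟩
      · rintro ⟨rfl, h1⟩
        exact ⟨rfl, by rw [htrunc]; exact h1⟩
    have hfk : Measurable fun ω => (C ω, shiftMarks k fun i => ζ i ω) :=
      hC.prodMk ((hsh k).comp hz)
    rw [e1, e2, h, ← hlaw k, Measure.map_apply hfk hV]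
  have hmap : P.map (fun ω => (C ω, shiftMarks (κ (A ω)) fun i => ζ i ω)) = μ := by
    ext V hV
    have := key univ V MeasurableSet.univ hV
    rw [preimage_univ, univ_inter, measure_univ, one_mul] at this
    rw [Measure.map_apply hfut hV, this]
  refine ⟨?_, hmap⟩
  rw [indepFun_iff_measure_inter_preimage_eq_mul]
  intro S V hS hV
  rw [key S V hS hV, ← hmap, Measure.map_apply hfut hV]

end Splitting

/-! ### Blocks of marked jumps -/

section Blocks

/-- The jumps of a marked counting process in a time window: their number, and the sequences of
their times, counted from the beginning of the window, and of their sizes, both numbered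
from `1`. -/
abbrev MarkedBlock := ℕ × (ℕ → ℝ) × (ℕ → ℝ)

/-- The time of the `i`-th jump of the counting path `u ↦ c (u / τ)` on `[0, τ]`, and `τ` if there
is none. Only rational values of `u / τ` are used, which makes it a measurable function of `c`. -/
def localArrival (τ : ℝ) (c : Icc (0 : ℚ) 1 → ℕ) (i : ℕ) : ℝ :=
  ⨅ u : Icc (0 : ℚ) 1, if i ≤ c u then τ * (u : ℚ) else τ

/-- The block of the counting path `c` in a window that starts in phase `t`, where `w (j, i)` is
the mark that the `(i + 1)`-th jump gets if it falls into the `j`-th season. -/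
def blockOf (d : ℕ) (s : ℕ → ℝ) (t τ : ℝ) (c : Icc (0 : ℚ) 1 → ℕ) (w : Fin d × ℕ → ℝ) :
    MarkedBlock :=
  (c 1, localArrival τ c, fun i => if 1 ≤ i ∧ i ≤ c 1 then
    ∑ j, (season d s j).indicator (fun _ => w (j, i - 1)) (t + localArrival τ c i) else 0)

variable {Ω : Type*}

/-- The path of `N - N a` on the window `[a, a + τ]`. -/
def windowPath (N : ℝ → Ω → ℕ) (τ a : ℝ) (ω : Ω) : Icc (0 : ℚ) 1 → ℕ :=
  fun u => N (a + τ * (u : ℚ)) ω - N a ω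

/-- The block of the `m`-th window `[t + m τ, t + (m + 1) τ]`. -/
def markedBlock (d : ℕ) (s : ℕ → ℝ) (N : ℝ → Ω → ℕ) (Z : Fin d → ℕ → Ω → ℝ) (t τ : ℝ) (m : ℕ)
    (ω : Ω) : MarkedBlock :=
  blockOf d s t τ (windowPath N τ (t + m * τ) ω)
    (shiftMarks (N (t + m * τ) ω) fun i => Z i.1 i.2 ω)

lemma measurable_localArrival (τ : ℝ) (i : ℕ) : Measurable fun c => localArrival τ c i := by
  refine Measurable.iInf fun u => Measurable.ite ?_ measurable_const measurable_const
  exact (measurable_pi_apply u) (measurableSet_Ici (a := i))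

lemma measurableSet_season (d : ℕ) (s : ℕ → ℝ) (j : Fin d) : MeasurableSet (season d s j) :=
  MeasurableSet.iUnion fun _ => measurableSet_Ioc

lemma measurable_blockOf (d : ℕ) (s : ℕ → ℝ) (t τ : ℝ) :
    Measurable (Function.uncurry (blockOf d s t τ)) := by
  have hT : ∀ i, Measurable fun p : (Icc (0 : ℚ) 1 → ℕ) × (Fin d × ℕ → ℝ) =>
      localArrival τ p.1 i := fun i => (measurable_localArrival τ i).comp measurable_fst
  have hc : Measurable fun p : (Icc (0 : ℚ) 1 → ℕ) × (Fin d × ℕ → ℝ) => p.1 1 :=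
    (measurable_pi_apply _).comp measurable_fst
  refine hc.prodMk ((measurable_pi_lambda _ hT).prodMk (measurable_pi_lambda _ fun i => ?_))
  refine Measurable.ite ?_ (Finset.measurable_sum _ fun j _ => ?_) measurable_const
  · exact (MeasurableSet.const _).inter (hc (measurableSet_Ici (a := i)))
  · have h : MeasurableSet ((fun p : (Icc (0 : ℚ) 1 → ℕ) × (Fin d × ℕ → ℝ) =>
        t + localArrival τ p.1 i) ⁻¹' season d s j) :=
      (measurable_const.add (hT i)) (measurableSet_season d s j)
    exact ((measurable_pi_apply (j, i - 1)).comp measurable_snd).indicator h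

lemma blockOf_congr {d : ℕ} {s : ℕ → ℝ} {t τ : ℝ} {c : Icc (0 : ℚ) 1 → ℕ}
    {w w' : Fin d × ℕ → ℝ} (h : ∀ j, ∀ l < c 1, w (j, l) = w' (j, l)) :
    blockOf d s t τ c w = blockOf d s t τ c w' := by
  refine Prod.ext rfl (Prod.ext rfl (funext fun i => ?_))
  simp only [blockOf]
  by_cases hi : 1 ≤ i ∧ i ≤ c 1
  · rw [if_pos hi, if_pos hi]
    exact Finset.sum_congr rfl fun j _ => by rw [h j (i - 1) (by omega)]
  · rw [if_neg hi, if_neg hi]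

lemma localArrival_mem (τ : ℝ) (hτ : 0 ≤ τ) (c : Icc (0 : ℚ) 1 → ℕ) (i : ℕ) :
    localArrival τ c i ∈ Icc 0 τ := by
  have h0 : ∀ u : Icc (0 : ℚ) 1, 0 ≤ if i ≤ c u then τ * (u : ℚ) else τ := fun u => by
    split_ifs
    · exact mul_nonneg hτ (by exact_mod_cast u.2.1)
    · exact hτ
  refine ⟨Real.iInf_nonneg h0, ?_⟩
  refine (ciInf_le ⟨0, by rintro _ ⟨u, rfl⟩; exact h0 u⟩ 1).trans ?_
  split_ifs
  · simp
  · exact le_rfl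

lemma localArrival_zero (τ : ℝ) (hτ : 0 ≤ τ) (c : Icc (0 : ℚ) 1 → ℕ) : localArrival τ c 0 = 0 := by
  refine le_antisymm ?_ (localArrival_mem τ hτ c 0).1
  refine (ciInf_le ⟨0, ?_⟩ 0).trans ?_
  · rintro _ ⟨u, rfl⟩
    simp only [zero_le, if_true]
    exact mul_nonneg hτ (by exact_mod_cast u.2.1)
  · simp

variable [MeasurableSpace Ω] {P : Measure Ω} {N : ℝ → Ω → ℕ} {Λ : ℝ → ℝ} {d : ℕ} {s : ℕ → ℝ}
  {Z : Fin d → ℕ → Ω → ℝ} {F : Fin d → Measure ℝ} {t τ : ℝ}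

lemma IsPoissonProcess.measurable_windowPath (hN : IsPoissonProcess N Λ P) (hτ : 0 ≤ τ) {a : ℝ}
    (ha : 0 ≤ a) : Measurable (windowPath N τ a) :=
  measurable_pi_lambda _ fun u => (hN.measurable _
    (add_nonneg ha (mul_nonneg hτ (by exact_mod_cast u.2.1)))).sub (hN.measurable _ ha)

/-- The blocks of successive periods are independent and identically distributed. -/
theorem IsPoissonProcess.isIIDSeq_markedBlock [IsProbabilityMeasure P]
    (hN : IsPoissonProcess N Λ P) (ht : 0 ≤ t) (hτ : 0 ≤ τ)
    (hΛ : ∀ (m : ℕ) v v', 0 ≤ v → v ≤ v' → v' ≤ τ →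
      Λ (t + m * τ + v') - Λ (t + m * τ + v) = Λ (t + v') - Λ (t + v))
    (hZm : ∀ j n, Measurable (Z j n)) (hZ : iIndepFun (fun i : Fin d × ℕ => Z i.1 i.2) P)
    (hZF : ∀ j n, P.map (Z j n) = F j)
    (hNZ : IndepFun (fun ω (u : ℝ≥0) => N u ω) (fun ω (i : Fin d × ℕ) => Z i.1 i.2 ω) P) :
    IsIIDSeq (markedBlock d s N Z t τ)
      (((P.map (windowPath N τ t)).prod (Measure.infinitePi fun i : Fin d × ℕ => F i.1)).map
        (Function.uncurry (blockOf d s t τ))) P := by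
  have ha0 : ∀ m : ℕ, 0 ≤ t + m * τ := fun m => by positivity
  have hq : ∀ u : Icc (0 : ℚ) 1, (0 : ℝ) ≤ ((u : ℚ) : ℝ) ∧ ((u : ℚ) : ℝ) ≤ 1 := fun u =>
    ⟨by exact_mod_cast u.2.1, by exact_mod_cast u.2.2⟩
  have hZall : Measurable fun ω (i : Fin d × ℕ) => Z i.1 i.2 ω :=
    measurable_pi_lambda _ fun i => hZm _ _
  -- the window paths have the same law
  have hwin : ∀ m : ℕ, P.map (windowPath N τ (t + m * τ)) = P.map (windowPath N τ t) := fun m => by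
    have h := hN.map_window_eq (ha0 m) ht (hΛ m)
    let g : (Icc 0 τ → ℕ) → Icc (0 : ℚ) 1 → ℕ := fun p u =>
      p ⟨τ * (u : ℚ), mul_nonneg hτ (hq u).1, mul_le_of_le_one_right hτ (hq u).2⟩
    have hg : Measurable g := measurable_pi_lambda _ fun u => measurable_pi_apply _
    have hm : ∀ a, 0 ≤ a → Measurable fun ω (v : Icc 0 τ) => N (a + v) ω - N a ω := fun a ha =>
      measurable_pi_lambda _ fun v =>
        (hN.measurable _ (add_nonneg ha v.2.1)).sub (hN.measurable _ ha)
    have h' := congrArg (Measure.map g) h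
    rw [Measure.map_map hg (hm _ (ha0 m)), Measure.map_map hg (hm _ ht)] at h'
    exact h'
  have key : ∀ m : ℕ, IndepFun (fun ω (i : Fin m) => markedBlock d s N Z t τ i ω)
      (fun ω => (windowPath N τ (t + m * τ) ω,
        shiftMarks (N (t + m * τ) ω) fun i => Z i.1 i.2 ω)) P ∧
      P.map (fun ω => (windowPath N τ (t + m * τ) ω,
        shiftMarks (N (t + m * τ) ω) fun i => Z i.1 i.2 ω))
        = (P.map (windowPath N τ (t + m * τ))).prod
          (Measure.infinitePi fun i : Fin d × ℕ => F i.1) := fun m => by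
    have hpf := hN.indepFun_past_future (ha0 m)
    have hA : Measurable fun ω (u : Icc 0 (t + m * τ)) => N u ω :=
      measurable_pi_lambda _ fun u => hN.measurable _ u.2.1
    have hC := hN.measurable_windowPath hτ (ha0 m)
    have hAC : IndepFun (fun ω (u : Icc 0 (t + m * τ)) => N u ω)
        (windowPath N τ (t + m * τ)) P := by
      have hg : Measurable fun (p : Ici (0 : ℝ) → ℕ) (u : Icc (0 : ℚ) 1) =>
          p ⟨τ * (u : ℚ), mul_nonneg hτ (hq u).1⟩ :=
        measurable_pi_lambda _ fun u => measurable_pi_apply _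
      exact hpf.comp measurable_id hg
    have hACZ : IndepFun (fun ω => ((fun u : Icc 0 (t + m * τ) => N u ω),
        windowPath N τ (t + m * τ) ω)) (fun ω (i : Fin d × ℕ) => Z i.1 i.2 ω) P := by
      have hg : Measurable fun p : ℝ≥0 → ℕ => ((fun u : Icc 0 (t + m * τ) => p ⟨u, u.2.1⟩),
          fun u : Icc (0 : ℚ) 1 => p ⟨t + m * τ + τ * (u : ℚ),
            add_nonneg (ha0 m) (mul_nonneg hτ (hq u).1)⟩ - p ⟨t + m * τ, ha0 m⟩) :=
        (measurable_pi_lambda _ fun u => measurable_pi_apply _).prodMk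
          (measurable_pi_lambda _ fun u =>
            (measurable_pi_apply _).sub (measurable_pi_apply _))
      exact hNZ.comp hg measurable_id
    -- the earlier blocks as a function of the path up to `t + m τ` and of the marks
    have hle : ∀ (i : Fin m) (u : Icc (0 : ℚ) 1), t + (i : ℕ) * τ + τ * (u : ℚ) ≤ t + m * τ :=
      fun i u => by
        have h1 : ((i : ℕ) : ℝ) + 1 ≤ m := by exact_mod_cast i.2
        nlinarith [mul_le_of_le_one_right hτ (hq u).2]
    have hle' : ∀ i : Fin m, t + (i : ℕ) * τ ≤ t + m * τ := fun i => by
      simpa using hle i 0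
    let c : (Icc 0 (t + m * τ) → ℕ) → Fin m → Icc (0 : ℚ) 1 → ℕ := fun a i u =>
      a ⟨t + (i : ℕ) * τ + τ * (u : ℚ), add_nonneg (ha0 i) (mul_nonneg hτ (hq u).1), hle i u⟩
        - a ⟨t + (i : ℕ) * τ, ha0 i, hle' i⟩
    let ψ : (Icc 0 (t + m * τ) → ℕ) × (Fin d × ℕ → ℝ) → Fin m → MarkedBlock := fun p i =>
      blockOf d s t τ (c p.1 i) (shiftMarks (p.1 ⟨t + (i : ℕ) * τ, ha0 i, hle' i⟩) p.2)
    have hψ : Measurable ψ := by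
      refine measurable_pi_lambda _ fun i => ?_
      have h1 : Measurable fun p : (Icc 0 (t + m * τ) → ℕ) × (Fin d × ℕ → ℝ) => c p.1 i :=
        measurable_pi_lambda _ fun u =>
          ((measurable_pi_apply _).comp measurable_fst).sub
            ((measurable_pi_apply _).comp measurable_fst)
      have h2 : Measurable fun p : (Icc 0 (t + m * τ) → ℕ) × (Fin d × ℕ → ℝ) =>
          (p.1 ⟨t + (i : ℕ) * τ, ha0 i, hle' i⟩, p.2) :=
        ((measurable_pi_apply _).comp measurable_fst).prodMk measurable_snd
      exact (measurable_blockOf d s t τ).comp (h1.prodMk (measurable_shiftMarks.comp h2))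
    refine indepFun_split_marks (κ := fun a => a ⟨t + m * τ, ha0 m, le_rfl⟩) (ψ := ψ) hZ
      (fun i => hZm _ _) (fun i => hZF _ _) hA hC hAC hACZ (measurable_pi_apply _) hψ fun ω => ?_
    funext i
    refine blockOf_congr fun j l hl => ?_
    have h1 : N (t + (i : ℕ) * τ) ω + 1 + l ≤ N (t + m * τ) ω := by
      have h2 := hN.le ω (add_nonneg (ha0 i) (mul_nonneg hτ (hq 1).1)) (hle i 1)
      have h3 : l < N (t + (i : ℕ) * τ + τ * ((1 : Icc (0 : ℚ) 1) : ℚ)) ω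
          - N (t + (i : ℕ) * τ) ω := hl
      omega
    simp only [shiftMarks, truncMarks]
    rw [if_pos h1]
  have hpair : ∀ m : ℕ, Measurable fun ω => (windowPath N τ (t + m * τ) ω,
      shiftMarks (N (t + m * τ) ω) fun i : Fin d × ℕ => Z i.1 i.2 ω) := fun m =>
    (hN.measurable_windowPath hτ (ha0 m)).prodMk
      (measurable_shiftMarks.comp ((hN.measurable _ (ha0 m)).prodMk hZall))
  refine ⟨fun m => (measurable_blockOf d s t τ).comp (hpair m), fun m => ?_,
    fun m => (key m).1.comp measurable_id (measurable_blockOf d s t τ)⟩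
  rw [← hwin m, ← (key m).2, Measure.map_map (measurable_blockOf d s t τ) (hpair m)]
  rfl

end Blocks

/-! ### The jump times of a counting process -/

section Arrivals

variable {Ω : Type*} {N : ℝ → Ω → ℕ}

lemma arrival_nonneg (N : ℝ → Ω → ℕ) (n : ℕ) (ω : Ω) : 0 ≤ arrival N n ω :=
  Real.sInf_nonneg fun _ h => h.1

lemma arrival_le {n : ℕ} {ω : Ω} {u : ℝ} (hu : 0 ≤ u) (h : n ≤ N u ω) : arrival N n ω ≤ u :=
  csInf_le ⟨0, fun _ h => h.1⟩ ⟨hu, h⟩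

variable [MeasurableSpace Ω] {P : Measure Ω} {Λ : ℝ → ℝ}

namespace IsPoissonProcess

/-- By right-continuity, the `n`-th jump has occurred at its arrival time. -/
lemma le_apply_arrival (hN : IsPoissonProcess N Λ P) {n : ℕ} {ω : Ω} {t : ℝ} (ht : 0 ≤ t)
    (h : n ≤ N t ω) : n ≤ N (arrival N n ω) ω := by
  set a := arrival N n ω with ha
  have h0 := arrival_nonneg N n ω
  have hc := hN.rightCont ω a h0
  have hev : ∀ᶠ u in 𝓝[Ici a] a, N u ω = N a ω := by
    have := hc.tendsto.eventually (IsOpen.mem_nhds (isOpen_discrete {N a ω}) rfl)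
    exact this
  obtain ⟨ε, hε, hball⟩ := Metric.mem_nhdsWithin_iff.1 hev
  obtain ⟨u, ⟨hu0, hu1⟩, hu2⟩ := exists_lt_of_csInf_lt (s := {u : ℝ | 0 ≤ u ∧ n ≤ N u ω})
    ⟨t, ht, h⟩ (show sInf {u : ℝ | 0 ≤ u ∧ n ≤ N u ω} < a + ε from lt_add_of_pos_right a hε)
  have hau : a ≤ u := arrival_le hu0 hu1
  have : N u ω = N a ω := hball ⟨by
    rw [Metric.mem_ball, Real.dist_eq, abs_of_nonneg (sub_nonneg.2 hau)]; linarith, hau⟩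
  rw [← this]
  exact hu1

lemma arrival_le_iff (hN : IsPoissonProcess N Λ P) {n : ℕ} {ω : Ω} {t u : ℝ} (ht : 0 ≤ t)
    (h : n ≤ N t ω) (hu : 0 ≤ u) : arrival N n ω ≤ u ↔ n ≤ N u ω :=
  ⟨fun h' => (hN.le_apply_arrival ht h).trans (hN.le ω (arrival_nonneg N n ω) h'),
    arrival_le hu⟩

lemma arrival_zero (hN : IsPoissonProcess N Λ P) (ω : Ω) : arrival N 0 ω = 0 :=
  le_antisymm (arrival_le le_rfl (by rw [hN.zero])) (arrival_nonneg N 0 ω)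

lemma arrival_pos (hN : IsPoissonProcess N Λ P) {n : ℕ} {ω : Ω} {t : ℝ} (ht : 0 ≤ t)
    (hn : 1 ≤ n) (h : n ≤ N t ω) : 0 < arrival N n ω := by
  refine lt_of_le_of_ne (arrival_nonneg N n ω) fun h0 => ?_
  have := hN.le_apply_arrival ht h
  rw [← h0, hN.zero] at this
  omega

/-- Jumps have size one. -/
lemma apply_arrival (hN : IsPoissonProcess N Λ P) {n : ℕ} {ω : Ω} {t : ℝ} (ht : 0 ≤ t)
    (h : n ≤ N t ω) : N (arrival N n ω) ω = n := by
  refine le_antisymm ?_ (hN.le_apply_arrival ht h)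
  rcases Nat.eq_zero_or_pos n with rfl | hn
  · rw [hN.arrival_zero, hN.zero]
  · obtain ⟨u, hu0, hu1, hu2⟩ := hN.unitJumps ω _ (hN.arrival_pos ht hn h)
    have h1 : ¬ n ≤ N u ω := fun h' => not_lt.2 (arrival_le hu0 h') hu1
    omega

lemma arrival_lt_arrival (hN : IsPoissonProcess N Λ P) {i j : ℕ} {ω : Ω} {t : ℝ} (ht : 0 ≤ t)
    (hij : i < j) (h : j ≤ N t ω) : arrival N i ω < arrival N j ω := by
  by_contra hlt
  have h1 := (hN.arrival_le_iff ht h (arrival_nonneg N i ω)).1 (not_lt.1 hlt)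
  rw [hN.apply_arrival ht (hij.le.trans h)] at h1
  omega

lemma localArrival_windowPath (hN : IsPoissonProcess N Λ P) {τ a : ℝ} (hτ : 0 < τ) (ha : 0 ≤ a)
    {ω : Ω} {i : ℕ} (hi : 1 ≤ i) (hi' : i ≤ windowPath N τ a ω 1) :
    localArrival τ (windowPath N τ a ω) i = arrival N (N a ω + i) ω - a := by
  have h1 : N a ω + i ≤ N (a + τ) ω := by
    simp only [windowPath, Icc.coe_one, Rat.cast_one, mul_one] at hi'
    omega
  have haτ : 0 ≤ a + τ := by positivity
  set T := arrival N (N a ω + i) ω with hT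
  have hTle : T ≤ a + τ := arrival_le haτ h1
  have haT : a < T := by
    by_contra hlt
    have := (hN.arrival_le_iff haτ h1 ha).1 (not_lt.1 hlt)
    omega
  have hq : ∀ u : Icc (0 : ℚ) 1, (0 : ℝ) ≤ ((u : ℚ) : ℝ) := fun u => by exact_mod_cast u.2.1
  have hiff : ∀ u : Icc (0 : ℚ) 1, i ≤ windowPath N τ a ω u ↔ T - a ≤ τ * (u : ℚ) := fun u => by
    have h0 : 0 ≤ a + τ * (u : ℚ) := add_nonneg ha (mul_nonneg hτ.le (hq u))
    have h2 := hN.arrival_le_iff haτ h1 h0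
    have h3 := hN.le ω ha (le_add_of_nonneg_right (a := a) (mul_nonneg hτ.le (hq u)))
    rw [sub_le_iff_le_add', h2]
    simp only [windowPath]
    omega
  have hlow : ∀ u : Icc (0 : ℚ) 1,
      T - a ≤ if i ≤ windowPath N τ a ω u then τ * (u : ℚ) else τ := fun u => by
    split_ifs with h
    · exact (hiff u).1 h
    · linarith
  refine le_antisymm (le_of_forall_pos_lt_add fun ε hε => ?_) (le_ciInf hlow)
  by_cases hlt : (T - a) / τ < 1
  · -- a rational point shortly after the jump
    obtain ⟨x, hx1, hx2⟩ := exists_rat_btwn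
      (show (T - a) / τ < min 1 ((T - a + ε) / τ) from
        lt_min hlt (div_lt_div_of_pos_right (by linarith) hτ))
    have hx0 : (0 : ℝ) < x := lt_trans (div_pos (by linarith) hτ) hx1
    have hx : x ∈ Icc (0 : ℚ) 1 :=
      ⟨by exact_mod_cast hx0.le, by exact_mod_cast (hx2.trans_le (min_le_left _ _)).le⟩
    refine (ciInf_le ⟨T - a, by rintro _ ⟨u, rfl⟩; exact hlow u⟩ ⟨x, hx⟩).trans_lt ?_
    have hxT : T - a ≤ τ * (x : ℝ) := by
      rw [div_lt_iff₀ hτ] at hx1; linarith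
    rw [if_pos ((hiff ⟨x, hx⟩).2 hxT)]
    have := hx2.trans_le (min_le_right _ _)
    rw [lt_div_iff₀ hτ] at this
    change τ * (x : ℝ) < _
    linarith
  · have hge : τ ≤ T - a := by
      rw [not_lt, le_div_iff₀ hτ] at hlt; linarith
    refine (ciInf_le ⟨T - a, by rintro _ ⟨u, rfl⟩; exact hlow u⟩ 1).trans_lt ?_
    have : (if i ≤ windowPath N τ a ω 1 then τ * (((1 : Icc (0 : ℚ) 1) : ℚ) : ℝ) else τ) = τ := by
      simp
    rw [this]
    linarith

end IsPoissonProcess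

end Arrivals

/-! ### The coefficients of a period as functions of its block -/

section Partition

variable {d : ℕ} {s : ℕ → ℝ}

lemma IsPeriodicPartition.period_eq (h : IsPeriodicPartition d s) : period d s = s d := by
  rw [period, Finset.sum_range_sub, h.zero, sub_zero]

lemma IsPeriodicPartition.period_pos (h : IsPeriodicPartition d s) : 0 < period d s := by
  rw [h.period_eq, ← h.zero]
  exact h.strictMono h.d_pos

lemma IsPeriodicPartition.add_period (h : IsPeriodicPartition d s) (j : ℕ) :
    s (j + d) = s j + period d s := by
  rw [h.period_eq]
  induction j with
  | zero => simp [h.zero]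
  | succ j ih =>
    have := h.periodic j
    rw [show j + 1 + d = j + d + 1 by ring]
    linarith

lemma IsPeriodicPartition.add_mul_period (h : IsPeriodicPartition d s) (j k : ℕ) :
    s (j + k * d) = s j + k * period d s := by
  induction k with
  | zero => simp
  | succ k ih =>
    rw [show j + (k + 1) * d = j + k * d + d by ring, h.add_period, ih]
    push_cast
    ring

lemma IsPeriodicPartition.nonneg (h : IsPeriodicPartition d s) (j : ℕ) : 0 ≤ s j :=
  h.zero ▸ h.strictMono.monotone (Nat.zero_le j)

lemma IsPeriodicPartition.mem_season_iff (h : IsPeriodicPartition d s) (j : Fin d) (x : ℝ) :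
    x ∈ season d s j ↔
      ∃ k : ℕ, s j + k * period d s < x ∧ x ≤ s (j + 1) + k * period d s := by
  simp only [season, mem_iUnion, mem_Ioc, h.add_mul_period]

/-- The seasons are periodic on the positive half-line. -/
lemma IsPeriodicPartition.add_mem_season_iff (h : IsPeriodicPartition d s) (j : Fin d) (m : ℕ)
    {x : ℝ} (hx : 0 < x) : x + m * period d s ∈ season d s j ↔ x ∈ season d s j := by
  rw [h.mem_season_iff, h.mem_season_iff]
  have hτ := h.period_pos
  constructor
  · rintro ⟨k, h1, h2⟩
    have hmk : m ≤ k := by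
      by_contra hlt
      have h3 : ((k : ℕ) : ℝ) + 1 ≤ m := by exact_mod_cast not_le.1 hlt
      have h4 : s (j + 1) ≤ period d s := by
        rw [h.period_eq]; exact h.strictMono.monotone j.2
      nlinarith
    refine ⟨k - m, ?_, ?_⟩
    · rw [Nat.cast_sub hmk]; nlinarith
    · rw [Nat.cast_sub hmk]; nlinarith
  · rintro ⟨k, h1, h2⟩
    refine ⟨k + m, ?_, ?_⟩
    · push_cast; nlinarith
    · push_cast; nlinarith

/-- The seasons partition the positive half-line. -/
lemma IsPeriodicPartition.existsUnique_season (h : IsPeriodicPartition d s) {x : ℝ} (hx : 0 < x) :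
    ∃! j : Fin d, x ∈ season d s j := by
  have hτ := h.period_pos
  have hd : 0 < d := h.d_pos
  -- the index of the interval of the partition that contains `x`
  have hunb : ∃ n, x ≤ s n := by
    obtain ⟨k, hk⟩ := exists_nat_ge (x / period d s)
    refine ⟨0 + k * d, ?_⟩
    rw [h.add_mul_period, h.zero, zero_add]
    exact (div_le_iff₀ hτ).1 hk
  classical
  have hn := Nat.find_spec hunb
  set n := Nat.find hunb with hn'
  have hn0 : n ≠ 0 := fun h0 => by
    rw [h0, h.zero] at hn; linarith
  obtain ⟨l, hl⟩ := Nat.exists_eq_succ_of_ne_zero hn0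
  rw [hl] at hn
  have hlow : s l < x := not_le.1 (Nat.find_min hunb (by omega))
  have huniq : ∀ i, s i < x → x ≤ s (i + 1) → i = l := fun i h1 h2 => by
    have h3 : l < i + 1 := h.strictMono.lt_iff_lt.1 (hlow.trans_le h2)
    have h4 : i < l + 1 := h.strictMono.lt_iff_lt.1 (h1.trans_le hn)
    omega
  refine ⟨⟨l % d, Nat.mod_lt _ hd⟩, ?_, ?_⟩
  · refine mem_iUnion.2 ⟨l / d, ?_, ?_⟩
    · rwa [Nat.mod_add_div' l d]
    · rw [add_right_comm, Nat.mod_add_div' l d]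
      exact hn
  · intro j hj
    obtain ⟨k, h1, h2⟩ := mem_iUnion.1 hj
    rw [add_right_comm] at h2
    have := huniq _ h1 h2
    refine Fin.ext ?_
    simp only
    rw [← this, Nat.add_mul_mod_self_right, Nat.mod_eq_of_lt j.2]

end Partition

section Coefficients

variable {q : ℕ} (α β : ℕ → ℝ)

lemma exp_add_smul (M : Matrix (Fin q) (Fin q) ℝ) (a b : ℝ) :
    NormedSpace.exp ((a + b) • M) = NormedSpace.exp (a • M) * NormedSpace.exp (b • M) := by
  rw [add_smul]
  exact Matrix.exp_add_of_commute _ _ (((Commute.refl M).smul_left a).smul_right b)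

lemma descProd_shift {C C' : ℕ → Matrix (Fin q) (Fin q) ℝ} {a b m : ℕ}
    (h : ∀ l, 1 ≤ l → l ≤ m → C (a + l) = C' (b + l)) : descProd C a m = descProd C' b m := by
  induction m with
  | zero => rfl
  | succ m ih =>
    simp only [descProd]
    rw [ih fun l h1 h2 => h l h1 (h2.trans (Nat.le_succ m)), add_assoc, add_assoc,
      h (m + 1) (by omega) le_rfl]

variable {α β} {T z T' z' : ℕ → ℝ} {k n : ℕ} {u : ℝ}

lemma stepMatrix_shift (hT : ∀ i, 1 ≤ i → i ≤ n - k → T' i = T (k + i) - u)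
    (hz : ∀ i, 1 ≤ i → i ≤ n - k → z' i = z (k + i)) {l : ℕ} (h2 : 2 ≤ l) (hl : l ≤ n - k) :
    stepMatrix q α β T z (k + l) = stepMatrix q α β T' z' l := by
  have h1 : T (k + l) - T (k + l - 1) = T' l - T' (l - 1) := by
    rw [hT l (by omega) hl, hT (l - 1) (by omega) (by omega), show k + l - 1 = k + (l - 1) by omega]
    ring
  rw [stepMatrix, stepMatrix, hz l (by omega) hl, h1]

/-- The jumps before time `u` only enter `J_{u,t}` through the flow from `T k` to `u`, which
cancels against a part of the first factor. -/
lemma pathJ_shift (hkn : k ≤ n) (hT0 : T' 0 = 0)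
    (hT : ∀ i, 1 ≤ i → i ≤ n - k → T' i = T (k + i) - u)
    (hz : ∀ i, 1 ≤ i → i ≤ n - k → z' i = z (k + i)) (t : ℝ) :
    pathJ q α β T z k n u t = pathJ q α β T' z' 0 (n - k) 0 (t - u) := by
  have key : ∀ m, m + 1 ≤ n - k → descProd (stepMatrix q α β T z) k (m + 1) *
      NormedSpace.exp ((T k - u) • companion q β)
        = descProd (stepMatrix q α β T' z') 0 (m + 1) := fun m hm => by
    induction m with
    | zero =>
      simp only [descProd, mul_one, zero_add, add_zero]
      have h1 : T' 1 - T' (1 - 1) = (T (k + 1) - T (k + 1 - 1)) + (T k - u) := by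
        simp only [Nat.sub_self, Nat.add_sub_cancel, hT0]
        rw [hT 1 le_rfl hm]
        ring
      rw [stepMatrix, stepMatrix, hz 1 le_rfl hm, h1, exp_add_smul, ← mul_assoc]
    | succ m ih =>
      have h1 := ih (by omega)
      rw [descProd] at h1 ⊢
      rw [mul_assoc, descProd, h1, add_assoc k, stepMatrix_shift hT hz (by omega) hm]
      simp only [descProd, zero_add]
  rw [pathJ, pathJ, Nat.sub_zero, hT0, sub_zero, zero_smul, NormedSpace.exp_zero, mul_one]
  obtain ⟨m, hm⟩ | h0 : (∃ m, n - k = m + 1) ∨ n = k := by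
    rcases Nat.eq_zero_or_pos (n - k) with h | h
    · right; omega
    · left; exact ⟨n - k - 1, by omega⟩
  · rw [mul_assoc, hm, key m hm.ge, ← hm, hT (n - k) (by omega) le_rfl,
      show k + (n - k) = n by omega]
    congr 3
    ring
  · subst h0
    simp only [Nat.sub_self, descProd, mul_one, hT0, sub_zero]
    rw [← exp_add_smul]
    congr 2
    ring

lemma pathK_shift (hkn : k ≤ n)
    (hT : ∀ i, 1 ≤ i → i ≤ n - k → T' i = T (k + i) - u)
    (hz : ∀ i, 1 ≤ i → i ≤ n - k → z' i = z (k + i)) (t : ℝ) :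
    pathK q α β T z k n t = pathK q α β T' z' 0 (n - k) (t - u) := by
  rcases Nat.eq_zero_or_pos (n - k) with h0 | h0
  · simp [pathK, h0]
  rw [pathK, pathK, Nat.sub_zero, hT (n - k) h0 le_rfl, show k + (n - k) = n by omega]
  congr 1
  · congr 2
    ring
  · refine Finset.sum_congr rfl fun i hi => ?_
    have hi' := Finset.mem_range.1 hi
    rw [hz (n - k - i) (by omega) (by omega), show k + (n - k - i) = n - i by omega]
    congr 1
    refine descProd_shift fun l h1 h2 => ?_
    rw [show n - i + l = k + (n - k - i + l) by omega]
    exact stepMatrix_shift hT hz (by omega) (by omega)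

end Coefficients

section BlockCoefficients

variable {Ω : Type*} {N : ℝ → Ω → ℕ} {d : ℕ} {s : ℕ → ℝ} {Z : Fin d → ℕ → Ω → ℝ} {q : ℕ}
  {α β : ℕ → ℝ} {t : ℝ}

/-- The matrix `J` of a period with block `R`. -/
def blockJ (q : ℕ) (α β : ℕ → ℝ) (τ : ℝ) (R : MarkedBlock) : Matrix (Fin q) (Fin q) ℝ :=
  pathJ q α β R.2.1 R.2.2 0 R.1 0 τ

/-- The vector `K` of a period with block `R`. -/
def blockK (q : ℕ) (α β : ℕ → ℝ) (τ : ℝ) (R : MarkedBlock) : Fin q → ℝ :=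
  pathK q α β R.2.1 R.2.2 0 R.1 τ

lemma markedBlock_count (N : ℝ → Ω → ℕ) (Z : Fin d → ℕ → Ω → ℝ) (τ : ℝ) (m : ℕ) (ω : Ω) :
    (markedBlock d s N Z t τ m ω).1 = N (t + m * τ + τ) ω - N (t + m * τ) ω := by
  simp [markedBlock, blockOf, windowPath]

variable [MeasurableSpace Ω] {P : Measure Ω} {Λ : ℝ → ℝ}

lemma IsPoissonProcess.markedBlock_time (hN : IsPoissonProcess N Λ P) {τ : ℝ} (hτ : 0 < τ)
    (ht : 0 ≤ t) {m : ℕ} {ω : Ω} {i : ℕ} (hi : 1 ≤ i)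
    (hi' : i ≤ N (t + m * τ + τ) ω - N (t + m * τ) ω) :
    (markedBlock d s N Z t τ m ω).2.1 i
      = arrival N (N (t + m * τ) ω + i) ω - (t + m * τ) :=
  hN.localArrival_windowPath hτ (by positivity) hi
    (by simpa only [windowPath, Icc.coe_one, Rat.cast_one, mul_one] using hi')

lemma IsPoissonProcess.markedBlock_size (hN : IsPoissonProcess N Λ P)
    (hs : IsPeriodicPartition d s) (ht : 0 ≤ t) {m : ℕ} {ω : Ω} {i : ℕ} (hi : 1 ≤ i)
    (hi' : i ≤ N (t + m * period d s + period d s) ω - N (t + m * period d s) ω) :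
    (markedBlock d s N Z t (period d s) m ω).2.2 i
      = jumpSize d s N Z (N (t + m * period d s) ω + i) ω := by
  have hτ := hs.period_pos
  have ha : 0 ≤ t + m * period d s := by positivity
  have ha' : 0 ≤ t + m * period d s + period d s := by positivity
  have hT := hN.markedBlock_time (Z := Z) (s := s) hτ ht hi hi'
  have hcount : 1 ≤ i ∧ i ≤ windowPath N (period d s) (t + m * period d s) ω 1 :=
    ⟨hi, by simpa only [windowPath, Icc.coe_one, Rat.cast_one, mul_one] using hi'⟩
  have hpos : t + m * period d s < arrival N (N (t + m * period d s) ω + i) ω := by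
    by_contra hlt
    have := (hN.arrival_le_iff ha' (by omega) ha).1 (not_lt.1 hlt)
    omega
  simp only [markedBlock, blockOf] at hT ⊢
  rw [if_pos hcount, hT, jumpSize]
  refine Finset.sum_congr rfl fun j _ => ?_
  have hx : 0 < t + (arrival N (N (t + m * period d s) ω + i) ω - (t + m * period d s)) := by
    linarith
  have hiff := hs.add_mem_season_iff j m hx
  rw [show t + (arrival N (N (t + m * period d s) ω + i) ω - (t + m * period d s))
    + m * period d s = arrival N (N (t + m * period d s) ω + i) ω by ring] at hiff
  have hidx : N (t + m * period d s) ω + 1 + (i - 1) = N (t + m * period d s) ω + i := by omega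
  by_cases h : arrival N (N (t + m * period d s) ω + i) ω ∈ season d s j
  · rw [indicator_of_mem h, indicator_of_mem (hiff.1 h)]
    simp only [shiftMarks, hidx]
  · rw [indicator_of_notMem h, indicator_of_notMem fun h' => h (hiff.2 h')]

theorem IsPoissonProcess.coeffJ_eq_blockJ (hN : IsPoissonProcess N Λ P)
    (hs : IsPeriodicPartition d s) (ht : 0 ≤ t) (m : ℕ) (ω : Ω) :
    coeffJ q α β d s N Z (t + m * period d s) (t + m * period d s + period d s) ω
      = blockJ q α β (period d s) (markedBlock d s N Z t (period d s) m ω) := by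
  have hτ := hs.period_pos
  have hle := hN.le ω (u := t + m * period d s) (v := t + m * period d s + period d s)
    (by positivity) (by linarith)
  rw [coeffJ, blockJ, markedBlock_count, pathJ_shift
    (T' := (markedBlock d s N Z t (period d s) m ω).2.1)
    (z' := (markedBlock d s N Z t (period d s) m ω).2.2) hle
    (localArrival_zero _ hτ.le _) (fun i hi hi' => hN.markedBlock_time hτ ht hi hi')
    (fun i hi hi' => hN.markedBlock_size hs ht hi hi'), add_sub_cancel_left]

theorem IsPoissonProcess.coeffK_eq_blockK (hN : IsPoissonProcess N Λ P)
    (hs : IsPeriodicPartition d s) (ht : 0 ≤ t) (m : ℕ) (ω : Ω) :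
    coeffK q α β d s N Z (t + m * period d s) (t + m * period d s + period d s) ω
      = blockK q α β (period d s) (markedBlock d s N Z t (period d s) m ω) := by
  have hτ := hs.period_pos
  have hle := hN.le ω (u := t + m * period d s) (v := t + m * period d s + period d s)
    (by positivity) (by linarith)
  rw [coeffK, blockK, markedBlock_count, pathK_shift
    (T' := (markedBlock d s N Z t (period d s) m ω).2.1)
    (z' := (markedBlock d s N Z t (period d s) m ω).2.2) hle
    (fun i hi hi' => hN.markedBlock_time hτ ht hi hi')
    (fun i hi hi' => hN.markedBlock_size hs ht hi hi'), add_sub_cancel_left]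

end BlockCoefficients

/-! ### Measurability of the coefficients of a block -/

section MeasurableCoefficients

open Matrix.Norms.Operator in
lemma continuous_exp_smul {q : ℕ} (M : Matrix (Fin q) (Fin q) ℝ) :
    Continuous fun a : ℝ => NormedSpace.exp (a • M) :=
  (NormedSpace.exp_continuous (𝔸 := Matrix (Fin q) (Fin q) ℝ)).comp
    (continuous_id.smul continuous_const)

lemma measurable_exp_smul_entry {X : Type*} [MeasurableSpace X] {q : ℕ}
    (M : Matrix (Fin q) (Fin q) ℝ) {f : X → ℝ} (hf : Measurable f) (i j : Fin q) :
    Measurable fun x => NormedSpace.exp (f x • M) i j :=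
  (((continuous_exp_smul M).matrix_elem i j).measurable).comp hf

variable {X : Type*} [MeasurableSpace X] {q : ℕ}

lemma measurable_mul_entry {A B : X → Matrix (Fin q) (Fin q) ℝ}
    (hA : ∀ i j, Measurable fun x => A x i j) (hB : ∀ i j, Measurable fun x => B x i j)
    (i j : Fin q) : Measurable fun x => (A x * B x) i j := by
  simp only [Matrix.mul_apply]
  exact Finset.measurable_sum _ fun l _ => (hA i l).mul (hB l j)

lemma measurable_mulVec {A : X → Matrix (Fin q) (Fin q) ℝ} {v : X → Fin q → ℝ}
    (hA : ∀ i j, Measurable fun x => A x i j) (hv : Measurable v) :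
    Measurable fun x => A x *ᵥ v x := by
  refine measurable_pi_lambda _ fun i => ?_
  simp only [Matrix.mulVec, dotProduct]
  exact Finset.measurable_sum _ fun l _ => (hA i l).mul ((measurable_pi_apply l).comp hv)

variable {α β : ℕ → ℝ}

lemma measurable_stepMatrix_entry (n : ℕ) (i j : Fin q) :
    Measurable fun p : (ℕ → ℝ) × (ℕ → ℝ) => stepMatrix q α β p.1 p.2 n i j := by
  refine measurable_mul_entry (fun i j => ?_) (fun i j => ?_) i j
  · have : Measurable fun p : (ℕ → ℝ) × (ℕ → ℝ) => p.2 n :=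
      (measurable_pi_apply n).comp measurable_snd
    simp only [Matrix.add_apply, Matrix.smul_apply, smul_eq_mul]
    exact measurable_const.add ((this.pow_const 2).mul_const _)
  · have h : ∀ l, Measurable fun p : (ℕ → ℝ) × (ℕ → ℝ) => p.1 l := fun l =>
      (measurable_pi_apply l).comp measurable_fst
    exact measurable_exp_smul_entry (f := fun p : (ℕ → ℝ) × (ℕ → ℝ) => p.1 n - p.1 (n - 1)) _
      ((h _).sub (h _)) i j

lemma measurable_descProd_entry (k n : ℕ) (i j : Fin q) :
    Measurable fun p : (ℕ → ℝ) × (ℕ → ℝ) => descProd (stepMatrix q α β p.1 p.2) k n i j := by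
  induction n generalizing i j with
  | zero => exact measurable_const
  | succ n ih => exact measurable_mul_entry (measurable_stepMatrix_entry _) ih i j

lemma measurable_blockJ_entry (τ : ℝ) (i j : Fin q) :
    Measurable fun R => blockJ q α β τ R i j := by
  refine measurable_from_prod_countable_right fun n => ?_
  have h : ∀ l, Measurable fun p : (ℕ → ℝ) × (ℕ → ℝ) => p.1 l := fun l =>
    (measurable_pi_apply l).comp measurable_fst
  exact measurable_mul_entry (measurable_mul_entry
    (measurable_exp_smul_entry (f := fun p : (ℕ → ℝ) × (ℕ → ℝ) => τ - p.1 n) _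
      (measurable_const.sub (h _))) (measurable_descProd_entry _ _))
    (measurable_exp_smul_entry (f := fun p : (ℕ → ℝ) × (ℕ → ℝ) => p.1 0 - 0) _
      ((h _).sub measurable_const)) i j

lemma measurable_blockK (τ : ℝ) : Measurable (blockK q α β τ) := by
  refine measurable_from_prod_countable_right fun n => ?_
  have h : ∀ l, Measurable fun p : (ℕ → ℝ) × (ℕ → ℝ) => p.1 l := fun l =>
    (measurable_pi_apply l).comp measurable_fst
  have h' : ∀ l, Measurable fun p : (ℕ → ℝ) × (ℕ → ℝ) => (α 0 * p.2 l ^ 2) • eVec q := fun l =>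
    (measurable_const.mul (((measurable_pi_apply l).comp measurable_snd).pow_const 2)).smul_const _
  have hsum : Measurable fun p : (ℕ → ℝ) × (ℕ → ℝ) => ∑ i ∈ Finset.range (n - 0),
      descProd (stepMatrix q α β p.1 p.2) (n - i) i *ᵥ ((α 0 * p.2 (n - i) ^ 2) • eVec q) :=
    Finset.measurable_sum _ fun i _ => measurable_mulVec (measurable_descProd_entry _ _) (h' _)
  exact measurable_mulVec (A := fun p : (ℕ → ℝ) × (ℕ → ℝ) =>
    NormedSpace.exp ((τ - p.1 n) • companion q β))
    (measurable_exp_smul_entry (f := fun p : (ℕ → ℝ) × (ℕ → ℝ) => τ - p.1 n) _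
      (measurable_const.sub (h _))) hsum

/-- The affine map `x ↦ J x + K` of a period with block `R`. -/
def blockMap (q : ℕ) (α β : ℕ → ℝ) (τ : ℝ) (R : MarkedBlock) (x : Fin q → ℝ) : Fin q → ℝ :=
  blockJ q α β τ R *ᵥ x + blockK q α β τ R

lemma measurable_blockMap (τ : ℝ) : Measurable (Function.uncurry (blockMap q α β τ)) :=
  (measurable_mulVec (fun i j => (measurable_blockJ_entry τ i j).comp measurable_fst)
    measurable_snd).add ((measurable_blockK τ).comp measurable_fst)

lemma continuous_blockMap (τ : ℝ) (R : MarkedBlock) : Continuous (blockMap q α β τ R) :=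
  (continuous_const.matrix_mulVec continuous_id).add continuous_const

end MeasurableCoefficients

/-! ### Càdlàg paths -/

section Cadlag

variable {E : Type*} [NormedAddCommGroup E] {y : ℝ → E}

/-- An approximation from the left by functions with countably many values: evaluated along it, a
path with left limits gives its left limit as a limit of measurable functions. -/
lemma tendsto_pred_ceil_div (u : ℝ) :
    Tendsto (fun n : ℕ => ((⌈(n : ℝ) * u⌉ : ℝ) - 1) / n) atTop (𝓝[<] u) := by
  refine tendsto_nhdsWithin_iff.2 ⟨?_, ?_⟩
  · have h1 : Tendsto (fun n : ℕ => u - 1 / (n : ℝ)) atTop (𝓝 (u - 0)) :=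
      tendsto_const_nhds.sub tendsto_one_div_atTop_nhds_zero_nat
    rw [sub_zero] at h1
    refine tendsto_of_tendsto_of_tendsto_of_le_of_le' h1 tendsto_const_nhds ?_ ?_
    · filter_upwards [eventually_gt_atTop 0] with n hn
      have hn' : (0 : ℝ) < n := by positivity
      rw [le_div_iff₀ hn', sub_mul, one_div, inv_mul_cancel₀ hn'.ne']
      linarith [Int.le_ceil ((n : ℝ) * u)]
    · filter_upwards [eventually_gt_atTop 0] with n hn
      have hn' : (0 : ℝ) < n := by positivity
      rw [div_le_iff₀ hn']
      linarith [Int.ceil_lt_add_one ((n : ℝ) * u)]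
  · filter_upwards [eventually_gt_atTop 0] with n hn
    have hn' : (0 : ℝ) < n := by positivity
    rw [mem_Iio, div_lt_iff₀ hn']
    linarith [Int.ceil_lt_add_one ((n : ℝ) * u)]

/-- A càdlàg path is bounded on bounded time intervals. -/
lemma exists_norm_le_of_cadlag (hr : ∀ t, 0 ≤ t → ContinuousWithinAt y (Ici t) t)
    (hl : ∀ t, 0 < t → ∃ l, Tendsto y (𝓝[<] t) (𝓝 l)) (T : ℝ) :
    ∃ C, ∀ u ∈ Icc 0 T, ‖y u‖ ≤ C := by
  have hbd : ∀ {l : Filter ℝ} {a : E}, Tendsto y l (𝓝 a) → ∀ᶠ u in l, ‖y u‖ ≤ ‖a‖ + 1 :=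
    fun h => (h.norm.eventually (gt_mem_nhds (lt_add_one _))).mono fun _ h => h.le
  refine isCompact_Icc.induction_on (p := fun S => ∃ C, ∀ u ∈ S, ‖y u‖ ≤ C) ⟨0, by simp⟩
    (fun S S' hS ⟨C, hC⟩ => ⟨C, fun u hu => hC u (hS hu)⟩)
    (fun S S' ⟨C, hC⟩ ⟨C', hC'⟩ => ⟨max C C', fun u hu => hu.elim
      (fun h => (hC u h).trans (le_max_left _ _)) fun h => (hC' u h).trans (le_max_right _ _)⟩)
    fun x hx => ?_
  have h1 := hbd (hr x hx.1)
  rcases hx.1.eq_or_lt with rfl | h0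
  · exact ⟨_, nhdsWithin_mono _ Icc_subset_Ici_self h1, _, fun u hu => hu⟩
  · obtain ⟨l, hl⟩ := hl x h0
    have h2 := hbd hl
    refine ⟨{u | ‖y u‖ ≤ max (‖l‖ + 1) (‖y x‖ + 1)}, mem_nhdsWithin_of_mem_nhds ?_, _,
      fun u hu => hu⟩
    rw [← nhdsLT_sup_nhdsGE]
    exact ⟨h2.mono fun u hu => hu.trans (le_max_left _ _),
      h1.mono fun u hu => hu.trans (le_max_right _ _)⟩

lemma tendsto_leftLim_of_cadlag (hl : ∀ t, 0 < t → ∃ l, Tendsto y (𝓝[<] t) (𝓝 l)) {t : ℝ}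
    (ht : 0 < t) : Tendsto y (𝓝[<] t) (𝓝 (Function.leftLim y t)) :=
  tendsto_leftLim_of_tendsto (hl t ht)

/-- The left limits of a càdlàg path are integrable on bounded time intervals. -/
lemma integrableOn_leftLim_of_cadlag (hr : ∀ t, 0 ≤ t → ContinuousWithinAt y (Ici t) t)
    (hl : ∀ t, 0 < t → ∃ l, Tendsto y (𝓝[<] t) (𝓝 l)) (T : ℝ) :
    IntegrableOn (Function.leftLim y) (Ioc 0 T) := by
  obtain ⟨C, hC⟩ := exists_norm_le_of_cadlag hr hl T
  have hlim : ∀ᵐ u ∂(volume.restrict (Ioc 0 T)),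
      Tendsto (fun n : ℕ => y (((⌈(n : ℝ) * u⌉ : ℝ) - 1) / n)) atTop
        (𝓝 (Function.leftLim y u)) := by
    filter_upwards [ae_restrict_mem measurableSet_Ioc] with u hu
    exact (tendsto_leftLim_of_cadlag hl hu.1).comp (tendsto_pred_ceil_div u)
  have hm : AEStronglyMeasurable (Function.leftLim y) (volume.restrict (Ioc 0 T)) := by
    refine aestronglyMeasurable_of_tendsto_ae atTop (fun n => ?_) hlim
    -- the approximating functions factor through the countable type `ℤ`
    have h1 : Measurable fun u : ℝ => ⌈(n : ℝ) * u⌉ := (measurable_const.mul measurable_id).ceil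
    have h2 : StronglyMeasurable fun k : ℤ => y (((k : ℝ) - 1) / n) :=
      StronglyMeasurable.of_discrete
    exact (h2.comp_measurable h1).aestronglyMeasurable
  refine Integrable.of_bound hm C ?_
  filter_upwards [ae_restrict_mem measurableSet_Ioc] with u hu
  refine le_of_tendsto (tendsto_leftLim_of_cadlag hl hu.1).norm ?_
  filter_upwards [Ioo_mem_nhdsLT hu.1] with v hv
  exact hC v ⟨hv.1.le, hv.2.le.trans hu.2⟩

end Cadlag

/-! ### The linear flow between two jumps -/

section Flow

variable {q : ℕ}

open Matrix.Norms.Operator in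
lemma hasDerivAt_exp_smul_mulVec (B : Matrix (Fin q) (Fin q) ℝ) (v : Fin q → ℝ) (a u : ℝ) :
    HasDerivAt (fun u => NormedSpace.exp ((u - a) • B) *ᵥ v)
      (B *ᵥ (NormedSpace.exp ((u - a) • B) *ᵥ v)) u := by
  let ℓ : Matrix (Fin q) (Fin q) ℝ →ₗ[ℝ] (Fin q → ℝ) :=
    { toFun := fun M => M *ᵥ v
      map_add' := fun M M' => Matrix.add_mulVec M M' v
      map_smul' := fun c M => Matrix.smul_mulVec c M v }
  have h1 := (hasDerivAt_exp_smul_const' (𝕂 := ℝ) B (u - a)).comp_sub_const u a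
  have h2 := ℓ.toContinuousLinearMap.hasFDerivAt.comp_hasDerivAt u h1
  have h3 : B *ᵥ (NormedSpace.exp ((u - a) • B) *ᵥ v)
      = (B * NormedSpace.exp ((u - a) • B)) *ᵥ v := Matrix.mulVec_mulVec _ _ _
  rw [h3]
  exact h2

/-- Solutions of `h' = B h` in integrated form. -/
lemma eq_exp_mulVec_of_integral_eq (B : Matrix (Fin q) (Fin q) ℝ) {h : ℝ → Fin q → ℝ} {a b : ℝ}
    (hab : a ≤ b) (hc : ContinuousOn h (Icc a b))
    (hint : ∀ u ∈ Icc a b, h u = h a + ∫ v in a..u, B *ᵥ h v) :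
    h b = NormedSpace.exp ((b - a) • B) *ᵥ h a := by
  -- a continuous extension of `h` to the line
  let k : ℝ → Fin q → ℝ := IccExtend hab ((Icc a b).domRestrict h)
  have hk : Continuous k := (continuousOn_iff_continuous_domRestrict.1 hc).Icc_extend'
  have hkh : ∀ u ∈ Icc a b, k u = h u := fun u hu => IccExtend_of_mem hab _ hu
  have hBk : Continuous fun v => B *ᵥ k v := continuous_const.matrix_mulVec hk
  let H : ℝ → Fin q → ℝ := fun u => h a + ∫ v in a..u, B *ᵥ k v
  have hH : ∀ u, HasDerivAt H (B *ᵥ k u) u := fun u =>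
    ((hBk.integral_hasStrictDerivAt a u).hasDerivAt).const_add (h a)
  have hHh : ∀ u ∈ Icc a b, H u = h u := fun u hu => by
    rw [hint u hu]
    simp only [H]
    congr 1
    refine intervalIntegral.integral_congr fun v hv => ?_
    rw [uIcc_of_le hu.1] at hv
    simp only [hkh v ⟨hv.1, hv.2.trans hu.2⟩]
  have hlip : ∀ _ : ℝ, LipschitzWith ‖(Matrix.mulVecLin B).toContinuousLinearMap‖₊
      fun x => B *ᵥ x := fun _ => (Matrix.mulVecLin B).toContinuousLinearMap.lipschitz
  have huniq := ODE_solution_unique (v := fun _ x => B *ᵥ x) (f := H)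
    (g := fun u => NormedSpace.exp ((u - a) • B) *ᵥ h a) (a := a) (b := b) hlip
    (fun u _ => (hH u).continuousAt.continuousWithinAt)
    (fun u hu => by
      have := (hH u).hasDerivWithinAt (s := Ici u)
      rwa [hkh u (Ico_subset_Icc_self hu), ← hHh u (Ico_subset_Icc_self hu)] at this)
    (fun u _ => (hasDerivAt_exp_smul_mulVec B (h a) a u).continuousAt.continuousWithinAt)
    (fun u _ => (hasDerivAt_exp_smul_mulVec B (h a) a u).hasDerivWithinAt)
    (by simp [H])
  have := huniq (right_mem_Icc.2 hab)
  rw [hHh b (right_mem_Icc.2 hab)] at this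
  exact this

/-- A path which on `[a, b)` is driven by `B` and its own left limits follows the flow of `B`. -/
lemma flow_of_integral_leftLim_eq (B : Matrix (Fin q) (Fin q) ℝ) {y : ℝ → Fin q → ℝ} {a b : ℝ}
    (hab : a < b) (hg : IntegrableOn (Function.leftLim y) (Ioc a b))
    (hy : ∀ u ∈ Ico a b, y u = y a + ∫ v in a..u, B *ᵥ Function.leftLim y v) :
    Function.leftLim y b = NormedSpace.exp ((b - a) • B) *ᵥ y a ∧
      y a + ∫ v in a..b, B *ᵥ Function.leftLim y v = NormedSpace.exp ((b - a) • B) *ᵥ y a := by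
  let h : ℝ → Fin q → ℝ := fun u => y a + ∫ v in a..u, B *ᵥ Function.leftLim y v
  have hBg : IntegrableOn (fun v => B *ᵥ Function.leftLim y v) (Ioc a b) :=
    (Matrix.mulVecLin B).toContinuousLinearMap.integrable_comp hg
  have hc : ContinuousOn h (Icc a b) := by
    have := intervalIntegral.continuousOn_primitive_interval (μ := volume) (a := a) (b := b)
      (f := fun v => B *ᵥ Function.leftLim y v)
      (by rwa [uIcc_of_le hab.le, integrableOn_Icc_iff_integrableOn_Ioc])
    rw [uIcc_of_le hab.le] at this
    exact continuousOn_const.add this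
  have hlh : ∀ u ∈ Ioc a b, Function.leftLim y u = h u := fun u hu => by
    refine leftLim_eq_of_tendsto ?_
    have h1 : Tendsto h (𝓝[<] u) (𝓝 (h u)) := by
      have h2 : Tendsto h (𝓝[Icc a b] u) (𝓝 (h u)) := hc u (Ioc_subset_Icc_self hu)
      refine h2.mono_left (nhdsWithin_le_of_mem ?_)
      filter_upwards [Ioo_mem_nhdsLT hu.1] with v hv
      exact ⟨hv.1.le, hv.2.le.trans hu.2⟩
    refine h1.congr' ?_
    filter_upwards [Ioo_mem_nhdsLT hu.1] with v hv
    exact (hy v ⟨hv.1.le, hv.2.trans_le hu.2⟩).symm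
  have hha : h a = y a := by simp [h]
  have key := eq_exp_mulVec_of_integral_eq B hab.le hc fun u hu => by
    rw [hha]
    simp only [h]
    congr 1
    refine intervalIntegral.integral_congr_ae (.of_forall fun v hv => ?_)
    rw [uIoc_of_le hu.1] at hv
    rw [hlh v ⟨hv.1, hv.2.trans hu.2⟩]
  rw [hha] at key
  exact ⟨(hlh b ⟨hab, le_rfl⟩).trans key, key⟩

end Flow

/-! ### The jump measure of the driving process -/

section JumpMeasure

variable {Ω : Type*} {N : ℝ → Ω → ℕ} {d : ℕ} {s : ℕ → ℝ} {Z : Fin d → ℕ → Ω → ℝ} {δ : ℝ}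

lemma tendsto_drivingProcess_of_eventually {ω : Ω} {u : ℝ} {n : ℕ}
    (h : ∀ᶠ v in 𝓝[<] u, N v ω = n) :
    Tendsto (fun v => drivingProcess d s N Z δ v ω) (𝓝[<] u)
      (𝓝 (δ * u + ∑ i ∈ Finset.Icc 1 n, jumpSize d s N Z i ω)) := by
  have h1 : Tendsto (fun v : ℝ => δ * v + ∑ i ∈ Finset.Icc 1 n, jumpSize d s N Z i ω) (𝓝[<] u)
      (𝓝 (δ * u + ∑ i ∈ Finset.Icc 1 n, jumpSize d s N Z i ω)) :=
    ((continuous_const.mul continuous_id).add continuous_const).continuousAt.continuousWithinAt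
  refine h1.congr' (h.mono fun v hv => ?_)
  simp only [drivingProcess, hv]

variable [MeasurableSpace Ω] {P : Measure Ω} {Λ : ℝ → ℝ}

lemma IsPoissonProcess.apply_eq_of_mem_Ico (hN : IsPoissonProcess N Λ P) {n : ℕ} {ω : Ω}
    {t v : ℝ} (ht : 0 ≤ t) (hn : n + 1 ≤ N t ω)
    (hv : v ∈ Ico (arrival N n ω) (arrival N (n + 1) ω)) : N v ω = n := by
  have hv0 : 0 ≤ v := (arrival_nonneg N n ω).trans hv.1
  have h1 := (hN.arrival_le_iff ht (by omega) hv0).1 hv.1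
  have h2 : ¬ n + 1 ≤ N v ω := fun h => not_lt.2 (arrival_le hv0 h) hv.2
  omega

lemma IsPoissonProcess.apply_eq_of_arrival_le (hN : IsPoissonProcess N Λ P) {ω : Ω}
    {t v : ℝ} (ht : 0 ≤ t) (hv : arrival N (N t ω) ω ≤ v) (hvt : v ≤ t) : N v ω = N t ω := by
  have hv0 : 0 ≤ v := (arrival_nonneg N _ ω).trans hv
  exact le_antisymm (hN.le ω hv0 hvt) ((hN.arrival_le_iff ht le_rfl hv0).1 hv)

/-- The jumps of the driving process are the `Z_n`, at the jump times of `N`. -/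
lemma IsPoissonProcess.jump_drivingProcess (hN : IsPoissonProcess N Λ P) {ω : Ω} {u : ℝ}
    (hu : 0 < u) :
    drivingProcess d s N Z δ u ω - Function.leftLim (fun v => drivingProcess d s N Z δ v ω) u
      = if arrival N (N u ω) ω = u then jumpSize d s N Z (N u ω) ω else 0 := by
  split_ifs with h
  · -- the path is constant on the interval between the last two jumps
    obtain ⟨n, hn⟩ : ∃ n, N u ω = n + 1 := by
      refine Nat.exists_eq_succ_of_ne_zero fun h0 => ?_
      rw [h0, hN.arrival_zero] at h
      exact hu.ne h
    rw [hn] at h ⊢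
    have hlt := hN.arrival_lt_arrival hu.le (Nat.lt_succ_self n) hn.ge
    simp only [Nat.succ_eq_add_one, h] at hlt
    have hev : ∀ᶠ v in 𝓝[<] u, N v ω = n := by
      filter_upwards [Ioo_mem_nhdsLT hlt] with v hv
      exact hN.apply_eq_of_mem_Ico hu.le hn.ge ⟨hv.1.le, h.symm ▸ hv.2⟩
    rw [leftLim_eq_of_tendsto (tendsto_drivingProcess_of_eventually hev), drivingProcess, hn,
      Finset.sum_Icc_succ_top (by omega)]
    ring
  · have hlt : arrival N (N u ω) ω < u := lt_of_le_of_ne (arrival_le hu.le le_rfl) h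
    have hev : ∀ᶠ v in 𝓝[<] u, N v ω = N u ω := by
      filter_upwards [Ioo_mem_nhdsLT hlt] with v hv
      exact hN.apply_eq_of_arrival_le hu.le hv.1.le hv.2.le
    rw [leftLim_eq_of_tendsto (tendsto_drivingProcess_of_eventually hev), drivingProcess, sub_self]

/-- On a bounded time interval, `d[S,S]` is a finite sum of point masses. -/
lemma IsPoissonProcess.quadVarMeasure_restrict (hN : IsPoissonProcess N Λ P) (ω : Ω) {t : ℝ}
    (ht : 0 ≤ t) :
    (quadVarMeasure fun v => drivingProcess d s N Z δ v ω).restrict (Ioc 0 t)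
      = ∑ n ∈ Finset.Icc 1 (N t ω), ENNReal.ofReal (jumpSize d s N Z n ω ^ 2) •
          Measure.dirac (arrival N n ω) := by
  classical
  ext A hA
  rw [Measure.restrict_apply hA, quadVarMeasure, Measure.sum_apply _ (hA.inter measurableSet_Ioc)]
  simp only [Measure.smul_apply, Measure.finsetSum_apply, smul_eq_mul]
  have hinj : Set.InjOn (fun n => arrival N n ω) (Finset.Icc 1 (N t ω) : Set ℕ) := by
    intro i hi j hj hij
    rw [Finset.mem_coe, Finset.mem_Icc] at hi hj
    by_contra hne
    rcases lt_or_gt_of_ne hne with h | h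
    · exact (hN.arrival_lt_arrival ht h hj.2).ne hij
    · exact (hN.arrival_lt_arrival ht h hi.2).ne' hij
  let φ : ℝ → ℝ≥0∞ := fun u => ENNReal.ofReal ((drivingProcess d s N Z δ u ω
      - Function.leftLim (fun v => drivingProcess d s N Z δ v ω) u) ^ 2) *
        Measure.dirac u (A ∩ Ioc 0 t)
  have h1 : ∑' u : Ioi (0 : ℝ), φ u = ∑' u : ℝ, (Ioi (0 : ℝ)).indicator φ u := tsum_subtype _ φ
  refine h1.trans ?_
  rw [tsum_eq_sum (s := (Finset.Icc 1 (N t ω)).image fun n => arrival N n ω), Finset.sum_image hinj]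
  · refine Finset.sum_congr rfl fun n hn => ?_
    rw [Finset.mem_Icc] at hn
    have hpos := hN.arrival_pos ht hn.1 hn.2
    have hle := (hN.arrival_le_iff ht hn.2 ht).2 hn.2
    rw [indicator_of_mem (show arrival N n ω ∈ Ioi (0 : ℝ) from hpos)]
    simp only [φ]
    rw [hN.jump_drivingProcess hpos, hN.apply_arrival ht hn.2, if_pos rfl,
      Measure.dirac_apply' _ (hA.inter measurableSet_Ioc), Measure.dirac_apply' _ hA]
    congr 1
    simp only [indicator_apply, mem_inter_iff, mem_Ioc, hpos, hle, and_self, and_true]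
  · intro u hu
    by_cases hu0 : 0 < u
    · rw [indicator_of_mem (show u ∈ Ioi (0 : ℝ) from hu0)]
      simp only [φ]
      rw [hN.jump_drivingProcess hu0]
      by_cases hut : u ≤ t
      · rw [if_neg fun h => hu (Finset.mem_image.2
          ⟨N u ω, Finset.mem_Icc.2 ⟨?_, hN.le ω hu0.le hut⟩, h⟩)]
        · simp
        · refine Nat.one_le_iff_ne_zero.2 fun h0 => ?_
          rw [h0, hN.arrival_zero] at h
          exact hu0.ne h
      · rw [Measure.dirac_apply' _ (hA.inter measurableSet_Ioc),
          indicator_of_notMem fun h => hut h.2.2, mul_zero]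
    · exact indicator_of_notMem hu0 _

lemma IsPoissonProcess.integral_quadVarMeasure (hN : IsPoissonProcess N Λ P) (ω : Ω) {t : ℝ}
    (ht : 0 ≤ t) {E : Type*} [NormedAddCommGroup E] [NormedSpace ℝ E] [CompleteSpace E]
    (f : ℝ → E) :
    ∫ u in Ioc 0 t, f u ∂(quadVarMeasure fun v => drivingProcess d s N Z δ v ω)
      = ∑ n ∈ Finset.Icc 1 (N t ω), jumpSize d s N Z n ω ^ 2 • f (arrival N n ω) := by
  rw [hN.quadVarMeasure_restrict ω ht, integral_finsetSum_measure fun n _ =>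
    (integrable_dirac (by simp)).smul_measure ENNReal.ofReal_ne_top]
  refine Finset.sum_congr rfl fun n _ => ?_
  rw [integral_smul_measure, integral_dirac, ENNReal.toReal_ofReal (sq_nonneg _)]

end JumpMeasure

/-! ### The recurrence between two times -/

section Recurrence

variable {Ω : Type*} [MeasurableSpace Ω] {P : Measure Ω} {N : ℝ → Ω → ℕ} {Λ : ℝ → ℝ} {d : ℕ}
  {s : ℕ → ℝ} {Z : Fin d → ℕ → Ω → ℝ} {δ : ℝ} {q : ℕ} {α β : ℕ → ℝ}

/-- Solution of an affine recurrence, in the notation of `pathK`. -/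
lemma eq_descProd_mulVec_add {C : ℕ → Matrix (Fin q) (Fin q) ℝ} {D x : ℕ → Fin q → ℝ} {k n : ℕ}
    (hkn : k ≤ n) (hx : ∀ i, k ≤ i → i < n → x (i + 1) = C (i + 1) *ᵥ x i + D (i + 1)) :
    x n = descProd C k (n - k) *ᵥ x k
      + ∑ i ∈ Finset.range (n - k), descProd C (n - i) i *ᵥ D (n - i) := by
  induction n, hkn using Nat.le_induction with
  | base => simp [descProd]
  | succ n hkn ih =>
    have h1 := ih fun i h1 h2 => hx i h1 (h2.trans (Nat.lt_succ_self n))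
    rw [hx n hkn (Nat.lt_succ_self n), Nat.succ_sub hkn, Finset.sum_range_succ', h1]
    simp only [descProd, Matrix.mulVec_add, Matrix.mulVec_mulVec,
      Matrix.one_mulVec, Nat.sub_zero, Nat.add_sub_add_right]
    rw [show k + (n - k) + 1 = n + 1 by omega, Matrix.mulVec_sum, add_assoc]
    congr 2
    refine Finset.sum_congr rfl fun i hi => ?_
    have hi' := Finset.mem_range.1 hi
    rw [Matrix.mulVec_mulVec, show n - i + i + 1 = n + 1 by omega]

lemma exp_neg_mul_exp (B : Matrix (Fin q) (Fin q) ℝ) (a b : ℝ) :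
    NormedSpace.exp ((a - b) • B) * NormedSpace.exp ((b - a) • B) = 1 := by
  rw [← exp_add_smul]
  simp

/-- A càdlàg path that solves the state equation satisfies the recurrence
`y t = J_{u,t} y u + K_{u,t}`. -/
theorem IsPoissonProcess.state_recurrence (hN : IsPoissonProcess N Λ P) {ω : Ω}
    {y : ℝ → Fin q → ℝ} (hr : ∀ t, 0 ≤ t → ContinuousWithinAt y (Ici t) t)
    (hl : ∀ t, 0 < t → ∃ l, Tendsto y (𝓝[<] t) (𝓝 l))
    (hsde : ∀ t, 0 ≤ t → y t = y 0
      + (∫ u in (0 : ℝ)..t, companion q β *ᵥ Function.leftLim y u)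
      + ∫ u in Ioc 0 t, (α 0 + aVec q α ⬝ᵥ Function.leftLim y u) • eVec q
          ∂(quadVarMeasure fun v => drivingProcess d s N Z δ v ω))
    {u t : ℝ} (hu : 0 ≤ u) (hut : u ≤ t) :
    y t = coeffJ q α β d s N Z u t ω *ᵥ y u + coeffK q α β d s N Z u t ω := by
  set B := companion q β with hB
  set T : ℕ → ℝ := fun n => arrival N n ω with hTdef
  set z : ℕ → ℝ := fun n => jumpSize d s N Z n ω with hzdef
  have ht : 0 ≤ t := hu.trans hut
  have hgi : ∀ a b, 0 ≤ a → IntegrableOn (Function.leftLim y) (Ioc a b) := fun a b ha =>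
    (integrableOn_leftLim_of_cadlag hr hl b).mono_set (Ioc_subset_Ioc_left ha)
  have hBi : ∀ a b, 0 ≤ a → a ≤ b →
      IntervalIntegrable (fun v => B *ᵥ Function.leftLim y v) volume a b := fun a b ha hab =>
    (intervalIntegrable_iff_integrableOn_Ioc_of_le hab).2
      ((Matrix.mulVecLin B).toContinuousLinearMap.integrable_comp (hgi a b ha))
  let X : ℕ → Fin q → ℝ := fun n =>
    z n ^ 2 • ((α 0 + aVec q α ⬝ᵥ Function.leftLim y (T n)) • eVec q)
  -- the equation in terms of the jumps
  have heq : ∀ t, 0 ≤ t → y t = y 0 + (∫ v in (0 : ℝ)..t, B *ᵥ Function.leftLim y v)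
      + ∑ n ∈ Finset.Icc 1 (N t ω), X n := fun t ht => by
    rw [hsde t ht, hN.integral_quadVarMeasure ω ht]
  have hinc : ∀ a b, 0 ≤ a → a ≤ b → N a ω = N b ω →
      y b = y a + ∫ v in a..b, B *ᵥ Function.leftLim y v := fun a b ha hab hNab => by
    rw [heq b (ha.trans hab), heq a ha, hNab, ← intervalIntegral.integral_add_adjacent_intervals
      (hBi 0 a le_rfl ha) (hBi a b ha hab)]
    abel
  have hT0 : ∀ n, 0 ≤ T n := fun n => arrival_nonneg N n ω
  -- the flow since the last jump
  have hflow : ∀ t, 0 ≤ t → y t = NormedSpace.exp ((t - T (N t ω)) • B) *ᵥ y (T (N t ω)) :=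
    fun t ht => by
      have hle : T (N t ω) ≤ t := arrival_le ht le_rfl
      have hNT : N (T (N t ω)) ω = N t ω := hN.apply_arrival ht le_rfl
      rcases hle.eq_or_lt with h | h
      · rw [h]; simp
      · rw [hinc _ t (hT0 _) hle hNT]
        refine (flow_of_integral_leftLim_eq B h (hgi _ _ (hT0 _)) fun v hv => ?_).2
        exact hinc _ v (hT0 _) hv.1
          (hNT.trans (hN.apply_eq_of_arrival_le ht hv.1 hv.2.le).symm)
  -- the effect of a jump
  have hjump : ∀ i, i < N t ω → y (T (i + 1))
      = stepMatrix q α β T z (i + 1) *ᵥ y (T i) + (α 0 * z (i + 1) ^ 2) • eVec q := fun i hi => by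
    have hlt : T i < T (i + 1) := hN.arrival_lt_arrival ht (Nat.lt_succ_self i) hi
    have hNi : N (T i) ω = i := hN.apply_arrival ht hi.le
    have hNi1 : N (T (i + 1)) ω = i + 1 := hN.apply_arrival ht hi
    obtain ⟨h1, h2⟩ := flow_of_integral_leftLim_eq B hlt (hgi _ _ (hT0 _)) fun v hv =>
      hinc _ v (hT0 _) hv.1 (hNi.trans (hN.apply_eq_of_mem_Ico ht hi hv).symm)
    have h3 : y (T (i + 1)) = y (T i) + (∫ v in T i..T (i + 1), B *ᵥ Function.leftLim y v)
        + X (i + 1) := by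
      rw [heq _ (hT0 (i + 1)), heq _ (hT0 i), hNi, hNi1, Finset.sum_Icc_succ_top (by omega),
        ← intervalIntegral.integral_add_adjacent_intervals
          (hBi 0 (T i) le_rfl (hT0 i)) (hBi (T i) (T (i + 1)) (hT0 i) hlt.le)]
      abel
    rw [h3, h2]
    simp only [X]
    rw [h1, stepMatrix, ← Matrix.mulVec_mulVec, Nat.add_sub_cancel, Matrix.add_mulVec,
      Matrix.one_mulVec, Matrix.smul_mulVec, Matrix.vecMulVec_mulVec]
    ext j
    simp only [Pi.add_apply, Pi.smul_apply, smul_eq_mul, MulOpposite.smul_eq_mul_unop,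
      MulOpposite.unop_op]
    ring
  have hkn : N u ω ≤ N t ω := hN.le ω hu hut
  have hsol := eq_descProd_mulVec_add (x := fun n => y (T n)) (C := stepMatrix q α β T z)
    (D := fun n => (α 0 * z n ^ 2) • eVec q) hkn fun i _ hi => hjump i hi
  have hTk : y (T (N u ω)) = NormedSpace.exp ((T (N u ω) - u) • B) *ᵥ y u := by
    rw [hflow u hu, Matrix.mulVec_mulVec, exp_neg_mul_exp, Matrix.one_mulVec]
  rw [hflow t ht, hsol, hTk, coeffJ, coeffK, pathJ, pathK, Matrix.mulVec_add,
    Matrix.mulVec_mulVec, Matrix.mulVec_mulVec]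

end Recurrence

/-! ### A norm adapted to the flow and to the jumps -/

section AdaptedNorm

variable {q : ℕ} {α β : ℕ → ℝ} {η κ : ℝ} {nrm : (Fin q → ℝ) → ℝ}

/-- `nrm` is a seminorm on `ℝ^q` for which the flow `exp(s B)`, `s ≥ 0`, has norm at most
`exp(η s)`, and the matrix `e a'` has norm at most `κ`. -/
structure IsAdaptedNorm (q : ℕ) (α β : ℕ → ℝ) (η κ : ℝ) (nrm : (Fin q → ℝ) → ℝ) : Prop where
  nonneg : ∀ v, 0 ≤ nrm v
  add_le : ∀ v w, nrm (v + w) ≤ nrm v + nrm w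
  smul : ∀ (c : ℝ) v, nrm (c • v) = |c| * nrm v
  exp_le : ∀ s : ℝ, 0 ≤ s → ∀ v,
    nrm (NormedSpace.exp (s • companion q β) *ᵥ v) ≤ Real.exp (η * s) * nrm v
  rankOne_le : ∀ v, nrm (Matrix.vecMulVec (eVec q) (aVec q α) *ᵥ v) ≤ κ * nrm v
  kappa_nonneg : 0 ≤ κ

/-- The sum of `g` over the jump sizes of a block. -/
def blockSum (g : ℝ → ℝ) (R : MarkedBlock) : ℝ := ∑ i ∈ Finset.Icc 1 R.1, g (R.2.2 i)

lemma measurable_blockSum {g : ℝ → ℝ} (hg : Measurable g) : Measurable (blockSum g) := by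
  refine measurable_from_prod_countable_right fun n => ?_
  exact Finset.measurable_sum (Finset.Icc 1 n) fun i _ =>
    hg.comp (((measurable_pi_apply i).comp measurable_snd :
      Measurable fun p : (ℕ → ℝ) × (ℕ → ℝ) => p.2 i))

/-- The times of a block are nondecreasing, from `0` to at most `τ`. -/
structure IsTimeSeq (τ : ℝ) (T : ℕ → ℝ) : Prop where
  zero : T 0 = 0
  mono : Monotone T
  le : ∀ i, T i ≤ τ

lemma isTimeSeq_localArrival {τ : ℝ} (hτ : 0 ≤ τ) (c : Icc (0 : ℚ) 1 → ℕ) :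
    IsTimeSeq τ (localArrival τ c) := by
  refine ⟨localArrival_zero τ hτ c, fun i j hij => ?_, fun i => (localArrival_mem τ hτ c i).2⟩
  have hu : ∀ u : Icc (0 : ℚ) 1, 0 ≤ τ * ((u : ℚ) : ℝ) ∧ τ * ((u : ℚ) : ℝ) ≤ τ := fun u =>
    ⟨mul_nonneg hτ (by exact_mod_cast u.2.1),
      mul_le_of_le_one_right hτ (by exact_mod_cast u.2.2)⟩
  refine ciInf_mono ⟨0, ?_⟩ fun u => ?_
  · rintro _ ⟨u, rfl⟩
    dsimp only
    split_ifs
    exacts [(hu u).1, hτ]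
  · split_ifs with h1 h2
    · exact le_rfl
    · exact (hu u).2
    · omega
    · exact le_rfl

namespace IsAdaptedNorm

lemma zero (h : IsAdaptedNorm q α β η κ nrm) : nrm 0 = 0 := by
  simpa using h.smul 0 0

lemma jump_le (h : IsAdaptedNorm q α β η κ nrm) (z : ℝ) (v : Fin q → ℝ) :
    nrm ((1 + z ^ 2 • Matrix.vecMulVec (eVec q) (aVec q α)) *ᵥ v) ≤ (1 + κ * z ^ 2) * nrm v := by
  rw [Matrix.add_mulVec, Matrix.one_mulVec, Matrix.smul_mulVec]
  refine (h.add_le _ _).trans ?_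
  rw [h.smul, abs_of_nonneg (sq_nonneg z)]
  nlinarith [mul_le_mul_of_nonneg_left (h.rankOne_le v) (sq_nonneg z)]

lemma stepMatrix_le (h : IsAdaptedNorm q α β η κ nrm) {T z : ℕ → ℝ} (hT : Monotone T) (i : ℕ)
    (v : Fin q → ℝ) : nrm (stepMatrix q α β T z i *ᵥ v)
      ≤ Real.exp (Real.log (1 + κ * z i ^ 2) + η * (T i - T (i - 1))) * nrm v := by
  have hpos : 0 < 1 + κ * z i ^ 2 := by
    have := mul_nonneg h.kappa_nonneg (sq_nonneg (z i)); linarith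
  rw [stepMatrix, ← Matrix.mulVec_mulVec, Real.exp_add, Real.exp_log hpos, mul_assoc]
  exact (h.jump_le _ _).trans (mul_le_mul_of_nonneg_left
    (h.exp_le _ (sub_nonneg.2 (hT (Nat.sub_le i 1))) v) hpos.le)

lemma descProd_le (h : IsAdaptedNorm q α β η κ nrm) {T z : ℕ → ℝ} (hT : Monotone T) (n : ℕ)
    (v : Fin q → ℝ) : nrm (descProd (stepMatrix q α β T z) 0 n *ᵥ v)
      ≤ Real.exp ((∑ i ∈ Finset.Icc 1 n, Real.log (1 + κ * z i ^ 2)) + η * (T n - T 0))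
        * nrm v := by
  induction n with
  | zero => simp [descProd]
  | succ n ih =>
    rw [descProd, ← Matrix.mulVec_mulVec, zero_add]
    refine (h.stepMatrix_le hT _ _).trans ((mul_le_mul_of_nonneg_left ih
      (Real.exp_pos _).le).trans_eq ?_)
    rw [← mul_assoc, ← Real.exp_add, Finset.sum_Icc_succ_top (by omega), Nat.add_sub_cancel]
    congr 2
    ring

/-- Over a period, `J` expands by at most `exp(η τ) ∏ (1 + κ z_i²)`. -/
theorem blockJ_le (h : IsAdaptedNorm q α β η κ nrm) {τ : ℝ} {R : MarkedBlock}
    (hT : IsTimeSeq τ R.2.1) (v : Fin q → ℝ) : nrm (blockJ q α β τ R *ᵥ v)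
      ≤ Real.exp (η * τ + blockSum (fun z => Real.log (1 + κ * z ^ 2)) R) * nrm v := by
  rw [blockJ, pathJ, hT.zero, sub_zero, zero_smul, NormedSpace.exp_zero, mul_one, Nat.sub_zero,
    ← Matrix.mulVec_mulVec]
  refine (h.exp_le _ (sub_nonneg.2 (hT.le _)) _).trans ((mul_le_mul_of_nonneg_left
    (h.descProd_le hT.mono _ _) (Real.exp_pos _).le).trans_eq ?_)
  rw [← mul_assoc, ← Real.exp_add, hT.zero, blockSum]
  congr 2
  ring

/-- Over a period, `K` is at most `∏ (1 + κ z_i²) (1 + α_0 ‖e‖ z_i²)`, if the flow contracts. -/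
theorem blockK_le (h : IsAdaptedNorm q α β η κ nrm) (hη : η ≤ 0) (hα : 0 ≤ α 0) {τ : ℝ}
    {R : MarkedBlock} (hT : IsTimeSeq τ R.2.1) : nrm (blockK q α β τ R)
      ≤ Real.exp (blockSum (fun z => Real.log (1 + κ * z ^ 2)
        + Real.log (1 + α 0 * nrm (eVec q) * z ^ 2)) R) := by
  set c := α 0 * nrm (eVec q) with hc
  have hc0 : 0 ≤ c := mul_nonneg hα (h.nonneg _)
  set z := R.2.2 with hz
  have hexp : ∀ {s : ℝ}, 0 ≤ s → Real.exp (η * s) ≤ 1 := fun hs =>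
    Real.exp_le_one_iff.2 (mul_nonpos_of_nonpos_of_nonneg hη hs)
  -- the recursion that is solved by the sum in `K`
  let D : ℕ → Fin q → ℝ := fun i => (α 0 * z i ^ 2) • eVec q
  let x : ℕ → Fin q → ℝ := fun n =>
    Nat.rec 0 (fun i y => stepMatrix q α β R.2.1 z (i + 1) *ᵥ y + D (i + 1)) n
  have hx : ∀ n, nrm (x n) ≤ Real.exp (∑ i ∈ Finset.Icc 1 n,
      (Real.log (1 + κ * z i ^ 2) + Real.log (1 + c * z i ^ 2))) := fun n => by
    induction n with
    | zero => simp [x, h.zero]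
    | succ n ih =>
      have hκz := mul_nonneg h.kappa_nonneg (sq_nonneg (z (n + 1)))
      have hcz := mul_nonneg hc0 (sq_nonneg (z (n + 1)))
      rw [Finset.sum_Icc_succ_top (by omega), Real.exp_add, Real.exp_add,
        Real.exp_log (by linarith), Real.exp_log (by linarith)]
      have hQ : 1 ≤ Real.exp (∑ i ∈ Finset.Icc 1 n,
          (Real.log (1 + κ * z i ^ 2) + Real.log (1 + c * z i ^ 2))) := by
        refine Real.one_le_exp (Finset.sum_nonneg fun i _ => add_nonneg ?_ ?_) <;>
          refine Real.log_nonneg (le_add_of_nonneg_right ?_)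
        exacts [mul_nonneg h.kappa_nonneg (sq_nonneg _), mul_nonneg hc0 (sq_nonneg _)]
      set Q := Real.exp (∑ i ∈ Finset.Icc 1 n,
          (Real.log (1 + κ * z i ^ 2) + Real.log (1 + c * z i ^ 2)))
      have h1 : nrm (stepMatrix q α β R.2.1 z (n + 1) *ᵥ x n)
          ≤ (1 + κ * z (n + 1) ^ 2) * Q := by
        rw [stepMatrix, ← Matrix.mulVec_mulVec]
        refine (h.jump_le _ _).trans (mul_le_mul_of_nonneg_left ?_ (by linarith))
        have hs := sub_nonneg.2 (hT.mono (Nat.sub_le (n + 1) 1))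
        exact (h.exp_le _ hs _).trans
          ((mul_le_of_le_one_left (h.nonneg _) (hexp hs)).trans ih)
      have h2 : nrm (D (n + 1)) = c * z (n + 1) ^ 2 := by
        rw [h.smul, abs_of_nonneg (mul_nonneg hα (sq_nonneg _)), hc]
        ring
      refine (h.add_le _ _).trans ((add_le_add h1 h2.le).trans ?_)
      have h3 : 0 ≤ c * z (n + 1) ^ 2 * (Q - 1) := mul_nonneg hcz (by linarith)
      have h4 : 0 ≤ Q * (κ * z (n + 1) ^ 2) * (c * z (n + 1) ^ 2) := by positivity
      nlinarith
  have hsum := eq_descProd_mulVec_add (C := stepMatrix q α β R.2.1 z) (D := D) (x := x)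
    (k := 0) (n := R.1) (Nat.zero_le _) fun i _ _ => rfl
  rw [show x 0 = 0 from rfl, Matrix.mulVec_zero, zero_add] at hsum
  have hs := sub_nonneg.2 (hT.le R.1)
  rw [blockK, pathK, ← hz, ← hsum]
  exact (h.exp_le _ hs _).trans ((mul_le_of_le_one_left (h.nonneg _) (hexp hs)).trans (hx _))

end IsAdaptedNorm

end AdaptedNorm

/-! ### The norm of the diagonalising coordinates -/

section DiagonalNorm

variable {q : ℕ}

lemma matrixLpNorm_nonneg (r : ℝ≥0∞) [Fact (1 ≤ r)] (C : Matrix (Fin q) (Fin q) ℂ) :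
    0 ≤ matrixLpNorm r C :=
  Real.iSup_nonneg fun _ => div_nonneg (norm_nonneg _) (norm_nonneg _)

lemma norm_toLp_mulVec_le {r : ℝ≥0∞} [Fact (1 ≤ r)] (C : Matrix (Fin q) (Fin q) ℂ)
    (c : Fin q → ℂ) :
    ‖WithLp.toLp r (C *ᵥ c)‖ ≤ matrixLpNorm r C * ‖WithLp.toLp r c‖ := by
  by_cases hc : c = 0
  · simp [hc]
  have hpos : 0 < ‖WithLp.toLp r c‖ := norm_pos_iff.2 (by simpa using hc)
  rw [← div_le_iff₀ hpos]
  let A : PiLp r (fun _ : Fin q => ℂ) →ₗ[ℂ] PiLp r (fun _ : Fin q => ℂ) :=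
    (WithLp.linearEquiv r ℂ (Fin q → ℂ)).symm.toLinearMap ∘ₗ C.mulVecLin ∘ₗ
      (WithLp.linearEquiv r ℂ (Fin q → ℂ)).toLinearMap
  refine le_ciSup (f := fun c : {c : Fin q → ℂ // c ≠ 0} =>
    ‖WithLp.toLp r (C *ᵥ c.1)‖ / ‖WithLp.toLp r c.1‖) ?_ ⟨c, hc⟩
  refine ⟨‖LinearMap.toContinuousLinearMap A‖, ?_⟩
  rintro _ ⟨⟨c', hc'⟩, rfl⟩
  exact div_le_of_le_mul₀ (norm_nonneg _) (norm_nonneg _)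
    ((LinearMap.toContinuousLinearMap A).le_opNorm (WithLp.toLp r c'))

lemma norm_toLp_diagonal_le {r : ℝ≥0∞} [hr : Fact (1 ≤ r)] {D c : Fin q → ℂ} {a : ℝ} (ha : 0 ≤ a)
    (hD : ∀ i, ‖D i‖ ≤ a) : ‖WithLp.toLp r (Matrix.diagonal D *ᵥ c)‖ ≤ a * ‖WithLp.toLp r c‖ := by
  have h0 : ∀ i, ‖(Matrix.diagonal D *ᵥ c) i‖ ≤ a * ‖c i‖ := fun i => by
    rw [Matrix.mulVec_diagonal, norm_mul]
    exact mul_le_mul_of_nonneg_right (hD i) (norm_nonneg _)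
  rcases eq_or_ne r ∞ with rfl | hr'
  · rw [PiLp.norm_toLp, PiLp.norm_toLp]
    refine (pi_norm_le_iff_of_nonneg (mul_nonneg ha (norm_nonneg _))).2 fun i => (h0 i).trans ?_
    exact mul_le_mul_of_nonneg_left (norm_le_pi_norm c i) ha
  · have hp : 0 < r.toReal := ENNReal.toReal_pos (zero_lt_one.trans_le hr.out).ne' hr'
    rw [PiLp.norm_eq_sum hp, PiLp.norm_eq_sum hp]
    have : a = (a ^ r.toReal) ^ (1 / r.toReal) := by
      rw [← Real.rpow_mul ha, mul_one_div_cancel hp.ne', Real.rpow_one]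
    rw [this, ← Real.mul_rpow (Real.rpow_nonneg ha _)
      (Finset.sum_nonneg fun i _ => Real.rpow_nonneg (norm_nonneg _) _), Finset.mul_sum]
    refine Real.rpow_le_rpow (Finset.sum_nonneg fun i _ => Real.rpow_nonneg (norm_nonneg _) _)
      (Finset.sum_le_sum fun i _ => ?_) (by positivity)
    rw [← Real.mul_rpow ha (norm_nonneg _)]
    exact Real.rpow_le_rpow (norm_nonneg _) (h0 i) hp.le

open Matrix.Norms.Operator in
lemma toComplex_exp (A : Matrix (Fin q) (Fin q) ℝ) :
    toComplex (NormedSpace.exp A) = NormedSpace.exp (toComplex A) :=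
  NormedSpace.map_exp (Complex.ofRealHom.mapMatrix (m := Fin q))
    (continuous_id.matrix_map Complex.continuous_ofReal) A

lemma toComplex_mulVec (A : Matrix (Fin q) (Fin q) ℝ) (v : Fin q → ℝ) :
    (fun i => ((A *ᵥ v) i : ℂ)) = toComplex A *ᵥ fun i => (v i : ℂ) :=
  funext fun i => by simp [Matrix.mulVec, dotProduct, toComplex]

variable {M : Matrix (Fin q) (Fin q) ℂ} {B : Matrix (Fin q) (Fin q) ℝ}

lemma diag_mem_eigenvalues (hM : IsUnit M) (hB : (M⁻¹ * toComplex B * M).IsDiag) (i : Fin q) :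
    (M⁻¹ * toComplex B * M) i i ∈ eigenvalues B := by
  obtain ⟨u, rfl⟩ := hM
  have h : (toComplex B).charpoly
      = ((u : Matrix (Fin q) (Fin q) ℂ)⁻¹ * toComplex B * u).charpoly := by
    rw [Matrix.charpoly_units_conj']
  rw [eigenvalues, h, Polynomial.mem_roots (Matrix.charpoly_monic _).ne_zero, Polynomial.IsRoot.def,
    ← hB.diagonal_diag, Matrix.charpoly_diagonal, Polynomial.eval_prod]
  refine Finset.prod_eq_zero (Finset.mem_univ i) ?_
  simp

lemma finite_re_eigenvalues (B : Matrix (Fin q) (Fin q) ℝ) :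
    (Complex.re '' {z | z ∈ eigenvalues B}).Finite := by
  refine Set.Finite.image _ ?_
  exact (Multiset.finite_toSet _)

lemma re_le_maxRe {z : ℂ} (hz : z ∈ eigenvalues B) : z.re ≤ maxRe B :=
  le_csSup (finite_re_eigenvalues B).bddAbove ⟨z, hz, rfl⟩

lemma maxRe_neg (hq : 0 < q) (hneg : ∀ z ∈ eigenvalues B, z.re < 0) : maxRe B < 0 := by
  have hne : (Complex.re '' {z | z ∈ eigenvalues B}).Nonempty := by
    have : 0 < (eigenvalues B).card := by
      rw [eigenvalues, IsAlgClosed.card_roots_eq_natDegree, Matrix.charpoly_natDegree_eq_dim,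
        Fintype.card_fin]
      exact hq
    obtain ⟨z, hz⟩ := Multiset.card_pos_iff_exists_mem.1 this
    exact ⟨z.re, z, hz, rfl⟩
  obtain ⟨z, hz, h⟩ := hne.csSup_mem (finite_re_eigenvalues B)
  rw [maxRe, ← h]
  exact hneg z hz

/-- The `L^r`-norm of the coordinates `M⁻¹ v` of a real vector `v`. -/
def diagNorm (r : ℝ≥0∞) (M : Matrix (Fin q) (Fin q) ℂ) (v : Fin q → ℝ) : ℝ :=
  ‖WithLp.toLp r (M⁻¹ *ᵥ fun i => (v i : ℂ))‖

lemma exists_norm_le_diagNorm {r : ℝ≥0∞} [Fact (1 ≤ r)] (hM : IsUnit M) :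
    ∃ K, 0 ≤ K ∧ ∀ v, ‖v‖ ≤ K * diagNorm r M v := by
  let A : PiLp r (fun _ : Fin q => ℂ) →ₗ[ℂ] (Fin q → ℂ) :=
    M.mulVecLin ∘ₗ (WithLp.linearEquiv r ℂ (Fin q → ℂ)).toLinearMap
  refine ⟨‖LinearMap.toContinuousLinearMap A‖, norm_nonneg _, fun v => ?_⟩
  have h := (LinearMap.toContinuousLinearMap A).le_opNorm
    (WithLp.toLp r (M⁻¹ *ᵥ fun i => (v i : ℂ)))
  have h2 : LinearMap.toContinuousLinearMap A (WithLp.toLp r (M⁻¹ *ᵥ fun i => (v i : ℂ)))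
      = fun i => (v i : ℂ) := by
    change M *ᵥ (M⁻¹ *ᵥ fun i => (v i : ℂ)) = _
    rw [Matrix.mulVec_mulVec, Matrix.mul_nonsing_inv _ ((Matrix.isUnit_iff_isUnit_det _).1 hM),
      Matrix.one_mulVec]
  rw [h2] at h
  refine le_trans ?_ h
  refine (pi_norm_le_iff_of_nonneg (norm_nonneg _)).2 fun i => ?_
  rw [← Complex.norm_real]
  exact norm_le_pi_norm (fun i => (v i : ℂ)) i

lemma inv_mulVec_toComplex (hM : IsUnit M) (A : Matrix (Fin q) (Fin q) ℝ) (v : Fin q → ℝ) :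
    M⁻¹ *ᵥ (fun i => ((A *ᵥ v) i : ℂ))
      = (M⁻¹ * toComplex A * M) *ᵥ (M⁻¹ *ᵥ fun i => (v i : ℂ)) := by
  rw [Matrix.mulVec_mulVec, mul_assoc _ M, Matrix.mul_nonsing_inv _
    ((Matrix.isUnit_iff_isUnit_det _).1 hM), mul_one, ← Matrix.mulVec_mulVec, toComplex_mulVec]

lemma diagNorm_exp_le {r : ℝ≥0∞} [Fact (1 ≤ r)] (hM : IsUnit M)
    (hB : (M⁻¹ * toComplex B * M).IsDiag) {s : ℝ} (hs : 0 ≤ s) (v : Fin q → ℝ) :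
    diagNorm r M (NormedSpace.exp (s • B) *ᵥ v) ≤ Real.exp (maxRe B * s) * diagNorm r M v := by
  have h1 : M⁻¹ * toComplex (NormedSpace.exp (s • B)) * M
      = Matrix.diagonal (NormedSpace.exp ((s : ℂ) • (M⁻¹ * toComplex B * M).diag)) := by
    have h2 : toComplex (s • B) = (s : ℂ) • toComplex B := by
      ext i j; simp [toComplex]
    rw [toComplex_exp, ← Matrix.exp_conj' _ _ hM, h2, mul_smul_comm, smul_mul_assoc,
      ← Matrix.exp_diagonal, Matrix.diagonal_smul, hB.diagonal_diag]
  rw [diagNorm, inv_mulVec_toComplex hM, h1]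
  refine norm_toLp_diagonal_le (Real.exp_pos _).le fun i => ?_
  rw [Pi.coe_exp, ← Complex.exp_eq_exp_ℂ, Complex.norm_exp]
  refine Real.exp_le_exp.2 ?_
  simp only [Pi.smul_apply, smul_eq_mul, Complex.re_ofReal_mul, Matrix.diag_apply]
  rw [mul_comm]
  exact mul_le_mul_of_nonneg_right (re_le_maxRe (diag_mem_eigenvalues hM hB i)) hs

/-- In diagonalising coordinates the flow is diagonal with entries `exp(λ_i s)`, of modulus at most
`exp(η s)`. -/
lemma isAdaptedNorm_diagNorm {r : ℝ≥0∞} [Fact (1 ≤ r)] {α β : ℕ → ℝ} (hM : IsUnit M)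
    (hB : (M⁻¹ * toComplex (companion q β) * M).IsDiag) :
    IsAdaptedNorm q α β (maxRe (companion q β))
      (matrixLpNorm r (M⁻¹ * toComplex (Matrix.vecMulVec (eVec q) (aVec q α)) * M))
      (diagNorm r M) where
  nonneg v := norm_nonneg _
  add_le v w := by
    have h : (fun i => ((v + w) i : ℂ)) = (fun i => (v i : ℂ)) + fun i => (w i : ℂ) :=
      funext fun i => by simp
    rw [diagNorm, h, Matrix.mulVec_add, WithLp.toLp_add]
    exact norm_add_le _ _
  smul c v := by
    have h : (fun i => ((c • v) i : ℂ)) = (c : ℂ) • fun i => (v i : ℂ) :=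
      funext fun i => by simp
    rw [diagNorm, h, Matrix.mulVec_smul, WithLp.toLp_smul, norm_smul, Complex.norm_real,
      Real.norm_eq_abs, diagNorm]
  exp_le s hs v := diagNorm_exp_le hM hB hs v
  rankOne_le v := by
    rw [diagNorm, inv_mulVec_toComplex hM]
    exact norm_toLp_mulVec_le _ _
  kappa_nonneg := matrixLpNorm_nonneg r _

end DiagonalNorm

/-! ### The expectation of a sum over the jumps of a period -/

section BlockExpectation

lemma lintegral_cast_poissonMeasure (r : ℝ≥0) :
    ∫⁻ n : ℕ, (n : ℝ≥0∞) ∂poissonMeasure r = r := by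
  have h : HasSum (fun n : ℕ => (n : ℝ) * (Real.exp (-r) * r ^ n / n.factorial)) r := by
    rw [← hasSum_nat_add_iff' 1]
    have h1 := (hasSum_one_poissonMeasure r).mul_left (r : ℝ)
    simp only [Finset.sum_range_one, Nat.cast_zero, zero_mul, sub_zero]
    rw [mul_one] at h1
    refine h1.congr_fun ?_
    intro n
    rw [Nat.factorial_succ]
    push_cast
    field_simp
    ring
  have h0 : ∀ n : ℕ, 0 ≤ (n : ℝ) * (Real.exp (-r) * r ^ n / n.factorial) := fun n => by positivity
  rw [lintegral_countable', ← ENNReal.ofReal_coe_nnreal (p := r), ← h.tsum_eq,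
    ENNReal.ofReal_tsum_of_nonneg h0 h.summable]
  refine tsum_congr fun n => ?_
  rw [poissonMeasure_singleton, ENNReal.ofReal_mul (Nat.cast_nonneg n), ENNReal.ofReal_natCast]

variable {d : ℕ} {s : ℕ → ℝ} {F : Fin d → Measure ℝ} {t τ C : ℝ} {g : ℝ → ℝ}

/-- The mark of a single jump has law `F j` for the season `j` in which the jump falls. -/
lemma lintegral_mark_le (hs : IsPeriodicPartition d s) (hF : ∀ j, IsProbabilityMeasure (F j))
    (hg : Measurable g) (hg0 : g 0 = 0) (hC : ∀ j, ∫⁻ z, ENNReal.ofReal (g z) ∂F j ≤ .ofReal C)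
    (l : ℕ) (x : ℝ) :
    ∫⁻ w, ENNReal.ofReal (g (∑ j, (season d s j).indicator (fun _ => w (j, l)) x))
      ∂Measure.infinitePi (fun i : Fin d × ℕ => F i.1) ≤ .ofReal C := by
  by_cases hx : ∃ j, x ∈ season d s j
  · obtain ⟨j, hj⟩ := hx
    have hx0 : 0 < x := by
      obtain ⟨k, hk, -⟩ := (hs.mem_season_iff j x).1 hj
      have := hs.nonneg j
      have := hs.period_pos
      have : (0 : ℝ) ≤ k * period d s := by positivity
      linarith
    have h : ∀ w : Fin d × ℕ → ℝ,
        ∑ j, (season d s j).indicator (fun _ => w (j, l)) x = w (j, l) := fun w => by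
      rw [Finset.sum_eq_single j (fun i _ hi => indicator_of_notMem
        (fun h' => hi ((hs.existsUnique_season hx0).unique h' hj)) _) (by simp),
        indicator_of_mem hj]
    simp only [h]
    have hmap := Measure.infinitePi_map_eval (fun i : Fin d × ℕ => F i.1) (j, l)
    have hl := lintegral_map (μ := Measure.infinitePi fun i : Fin d × ℕ => F i.1)
      hg.ennreal_ofReal (measurable_pi_apply (j, l))
    rw [hmap] at hl
    exact hl.symm.trans_le (hC j)
  · have h : ∀ w : Fin d × ℕ → ℝ,
        ∑ j, (season d s j).indicator (fun _ => w (j, l)) x = 0 := fun w =>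
      Finset.sum_eq_zero fun j _ => indicator_of_notMem (fun h' => hx ⟨j, h'⟩) _
    simp [h, hg0]

/-- A form of Wald's identity: the sum of `g` over the jumps of a block has expectation at most
`C` times the expected number of jumps. -/
lemma lintegral_blockSum_le (hs : IsPeriodicPartition d s) (hF : ∀ j, IsProbabilityMeasure (F j))
    (hg : Measurable g) (hg0 : g 0 = 0) (hgn : ∀ z, 0 ≤ g z)
    (hC : ∀ j, ∫⁻ z, ENNReal.ofReal (g z) ∂F j ≤ .ofReal C)
    (π : Measure (Icc (0 : ℚ) 1 → ℕ)) [SFinite π] :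
    ∫⁻ R, ENNReal.ofReal (blockSum g R)
      ∂((π.prod (Measure.infinitePi fun i : Fin d × ℕ => F i.1)).map
        (Function.uncurry (blockOf d s t τ)))
      ≤ .ofReal C * ∫⁻ c, (c 1 : ℝ≥0∞) ∂π := by
  have hm : Measurable fun R => ENNReal.ofReal (blockSum g R) :=
    (measurable_blockSum hg).ennreal_ofReal
  have hm' : Measurable fun p =>
      ENNReal.ofReal (blockSum g (Function.uncurry (blockOf d s t τ) p)) :=
    hm.comp (measurable_blockOf d s t τ)
  have hc : Measurable fun c : Icc (0 : ℚ) 1 → ℕ => (c 1 : ℝ≥0∞) :=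
    measurable_from_nat.comp (measurable_pi_apply (1 : Icc (0 : ℚ) 1))
  rw [lintegral_map hm (measurable_blockOf d s t τ), lintegral_prod _ hm'.aemeasurable,
    ← lintegral_const_mul _ hc]
  refine lintegral_mono fun c => ?_
  have h1 : ∀ w : Fin d × ℕ → ℝ, ENNReal.ofReal (blockSum g (blockOf d s t τ c w))
      = ∑ i ∈ Finset.Icc 1 (c 1), ENNReal.ofReal (g (∑ j,
        (season d s j).indicator (fun _ => w (j, i - 1)) (t + localArrival τ c i))) := fun w => by
    rw [blockSum, ENNReal.ofReal_sum_of_nonneg fun i _ => hgn _]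
    refine Finset.sum_congr rfl fun i hi => ?_
    simp only [blockOf]
    rw [if_pos (Finset.mem_Icc.1 hi)]
  simp only [Function.uncurry_apply_pair, h1]
  rw [lintegral_finsetSum]
  · refine (Finset.sum_le_sum fun i _ => lintegral_mark_le hs hF hg hg0 hC (i - 1)
      (t + localArrival τ c i)).trans ?_
    simp [mul_comm]
  · intro i _
    refine (hg.comp (Finset.measurable_sum _ fun j _ => ?_)).ennreal_ofReal
    by_cases hj : t + localArrival τ c i ∈ season d s j
    · simpa only [indicator_of_mem hj] using measurable_pi_apply (j, i - 1)
    · simpa only [indicator_of_notMem hj] using measurable_const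

variable {Ω : Type*} [MeasurableSpace Ω] {P : Measure Ω} {N : ℝ → Ω → ℕ} {Λ : ℝ → ℝ}

lemma IsPoissonProcess.lintegral_windowPath (hN : IsPoissonProcess N Λ P) (hτ : 0 ≤ τ)
    (ht : 0 ≤ t) : ∫⁻ c, (c 1 : ℝ≥0∞) ∂P.map (windowPath N τ t)
      = ENNReal.ofReal (Λ (t + τ) - Λ t) := by
  have hc : Measurable fun n : ℕ => (n : ℝ≥0∞) := measurable_from_nat
  have h := hN.law_increment t (t + τ) ht (by linarith)
  have hl := lintegral_map hc ((hN.measurable (t + τ) (by linarith)).sub (hN.measurable t ht))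
    (μ := P)
  have hc1 : Measurable fun c : Icc (0 : ℚ) 1 → ℕ => (c 1 : ℝ≥0∞) :=
    hc.comp (measurable_pi_apply (1 : Icc (0 : ℚ) 1))
  rw [lintegral_map hc1 (hN.measurable_windowPath hτ ht)]
  have h2 : ∀ ω, windowPath N τ t ω 1 = N (t + τ) ω - N t ω := fun ω => by simp [windowPath]
  simp only [h2]
  exact hl.symm.trans ((congrArg (fun μ => ∫⁻ n : ℕ, (n : ℝ≥0∞) ∂μ) h.map_eq).trans
    (lintegral_cast_poissonMeasure _))

/-- The sum of `g ≥ 0` over the jumps of a period is integrable, and its expectation is at most the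
expected number of jumps times a bound `C` of the expectation of `g` per jump. -/
theorem IsPoissonProcess.integrable_blockSum [IsProbabilityMeasure P]
    (hN : IsPoissonProcess N Λ P) (hs : IsPeriodicPartition d s)
    (hF : ∀ j, IsProbabilityMeasure (F j)) (hτ : 0 ≤ τ) (ht : 0 ≤ t) (hg : Measurable g)
    (hg0 : g 0 = 0) (hgn : ∀ z, 0 ≤ g z) (hgi : ∀ j, Integrable g (F j))
    (hC : ∀ j, ∫ z, g z ∂F j ≤ C) :
    Integrable (blockSum g)
        (((P.map (windowPath N τ t)).prod (Measure.infinitePi fun i : Fin d × ℕ => F i.1)).map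
          (Function.uncurry (blockOf d s t τ))) ∧
      ∫ R, blockSum g R
        ∂(((P.map (windowPath N τ t)).prod (Measure.infinitePi fun i : Fin d × ℕ => F i.1)).map
          (Function.uncurry (blockOf d s t τ))) ≤ C * max (Λ (t + τ) - Λ t) 0 := by
  have hC0 : 0 ≤ C := (integral_nonneg hgn).trans (hC ⟨0, hs.d_pos⟩)
  have hCl : ∀ j, ∫⁻ z, ENNReal.ofReal (g z) ∂F j ≤ .ofReal C := fun j => by
    rw [← ofReal_integral_eq_lintegral_ofReal (hgi j) (ae_of_all _ hgn)]
    exact ENNReal.ofReal_le_ofReal (hC j)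
  have h := lintegral_blockSum_le (t := t) (τ := τ) hs hF hg hg0 hgn hCl (P.map (windowPath N τ t))
  rw [hN.lintegral_windowPath hτ ht, ← ENNReal.ofReal_mul hC0] at h
  have hb0 : ∀ R, 0 ≤ blockSum g R := fun R => Finset.sum_nonneg fun i _ => hgn _
  have hbm := (measurable_blockSum hg).aestronglyMeasurable (μ :=
    (((P.map (windowPath N τ t)).prod (Measure.infinitePi fun i : Fin d × ℕ => F i.1)).map
          (Function.uncurry (blockOf d s t τ))))
  refine ⟨⟨hbm, ?_⟩, ?_⟩
  · rw [hasFiniteIntegral_iff_ofReal (ae_of_all _ hb0)]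
    exact h.trans_lt ENNReal.ofReal_lt_top
  · rw [integral_eq_lintegral_of_nonneg_ae (ae_of_all _ hb0) hbm]
    refine ENNReal.toReal_le_of_le_ofReal (mul_nonneg hC0 (le_max_right _ _)) (h.trans ?_)
    exact ENNReal.ofReal_le_ofReal (mul_le_mul_of_nonneg_left (le_max_left _ _) hC0)

end BlockExpectation

/-! ### Periodicity of the intensity -/

section Periodicity

variable {d : ℕ} {s : ℕ → ℝ} (lam : Fin d → ℝ)

lemma intervalIntegrable_intensity (a b : ℝ) :
    IntervalIntegrable (intensity d s lam) volume a b := by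
  rw [intervalIntegrable_iff]
  exact integrable_finsetSum _ fun j _ =>
    (intervalIntegrable_iff.1 intervalIntegrable_const).indicator (measurableSet_season d s j)

lemma IsPeriodicPartition.cumIntensity_add_mul_period_sub (hs : IsPeriodicPartition d s) (m : ℕ)
    {u v : ℝ} (hu : 0 ≤ u) (huv : u ≤ v) :
    cumIntensity d s lam (v + m * period d s) - cumIntensity d s lam (u + m * period d s)
      = cumIntensity d s lam v - cumIntensity d s lam u := by
  have hi := intervalIntegrable_intensity (s := s) lam
  simp only [cumIntensity]
  rw [intervalIntegral.integral_interval_sub_left (hi _ _) (hi _ _),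
    intervalIntegral.integral_interval_sub_left (hi _ _) (hi _ _),
    ← intervalIntegral.integral_comp_add_right]
  refine intervalIntegral.integral_congr_ae (ae_of_all _ fun x hx => ?_)
  rw [uIoc_of_le huv] at hx
  refine Finset.sum_congr rfl fun j _ => ?_
  by_cases h : x ∈ season d s j
  · rw [indicator_of_mem h, indicator_of_mem ((hs.add_mem_season_iff j m (hu.trans_lt hx.1)).2 h)]
  · rw [indicator_of_notMem h,
      indicator_of_notMem fun h' => h ((hs.add_mem_season_iff j m (hu.trans_lt hx.1)).1 h')]

end Periodicity

/-! ### The affine recurrence over one period -/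

section Contraction

variable {Ω : Type*} [MeasurableSpace Ω] {P : Measure Ω} {q : ℕ} {α β : ℕ → ℝ}

lemma solvesRecurrence_iff_transfer_eq [SFinite P] {R : Ω → MarkedBlock} (hR : Measurable R)
    (τ : ℝ) (ν : Measure (Fin q → ℝ)) [SFinite ν] :
    SolvesRecurrence P (fun ω => blockJ q α β τ (R ω)) (fun ω => blockK q α β τ (R ω)) ν ↔
      transfer (blockMap q α β τ) (P.map R) ν = ν := by
  have hRi : Measurable (Prod.map R (id : (Fin q → ℝ) → Fin q → ℝ)) := hR.prodMap measurable_id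
  have hf := measurable_blockMap (q := q) (α := α) (β := β) τ
  have h : transfer (blockMap q α β τ) (P.map R) ν
      = (P.prod ν).map fun x : Ω × (Fin q → ℝ) =>
        blockJ q α β τ (R x.1) *ᵥ x.2 + blockK q α β τ (R x.1) := by
    have h1 := Measure.map_prod_map P ν hR measurable_id
    rw [Measure.map_id] at h1
    rw [transfer, h1, Measure.map_map hf hRi]
    rfl
  rw [h]
  exact ⟨fun h => h.map_eq, fun h => ⟨(hf.comp hRi).aemeasurable, h⟩⟩

lemma log_one_add_mul_sq_nonneg {c : ℝ} (hc : 0 ≤ c) (z : ℝ) : 0 ≤ Real.log (1 + c * z ^ 2) :=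
  Real.log_nonneg (le_add_of_nonneg_right (mul_nonneg hc (sq_nonneg z)))

lemma measurable_log_one_add_mul_sq (c : ℝ) : Measurable fun z : ℝ => Real.log (1 + c * z ^ 2) :=
  Real.measurable_log.comp (measurable_const.add ((measurable_id.pow_const 2).const_mul c))

lemma integrable_log_one_add_mul_sq {ν : Measure ℝ} (h : Integrable (fun z : ℝ => z ^ 2) ν)
    {c : ℝ} (hc : 0 ≤ c) : Integrable (fun z : ℝ => Real.log (1 + c * z ^ 2)) ν := by
  refine (h.const_mul c).mono' (measurable_log_one_add_mul_sq c).aestronglyMeasurable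
    (ae_of_all _ fun z => ?_)
  rw [Real.norm_of_nonneg (log_one_add_mul_sq_nonneg hc z)]
  have := Real.log_le_sub_one_of_pos
    (show 0 < 1 + c * z ^ 2 by have := mul_nonneg hc (sq_nonneg z); linarith)
  linarith

/-- If the flow contracts enough, compared with the expected logarithmic expansion at the jumps of
a period, the state process converges in distribution along the times `t + m τ`. -/
theorem IsSemiLevyCompoundPoisson.exists_limit_law [IsProbabilityMeasure P] {d : ℕ} {s : ℕ → ℝ}
    {lam : Fin d → ℝ} {F : Fin d → Measure ℝ} {N : ℝ → Ω → ℕ} {Z : Fin d → ℕ → Ω → ℝ}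
    (hS : IsSemiLevyCompoundPoisson d s lam F N Z P) {η κ K : ℝ} {nrm : (Fin q → ℝ) → ℝ}
    (hn : IsAdaptedNorm q α β η κ nrm) (hK : 0 ≤ K) (hnK : ∀ v, ‖v‖ ≤ K * nrm v) (hη : η < 0)
    (hα : 0 ≤ α 0) {t : ℝ} (ht : 0 ≤ t)
    (hlog : ∀ j : Fin d, 0 < cumIntensity d s lam (t + period d s) - cumIntensity d s lam t →
      ∫ z, Real.log (1 + κ * z ^ 2) ∂(F j)
        < -(η * period d s) / (cumIntensity d s lam (t + period d s) - cumIntensity d s lam t))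
    {Y : ℝ → Ω → Fin q → ℝ} (hYm : ∀ u, 0 ≤ u → Measurable (Y u))
    (hY : ∀ᵐ ω ∂P, ∀ u v, 0 ≤ u → u ≤ v →
      Y v ω = coeffJ q α β d s N Z u v ω *ᵥ Y u ω + coeffK q α β d s N Z u v ω) :
    ∃ μ : ProbabilityMeasure (Fin q → ℝ),
      TendstoInDistribution (fun (m : ℕ) ω => Y (t + m * period d s) ω) atTop
        (id : (Fin q → ℝ) → (Fin q → ℝ)) (fun _ => P) (μ : Measure (Fin q → ℝ)) ∧
      SolvesRecurrence P (coeffJ q α β d s N Z t (t + period d s))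
        (coeffK q α β d s N Z t (t + period d s)) (μ : Measure (Fin q → ℝ)) ∧
      ∀ ν : ProbabilityMeasure (Fin q → ℝ),
        SolvesRecurrence P (coeffJ q α β d s N Z t (t + period d s))
          (coeffK q α β d s N Z t (t + period d s)) (ν : Measure (Fin q → ℝ)) → ν = μ := by
  have hs := hS.partition
  have hN := hS.poisson
  have hF := hS.prob
  have hτ := hs.period_pos
  have : Nonempty (Fin d) := ⟨⟨0, hs.d_pos⟩⟩
  set τ := period d s with hτdef
  have hiid := hN.isIIDSeq_markedBlock (s := s) ht hτ.le (fun m v v' hv hvv' _ => by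
    have := hs.cumIntensity_add_mul_period_sub lam m (add_nonneg ht hv)
      (add_le_add_right hvv' t)
    rw [add_right_comm t _ v, add_right_comm t _ v']
    exact this) hS.measurable_jump hS.indep_jumps (fun j n => (hS.law_jump j n).map_eq)
    hS.indep_counting
  set ρ := ((P.map (windowPath N τ t)).prod (Measure.infinitePi fun i : Fin d × ℕ => F i.1)).map
    (Function.uncurry (blockOf d s t τ))
  have : IsProbabilityMeasure ρ := hiid.isProbabilityMeasure
  have hκ := hn.kappa_nonneg
  set c := α 0 * nrm (eVec q) with hc
  have hc0 : 0 ≤ c := mul_nonneg hα (hn.nonneg _)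
  have hgi := fun j => integrable_log_one_add_mul_sq (hS.secondMoment j) hκ
  have hgi' := fun j => (hgi j).add (integrable_log_one_add_mul_sq (hS.secondMoment j) hc0)
  -- the seasons with the largest expectations per jump
  obtain ⟨j₀, hj₀⟩ := Finite.exists_max fun j => ∫ z, Real.log (1 + κ * z ^ 2) ∂F j
  obtain ⟨j₁, hj₁⟩ := Finite.exists_max fun j =>
    ∫ z, (Real.log (1 + κ * z ^ 2) + Real.log (1 + c * z ^ 2)) ∂F j
  have hm := (measurable_log_one_add_mul_sq κ)
  have hm' := hm.add (measurable_log_one_add_mul_sq c)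
  obtain ⟨hLi, hLle⟩ := hN.integrable_blockSum hs hF hτ.le ht hm (by simp)
    (log_one_add_mul_sq_nonneg hκ) hgi hj₀
  obtain ⟨hGi, -⟩ := hN.integrable_blockSum hs hF hτ.le ht hm' (by simp)
    (fun z => add_nonneg (log_one_add_mul_sq_nonneg hκ z) (log_one_add_mul_sq_nonneg hc0 z))
    hgi' hj₁
  have hT : ∀ ω i, IsTimeSeq τ (markedBlock d s N Z t τ i ω).2.1 := fun ω i =>
    isTimeSeq_localArrival hτ.le _
  obtain ⟨μ, h1, h2, h3⟩ := hiid.exists_stationary_law (f := blockMap q α β τ)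
    (measurable_blockMap τ) (continuous_blockMap τ) hK hnK
    (L := fun R => η * τ + blockSum (fun z => Real.log (1 + κ * z ^ 2)) R)
    (G := blockSum fun z => Real.log (1 + κ * z ^ 2) + Real.log (1 + c * z ^ 2))
    (fun ω i x y => by
      rw [blockMap, blockMap, add_sub_add_right_eq_sub, ← Matrix.mulVec_sub]
      exact hn.blockJ_le (hT ω i) _)
    (fun ω i => by
      rw [blockMap, Matrix.mulVec_zero, zero_add]
      exact hn.blockK_le hη.le hα (hT ω i))
    (measurable_const.add (measurable_blockSum hm)) (measurable_blockSum hm')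
    ((integrable_const _).add hLi) hGi
    (by
      rw [integral_add (integrable_const _) hLi, integral_const, probReal_univ, one_smul]
      refine (add_le_add_right hLle _).trans_lt ?_
      -- without jumps in a period, only the contraction by the flow is left
      rcases lt_or_ge 0 (cumIntensity d s lam (t + τ) - cumIntensity d s lam t) with hpos | hle
      · have := (lt_div_iff₀ hpos).1 (hlog j₀ hpos)
        rw [max_eq_left hpos.le]
        linarith
      · rw [max_eq_right hle, mul_zero, add_zero]
        exact mul_neg_of_neg_of_pos hη hτ)
    (fun m => Y (t + m * τ)) (fun m => hYm _ (by positivity))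
    (by
      filter_upwards [hY] with ω hω m
      have h := hω (t + m * τ) (t + m * τ + τ) (by positivity) (by linarith)
      rw [hN.coeffJ_eq_blockJ hs ht, hN.coeffK_eq_blockK hs ht] at h
      rw [show t + ((m + 1 : ℕ) : ℝ) * τ = t + m * τ + τ by push_cast; ring]
      exact h)
  have hJ : coeffJ q α β d s N Z t (t + τ)
      = fun ω => blockJ q α β τ (markedBlock d s N Z t τ 0 ω) := funext fun ω => by
    simpa using hN.coeffJ_eq_blockJ (Z := Z) (α := α) (β := β) (q := q) hs ht 0 ω
  have hKb : coeffK q α β d s N Z t (t + τ)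
      = fun ω => blockK q α β τ (markedBlock d s N Z t τ 0 ω) := funext fun ω => by
    simpa using hN.coeffK_eq_blockK (Z := Z) (α := α) (β := β) (q := q) hs ht 0 ω
  have hiff : ∀ ν : ProbabilityMeasure (Fin q → ℝ),
      SolvesRecurrence P (coeffJ q α β d s N Z t (t + τ)) (coeffK q α β d s N Z t (t + τ))
        (ν : Measure (Fin q → ℝ)) ↔ transfer (blockMap q α β τ) ρ (ν : Measure (Fin q → ℝ)) = ν :=
    fun ν => by
      rw [hJ, hKb, solvesRecurrence_iff_transfer_eq (hiid.measurable 0), hiid.map_eq]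
  exact ⟨μ, h1, (hiff μ).2 h2, fun ν hν => h3 ν ((hiff ν).1 hν)⟩

end Contraction

end SLDCogarch

end

open SLDCogarch in
theorem theorem3p2 {Ω : Type*} [MeasurableSpace Ω] (P : Measure Ω) [IsProbabilityMeasure P]
    -- the driving semi-Lévy compound Poisson process
    (d : ℕ) (s : ℕ → ℝ) (lam : Fin d → ℝ) (F : Fin d → Measure ℝ)
    (N : ℝ → Ω → ℕ) (Z : Fin d → ℕ → Ω → ℝ) (δ : ℝ)
    (hS : IsSemiLevyCompoundPoisson d s lam F N Z P)
    -- the parameters and the state process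
    (p q : ℕ) (α β : ℕ → ℝ) (hαβ : IsCogarchParam p q α β)
    (Y : ℝ → Ω → Fin q → ℝ)
    (hY : IsStateProcess q α β (drivingProcess d s N Z δ) Y P)
    -- the eigenvalues are distinct, with strictly negative real parts
    (hdistinct : (eigenvalues (companion q β)).Nodup)
    (hneg : ∀ z ∈ eigenvalues (companion q β), z.re < 0)
    -- the logarithmic moment condition, for some diagonalising matrix and some `r ∈ [1, ∞]`
    (hlog : ∃ (r : ℝ≥0∞) (M : Matrix (Fin q) (Fin q) ℂ), 1 ≤ r ∧ IsUnit M ∧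
      (M⁻¹ * toComplex (companion q β) * M).IsDiag ∧
      ∀ t ∈ Icc 0 (period d s), ∀ j : Fin d,
        0 < cumIntensity d s lam (t + period d s) - cumIntensity d s lam t →
        ∫ z, Real.log (1 + matrixLpNorm r
            (M⁻¹ * toComplex (Matrix.vecMulVec (eVec q) (aVec q α)) * M) * z ^ 2) ∂(F j)
          < -(maxRe (companion q β) * period d s) /
              (cumIntensity d s lam (t + period d s) - cumIntensity d s lam t)) :
    ∀ t ∈ Ico 0 (period d s), ∃ μ : ProbabilityMeasure (Fin q → ℝ),
      TendstoInDistribution (fun (m : ℕ) ω => Y (t + m * period d s) ω) atTop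
        (id : (Fin q → ℝ) → (Fin q → ℝ)) (fun _ => P) (μ : Measure (Fin q → ℝ)) ∧
      SolvesRecurrence P (coeffJ q α β d s N Z t (t + period d s))
        (coeffK q α β d s N Z t (t + period d s)) (μ : Measure (Fin q → ℝ)) ∧
      ∀ ν : ProbabilityMeasure (Fin q → ℝ),
        SolvesRecurrence P (coeffJ q α β d s N Z t (t + period d s))
          (coeffK q α β d s N Z t (t + period d s)) (ν : Measure (Fin q → ℝ)) → ν = μ := by
  intro t ht
  obtain ⟨r, M, hr, hM, hB, hlog⟩ := hlog
  have : Fact (1 ≤ r) := ⟨hr⟩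
  obtain ⟨K, hK, hnK⟩ := exists_norm_le_diagNorm (r := r) hM
  refine hS.exists_limit_law (isAdaptedNorm_diagNorm (r := r) hM hB) hK hnK
    (maxRe_neg (hαβ.one_le_p.trans hαβ.p_le_q) hneg) hαβ.alpha_zero.le ht.1
    (hlog t ⟨ht.1, ht.2.le⟩) hY.measurable ?_
  filter_upwards [hY.rightCont, hY.leftLimits, hY.sde] with ω h1 h2 h3 u v hu huv
  exact hS.poisson.state_recurrence h1 h2 h3 hu huv
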